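/- Let $d\ge 2$, let $\mathbb D\subset\mathbb R^d$ be the open unit disk, $\overline{\mathbb D}$ its closure, and let $S^d$ be the standard round sphere, oriented so that the inverse stereographic projection $\sigma_0:\mathbb R^d\to S^d$ is orientation preserving. For $n\ge 0$ let $\mathrm{Mfld}^{\mathbb D}_n(S^d)$ be the set of $n$-tuples $f=(f_1,\dots,f_n)$ of germs along $\overline{\mathbb D}$ of maps to $S^d$ which are represented by smooth, orientation-preserving conformal injective maps $f_i:V_i\to S^d$ on open neighbourhoods $V_i$ of $\overline{\mathbb D}$ with pairwise disjoint images $f_i(V_i)$. Let $\mathbb{CE}_d(n)$ be the analogous set with $\mathbb R^d$ in place of $S^d$ and the additional condition $f_i(\overline{\mathbb D})\subset\overline{\mathbb D}$; with the partial compositions $\circ_i$, permutations of the disks, and the identity germ this is an operad, and composition with $\sigma_0$ maps $\mathbb{CE}_d(n)$ into $\mathrm{Mfld}^{\mathbb D}_n(S^d)$. Write $r^D\in\mathbb{CE}_d(1)$ for $x\mapsto rx$ ($0<r\le 1$), and $\mathbb G_d=\{g\in \mathrm{SO}^+(d+1,1)\mid g(\mathbb D)=\mathbb D\}\subset\mathbb{CE}_d(1)$,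 acting by Möbius transformations. Let $(V,\rho)$ be a $\mathbb{CE}_d$-algebra in complex vector spaces: linear maps $\rho_f=\rho_n(f):V^{\otimes n}\to V$ for $f\in\mathbb{CE}_d(n)$, compatible with $\circ_i$, permutations and the unit. Let $\mathbf 1=\rho_0(\ast)$, where $\ast\in\mathbb{CE}_d(0)$ is the empty configuration. Assume that $(V,\rho)$ has a Hilbert space filtration: subspaces $H^0\subset H^1\subset\cdots$ with $V=\bigcup_k H^k$ and $\mathbf 1\in H^0$, and compatible positive definite Hermitian inner products (linear in the second variable) making each $H^k$ a separable Hilbert space, such that $\rho_1(g)H^k\subset H^k$ for all $g\in\mathbb{CE}_d(1)$, and such that for all $n$ and $k_1,\dots,k_n$ there is $K$ such that, for every $f\in\mathbb{CE}_d(n)$, $\rho_n(f)$ maps $H^{k_1}\otimes\cdots\otimes H^{k_n}$ into $H^K$ and is bounded there for the Hilbert space norm of the algebraic tensor product. Assume moreover, for every $k$: * (U) $g\mapsto\rho_1(g)|_{H^k}$, $g\in\mathbb G_d$, takes values in the unitary operators of $H^k$ and is strongly continuous. * (D) For $0<r<1$ the operator $\rho_1(r^D)|_{H^k}$ is a self-adjoint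 Hilbert–Schmidt contraction; $\rho_1(r^D)v\to v$ as $r\to1$ for all $v\in H^k$; and for each $0<r<1$ there is $M(r)>0$, independent of $k$, with $\sum_i\|\rho_1(r^D)e_i\|^2\le M(r)$ for an orthonormal basis $(e_i)$ of $H^k$. A *state* on $S^d$ is a family of maps $\chi:\mathrm{Mfld}^{\mathbb D}_n(S^d)\to\mathrm{Hom}_{\mathbb C}(V^{\otimes n},\mathbb C)$, $n\ge0$, with $\chi(f\circ_i\phi)=\chi(f)\circ_i\rho_m(\phi)$ for all $n\ge 1$, $m\ge 0$, $f\in\mathrm{Mfld}^{\mathbb D}_n(S^d)$, $\phi\in\mathbb{CE}_d(m)$, $1\le i\le n$, and equivariant under permutations of the disks. It is *conformally invariant* if $\chi(\phi f_1,\dots,\phi f_n)=\chi(f_1,\dots,f_n)$ for every orientation-preserving conformal diffeomorphism $\phi$ of $S^d$, and *continuous* if every restriction $\chi(f)|_{H^{k_1}\otimes\cdots\otimes H^{k_n}}$ is bounded for the Hilbert space norm of the algebraic tensor product. Then there is a unique state $\chi_S$ on $S^d$ such that 1. $\chi_S$ is conformally invariant; 2. $\chi_S(\sigma_0\circ f)(a_1,\dots,a_n)=\langle\mathbf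 1,\rho_f(a_1,\dots,a_n)\rangle$ for all $n\ge0$, $f\in\mathbb{CE}_d(n)$ and $a_1,\dots,a_n\in V$. Moreover $\chi_S$ is continuous, and $\chi_S(\emptyset)\ne0$ if $V\neq 0$. -/

import Mathlib

open scoped Manifold ContDiff Topology InnerProductSpace

noncomputable section

namespace ConfDisk

/-! ## Spaces -/

/-- Euclidean space `ℝ^d` with the standard metric. -/
abbrev E (d : ℕ) := EuclideanSpace ℝ (Fin d)

/-- The closed unit disk, the core of the object `(ℝ^d, g_std, closed disk)`. -/
abbrev cDisk (d : ℕ) : Set (E d) := Metric.closedBall 0 1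

/-- The standard sphere `S^d ⊂ ℝ^{d+1}`. -/
abbrev Sph (d : ℕ) := Metric.sphere (0 : E (d + 1)) 1

/-- The determinant of `(p, w_1, …, w_d)` in `ℝ^{d+1}`.  For `p ∈ S^d`, a frame `w` of the tangent
space at `p` is positively oriented if this number is positive (outward normal first). -/
def orient {d : ℕ} (p : E (d + 1)) (w : Fin d → E (d + 1)) : ℝ :=
  (EuclideanSpace.basisFun (Fin (d + 1)) ℝ).toBasis.det (Matrix.vecCons p w)

/-! ## Orientation-preserving conformal maps on open subsets of `ℝ^d` -/

/-- `f` restricts to an orientation-preserving conformal map `V → ℝ^d` on the open set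
`V ⊆ ℝ^d`. -/
structure FlatConf {d : ℕ} (f : E d → E d) (V : Set (E d)) : Prop where
  isOpen : IsOpen V
  smooth : ContDiffOn ℝ ∞ f V
  conformal : ∀ x ∈ V, ConformalAt f x
  oriented : ∀ x ∈ V, 0 < (fderiv ℝ f x).det

/-- `f` restricts to an orientation-preserving conformal map `V → S^d` on the open set
`V ⊆ ℝ^d`, where `S^d` carries the metric induced from `ℝ^{d+1}`. -/
structure SphConf {d : ℕ} (f : E d → Sph d) (V : Set (E d)) : Prop where
  isOpen : IsOpen V
  smooth : ContMDiffOn 𝓘(ℝ, E d) (𝓡 d) ∞ f V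
  conformal : ∀ x ∈ V, ConformalAt (fun y => (f y : E (d + 1))) x
  oriented : ∀ x ∈ V, 0 < orient (f x : E (d + 1)) (fun i =>
    fderiv ℝ (fun y => (f y : E (d + 1))) x (EuclideanSpace.basisFun (Fin d) ℝ i))

/-! ## Germs of disk configurations -/

/-- Germs of maps along the closed unit disk: two maps are identified if they agree on a
neighbourhood of the closed disk. -/
abbrev DGerm (d : ℕ) (Y : Type) := (𝓝ˢ (cDisk d)).Germ Y

/-- `F` represents a morphism from the disjoint union of `n` closed disks to a target with
underlying set `Y` and core `M`: the `F i` are orientation-preserving conformal maps (as specified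
by `conf`) on open neighbourhoods `V i` of the closed disk, they are jointly injective on the
disjoint union of the `V i`, and they map the closed disk into the core.  (An injective conformal
map between manifolds of the same dimension is an open embedding.) -/
structure IsRep {d : ℕ} {Y : Type} (conf : (E d → Y) → Set (E d) → Prop) (M : Set Y)
    {n : ℕ} (F : Fin n → E d → Y) (V : Fin n → Set (E d)) : Prop where
  conf : ∀ i, conf (F i) (V i)
  subset : ∀ i, cDisk d ⊆ V i
  injOn : ∀ i, Set.InjOn (F i) (V i)
  disjoint : ∀ i j, i ≠ j → Disjoint (F i '' V i) (F j '' V j)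
  mapsTo : ∀ i, Set.MapsTo (F i) (cDisk d) M

/-- Morphisms from the disjoint union of `n` closed disks to `(Y, M)`: tuples of germs along the
closed disk that come from one conformal open embedding of a neighbourhood of all the disks. -/
def Config {d : ℕ} {Y : Type} (conf : (E d → Y) → Set (E d) → Prop) (M : Set Y) (n : ℕ) :=
  {f : Fin n → DGerm d Y // ∃ F V, IsRep conf M F V ∧ ∀ i, f i = (F i : DGerm d Y)}

/-- The conformally flat `d`-disk operad, in arity `n`. -/
abbrev CE (d n : ℕ) := Config (FlatConf (d := d)) (cDisk d) n

/-- Configurations of `n` disks in the sphere. -/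
abbrev SConf (d n : ℕ) := Config (SphConf (d := d)) Set.univ n

/-- The empty configuration. -/
def Config.empty {d : ℕ} {Y : Type} (conf : (E d → Y) → Set (E d) → Prop) (M : Set Y) :
    Config conf M 0 :=
  ⟨Fin.elim0, Fin.elim0, Fin.elim0,
    ⟨fun i => i.elim0, fun i => i.elim0, fun i => i.elim0, fun i => i.elim0, fun i => i.elim0⟩, fun i => i.elim0⟩

/-- Permuting the disks: `(f_1, …, f_n) ↦ (f_{σ 1}, …, f_{σ n})`. -/
def Config.perm {d : ℕ} {Y : Type} {conf : (E d → Y) → Set (E d) → Prop} {M : Set Y} {n : ℕ}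
    (f : Config conf M n) (σ : Equiv.Perm (Fin n)) : Config conf M n :=
  ⟨fun i => f.1 (σ i), by
    obtain ⟨F, V, h, hf⟩ := f.2
    exact ⟨fun i => F (σ i), fun i => V (σ i),
      ⟨fun i => h.conf _, fun i => h.subset _, fun i => h.injOn _,
        fun i j hij => h.disjoint _ _ fun e => hij (σ.injective e), fun i => h.mapsTo _⟩,
      fun i => hf _⟩⟩

/-! ## Partial composition -/

/-- The tuple `(g_1, …, g_{i-1}, f_1, …, f_m, g_{i+1}, …, g_n)` of length `N = n + m - 1`. -/
def splice {X : Type*} {n m N : ℕ} (h : N + 1 = n + m) (i : Fin n) (g : Fin n → X)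
    (f : Fin m → X) (k : Fin N) : X :=
  if h₁ : k.1 < i.1 then g ⟨k.1, by omega⟩
  else if h₂ : k.1 < i.1 + m then f ⟨k.1 - i.1, by omega⟩
  else g ⟨k.1 + 1 - m, by omega⟩

/-- The entries `(a_i, …, a_{i+m-1})` of a tuple of length `N = n + m - 1`. -/
def block {X : Type*} {n m N : ℕ} (h : N + 1 = n + m) (i : Fin n) (a : Fin N → X)
    (k : Fin m) : X :=
  a ⟨i.1 + k.1, by omega⟩

/-- The tuple `(a_1, …, a_{i-1}, b, a_{i+m}, …, a_N)` of length `n`, for `N = n + m - 1`. -/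
def plug {X : Type*} {n m N : ℕ} (h : N + 1 = n + m) (i : Fin n) (a : Fin N → X) (b : X)
    (j : Fin n) : X :=
  if h₁ : j.1 < i.1 then a ⟨j.1, by omega⟩
  else if h₂ : j.1 = i.1 then b
  else a ⟨j.1 + m - 1, by omega⟩

theorem splice_forall {X : Type*} {n m N : ℕ} (h : N + 1 = n + m) (i : Fin n) (g : Fin n → X)
    (f : Fin m → X) (P : X → Prop) (hg : ∀ j, j ≠ i → P (g j)) (hf : ∀ j, P (f j)) (k : Fin N) :
    P (splice h i g f k) := by
  unfold splice
  split_ifs with h₁ h₂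
  · exact hg _ (by simp only [ne_eq, Fin.ext_iff]; omega)
  · exact hf _
  · exact hg _ (by simp only [ne_eq, Fin.ext_iff]; omega)

theorem splice_pairwise {X : Type*} {n m N : ℕ} (h : N + 1 = n + m) (i : Fin n) (g : Fin n → X)
    (f : Fin m → X) (R : X → X → Prop) (hR : ∀ x y, R x y → R y x)
    (hg : ∀ j k, j ≠ k → R (g j) (g k)) (hf : ∀ j k, j ≠ k → R (f j) (f k))
    (hgf : ∀ j k, j ≠ i → R (g j) (f k)) (k l : Fin N) (hkl : k ≠ l) :
    R (splice h i g f k) (splice h i g f l) := by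
  have hkl' : k.1 ≠ l.1 := fun e => hkl (Fin.ext e)
  unfold splice
  split_ifs
  all_goals first
    | exact hg _ _ (by simp only [ne_eq, Fin.ext_iff]; omega)
    | exact hf _ _ (by simp only [ne_eq, Fin.ext_iff]; omega)
    | exact hgf _ _ (by simp only [ne_eq, Fin.ext_iff]; omega)
    | exact hR _ _ (hgf _ _ (by simp only [ne_eq, Fin.ext_iff]; omega))

theorem splice_map {X Z : Type*} {n m N : ℕ} (h : N + 1 = n + m) (i : Fin n) (g : Fin n → X)
    (f : Fin m → X) (q : X → Z) (k : Fin N) :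
    q (splice h i g f k) = splice h i (fun j => q (g j)) (fun j => q (f j)) k := by
  unfold splice
  split_ifs <;> rfl

theorem FlatConf.tendsto {d : ℕ} {f : E d → E d} {V : Set (E d)} (hf : FlatConf f V)
    (hV : cDisk d ⊆ V) (hm : Set.MapsTo f (cDisk d) (cDisk d)) :
    Filter.Tendsto f (𝓝ˢ (cDisk d)) (𝓝ˢ (cDisk d)) := by
  intro U hU
  rw [Filter.mem_map, mem_nhdsSet_iff_forall]
  rw [mem_nhdsSet_iff_forall] at hU
  intro x hx
  exact (hf.smooth.continuousOn.continuousAt (hf.isOpen.mem_nhds (hV hx))) (hU _ (hm hx))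

theorem CE.tendsto {d n : ℕ} (f : CE d n) (i : Fin n) : (f.1 i).Tendsto (𝓝ˢ (cDisk d)) := by
  obtain ⟨F, V, h, hf⟩ := f.2
  rw [hf i]
  exact (h.conf i).tendsto (h.subset i) (h.mapsTo i)

/-- The class `conf` of conformal maps is closed under precomposition with conformal maps
of domains of `ℝ^d`. -/
def Precomp {d : ℕ} {Y : Type} (conf : (E d → Y) → Set (E d) → Prop) : Prop :=
  ∀ f V h W, conf f V → FlatConf h W → conf (f ∘ h) (W ∩ h ⁻¹' V)

theorem germ_comp {d : ℕ} {Y : Type} (f : DGerm d Y) (g : DGerm d (E d))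
    (hg : g.Tendsto (𝓝ˢ (cDisk d))) (F : E d → Y) (G : E d → E d) (e : f = (F : DGerm d Y))
    (e' : g = (G : DGerm d (E d))) : f.compTendsto' g hg = ((F ∘ G : E d → Y) : DGerm d Y) := by
  subst e
  subst e'
  rfl

/-- The partial composition `f ∘_i g`. -/
def Config.circ {d : ℕ} {Y : Type} {conf : (E d → Y) → Set (E d) → Prop} {M : Set Y}
    (hconf : Precomp conf) {n m N : ℕ} (hN : N + 1 = n + m) (f : Config conf M n) (i : Fin n)
    (g : CE d m) : Config conf M N :=
  ⟨splice hN i f.1 (fun k => (f.1 i).compTendsto' (g.1 k) (CE.tendsto g k)), by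
    obtain ⟨F, V, h, hf⟩ := f.2
    obtain ⟨G, W, h', hg⟩ := g.2
    let P : Fin n → (E d → Y) × Set (E d) := fun j => (F j, V j)
    let Q : Fin m → (E d → Y) × Set (E d) := fun k => (F i ∘ G k, W k ∩ G k ⁻¹' V i)
    have hQ : ∀ k, (Q k).1 '' (Q k).2 ⊆ F i '' V i := by
      rintro k _ ⟨x, hx, rfl⟩
      exact ⟨G k x, hx.2, rfl⟩
    have hS := splice_forall hN i P Q
      (fun p => conf p.1 p.2 ∧ cDisk d ⊆ p.2 ∧ Set.InjOn p.1 p.2 ∧ Set.MapsTo p.1 (cDisk d) M)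
      (fun j _ => ⟨h.conf j, h.subset j, h.injOn j, h.mapsTo j⟩)
      (fun k => ⟨hconf _ _ _ _ (h.conf i) (h'.conf k),
        fun x hx => ⟨h'.subset k hx, h.subset i (h'.mapsTo k hx)⟩,
        fun x hx y hy e => h'.injOn k hx.1 hy.1 (h.injOn i hx.2 hy.2 e),
        fun x hx => h.mapsTo i (h'.mapsTo k hx)⟩)
    have hD := splice_pairwise hN i P Q (fun p q => Disjoint (p.1 '' p.2) (q.1 '' q.2))
      (fun _ _ e => e.symm) (fun j k hjk => h.disjoint j k hjk)
      (fun j k hjk => by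
        rw [Set.disjoint_left]
        rintro _ ⟨x, hx, rfl⟩ ⟨y, hy, hxy⟩
        have e : G k y = G j x := h.injOn i hy.2 hx.2 hxy
        exact Set.disjoint_left.1 (h'.disjoint j k hjk) ⟨x, hx.1, rfl⟩ ⟨y, hy.1, e⟩)
      (fun j k hj => (h.disjoint j i hj).mono_right (hQ k))
    refine ⟨fun k => (splice hN i P Q k).1, fun k => (splice hN i P Q k).2,
      ⟨fun k => (hS k).1, fun k => (hS k).2.1, fun k => (hS k).2.2.1,
        fun k l => hD k l, fun k => (hS k).2.2.2⟩, ?_⟩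
    intro k
    have e := splice_map hN i P Q (fun p => (p.1 : DGerm d Y)) k
    refine Eq.trans ?_ e.symm
    unfold splice
    split_ifs
    · exact hf _
    · exact germ_comp _ _ _ (F i) (G _) (hf i) (hg _)
    · exact hf _⟩

theorem FlatConf.precomp (d : ℕ) : Precomp (FlatConf (d := d)) := by
  intro f V h W hf hh
  refine ⟨hh.smooth.continuousOn.isOpen_inter_preimage hh.isOpen hf.isOpen,
    hf.smooth.comp (hh.smooth.mono Set.inter_subset_left) Set.inter_subset_right,
    fun x hx => (hf.conformal _ hx.2).comp x (hh.conformal _ hx.1), fun x hx => ?_⟩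
  rw [fderiv_comp x (hf.conformal _ hx.2).differentiableAt (hh.conformal _ hx.1).differentiableAt]
  have := mul_pos (hf.oriented _ hx.2) (hh.oriented _ hx.1)
  rw [ContinuousLinearMap.det, ContinuousLinearMap.det] at this
  rw [← LinearMap.det_comp] at this
  exact this

/-- The orientation form composed with a linear map of tangent frames. -/
theorem orient_comp {d : ℕ} (p : E (d + 1)) (A : E d →L[ℝ] E (d + 1)) (B : E d →L[ℝ] E d) :
    orient p (fun i => (A.comp B) (EuclideanSpace.basisFun (Fin d) ℝ i)) =
      B.det * orient p (fun i => A (EuclideanSpace.basisFun (Fin d) ℝ i)) := by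
  let b := (EuclideanSpace.basisFun (Fin d) ℝ).toBasis
  let η := ((EuclideanSpace.basisFun (Fin (d + 1)) ℝ).toBasis.det.curryLeft p).compLinearMap
    (A : E d →ₗ[ℝ] E (d + 1))
  have h₁ : ∀ v : Fin d → E d, η v = η b * b.det v := fun v => by
    have := congrArg (fun ξ => ξ v) (η.eq_smul_basis_det b)
    simpa using this
  have h₂ : η ((B : E d →ₗ[ℝ] E d) ∘ b) = B.det * η b := by
    rw [h₁, Module.Basis.det_comp, Module.Basis.det_self, mul_one, mul_comm]
  have h₃ : ∀ v : Fin d → E d, η v = orient p (fun i => A (v i)) := fun v => rfl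
  rw [h₃, h₃] at h₂
  simpa [b] using h₂

theorem SphConf.precomp (d : ℕ) : Precomp (SphConf (d := d)) := by
  intro f V h W hf hh
  refine ⟨hh.smooth.continuousOn.isOpen_inter_preimage hh.isOpen hf.isOpen,
    hf.smooth.comp (hh.smooth.contMDiffOn.mono Set.inter_subset_left) Set.inter_subset_right,
    fun x hx => (hf.conformal _ hx.2).comp x (hh.conformal _ hx.1), fun x hx => ?_⟩
  have e : fderiv ℝ (fun y => ((f ∘ h) y : E (d + 1))) x =
      (fderiv ℝ (fun y => (f y : E (d + 1))) (h x)).comp (fderiv ℝ h x) :=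
    fderiv_comp x (hf.conformal _ hx.2).differentiableAt (hh.conformal _ hx.1).differentiableAt
  rw [e, orient_comp]
  exact mul_pos (hh.oriented _ hx.1) (hf.oriented _ hx.2)

/-- The partial composition of the operad. -/
def CE.circ {d n m N : ℕ} (hN : N + 1 = n + m) (f : CE d n) (i : Fin n) (g : CE d m) : CE d N :=
  Config.circ (FlatConf.precomp d) hN f i g

/-- The partial composition of a disk configuration in the sphere with an element of the operad. -/
def SConf.circ {d n m N : ℕ} (hN : N + 1 = n + m) (f : SConf d n) (i : Fin n) (g : CE d m) :
    SConf d N :=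
  Config.circ (SphConf.precomp d) hN f i g

/-! ## Dilations and the identity -/

theorem flatConf_smul {d : ℕ} {r : ℝ} (hr : 0 < r) :
    FlatConf (fun x : E d => r • x) Set.univ := by
  refine ⟨isOpen_univ, (contDiff_const_smul r).contDiffOn,
    fun x _ => conformalAt_const_smul hr.ne' x, fun x _ => ?_⟩
  have e : fderiv ℝ (fun x : E d => r • x) x = r • ContinuousLinearMap.id ℝ (E d) :=
    ((hasFDerivAt_id x).const_smul r).fderiv
  have e' : ((r • ContinuousLinearMap.id ℝ (E d) : E d →L[ℝ] E d) : E d →ₗ[ℝ] E d) =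
      r • LinearMap.id := rfl
  rw [e, ContinuousLinearMap.det, e', LinearMap.det_smul, LinearMap.det_id, mul_one]
  exact pow_pos hr _

/-- The dilation `r^D : x ↦ r x` for `0 < r ≤ 1`. -/
def dil (d : ℕ) (r : ℝ) (hr : 0 < r ∧ r ≤ 1) : CE d 1 :=
  ⟨fun _ => ((fun x : E d => r • x : E d → E d) : DGerm d (E d)),
    fun _ x => r • x, fun _ => Set.univ,
    ⟨fun _ => flatConf_smul hr.1, fun _ => Set.subset_univ _,
      fun _ _ _ _ _ e => smul_right_injective _ hr.1.ne' e,
      fun i j hij => absurd (Subsingleton.elim i j) hij, fun _ x hx => by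
        rw [mem_closedBall_zero_iff] at hx ⊢
        rw [norm_smul, Real.norm_of_nonneg hr.1.le]
        exact mul_le_one₀ hr.2 (norm_nonneg _) hx⟩, fun _ => rfl⟩

/-- The identity of the disk, the unit of the operad. -/
def CE.one (d : ℕ) : CE d 1 :=
  ⟨fun _ => ((fun x : E d => x : E d → E d) : DGerm d (E d)), by
    simpa only [dil, one_smul] using (dil d 1 ⟨one_pos, le_rfl⟩).2⟩

/-! ## The embedding of the disk into the sphere -/

/-- The squared-norm denominator `1 + |x|²`. -/
theorem one_add_normSq_pos {d : ℕ} (x : E d) : 0 < 1 + ‖x‖ ^ 2 := by positivity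

/-- Inverse stereographic projection `ℝ^d → ℝ^{d+1}`,
`x ↦ ((1 - |x|²) / (1 + |x|²), 2 x / (1 + |x|²))`. -/
def stereoFun {d : ℕ} (x : E d) : E (d + 1) :=
  WithLp.toLp 2 (Matrix.vecCons ((1 - ‖x‖ ^ 2) / (1 + ‖x‖ ^ 2)) fun i => 2 * x i / (1 + ‖x‖ ^ 2))

theorem stereoFun_mem {d : ℕ} (x : E d) : stereoFun x ∈ Metric.sphere (0 : E (d + 1)) 1 := by
  have h := one_add_normSq_pos x
  have hx : ‖x‖ ^ 2 = ∑ i, x i ^ 2 := EuclideanSpace.real_norm_sq_eq x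
  rw [mem_sphere_zero_iff_norm, ← sq_eq_sq₀ (norm_nonneg _) zero_le_one,
    EuclideanSpace.real_norm_sq_eq, Fin.sum_univ_succ]
  simp only [stereoFun, Matrix.cons_val_zero, Matrix.cons_val_succ, div_pow, mul_pow,
    ← Finset.sum_div, ← Finset.mul_sum, ← hx]
  field_simp
  ring

/-- The inclusion `σ_0 : ℝ^d → S^d`, by inverse stereographic projection. -/
def stereo (d : ℕ) (x : E d) : Sph d := ⟨stereoFun x, stereoFun_mem x⟩

theorem stereoFun_contDiff (d : ℕ) : ContDiff ℝ ∞ (stereoFun (d := d)) := by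
  rw [contDiff_euclidean]
  have h₀ : ContDiff ℝ ∞ fun x : E d => ‖x‖ ^ 2 := contDiff_norm_sq ℝ
  have h₁ : ∀ i, ContDiff ℝ ∞ fun x : E d => x i := fun i => by fun_prop
  intro i
  refine Fin.cases ?_ (fun j => ?_) i
  · exact (contDiff_const.sub h₀).div (contDiff_const.add h₀) fun x => (one_add_normSq_pos x).ne'
  · exact (contDiff_const.mul (h₁ j)).div (contDiff_const.add h₀)
      fun x => (one_add_normSq_pos x).ne'

theorem stereo_injective (d : ℕ) : Function.Injective (stereo d) := by
  intro x y h
  have h' : stereoFun x = stereoFun y := congrArg Subtype.val h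
  have hx := one_add_normSq_pos x
  have hy := one_add_normSq_pos y
  have h₀ : (1 - ‖x‖ ^ 2) / (1 + ‖x‖ ^ 2) = (1 - ‖y‖ ^ 2) / (1 + ‖y‖ ^ 2) :=
    congrArg (fun v : E (d + 1) => v 0) h'
  have h₁ : ‖x‖ ^ 2 = ‖y‖ ^ 2 := by
    rw [div_eq_div_iff hx.ne' hy.ne'] at h₀
    linarith
  ext i
  have h₂ : 2 * x i / (1 + ‖x‖ ^ 2) = 2 * y i / (1 + ‖y‖ ^ 2) :=
    congrArg (fun v : E (d + 1) => v i.succ) h'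
  rw [h₁, div_left_inj' hy.ne'] at h₂
  linarith

theorem stereoFun_fderiv_zero {d : ℕ} (x u : E d) :
    fderiv ℝ stereoFun x u 0 = -4 * ⟪x, u⟫_ℝ / (1 + ‖x‖ ^ 2) ^ 2 := by
  have hs := (one_add_normSq_pos x).ne'
  have hd : HasFDerivAt stereoFun (fderiv ℝ stereoFun x) x :=
    ((stereoFun_contDiff d).differentiable (by simp) x).hasFDerivAt
  have h₀ := (EuclideanSpace.proj (𝕜 := ℝ) (0 : Fin (d + 1))).hasFDerivAt.comp x hd
  have hq := (hasStrictFDerivAt_norm_sq x).hasFDerivAt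
  have h₁ := (hq.const_sub 1).mul ((hasFDerivAt_inv (𝕜 := ℝ) hs).comp x (hq.const_add 1))
  have h₂ := congrArg (fun L => L u) (h₀.unique h₁)
  simp at h₂
  rw [h₂]
  field_simp
  ring

theorem stereoFun_fderiv_succ {d : ℕ} (x u : E d) (i : Fin d) :
    fderiv ℝ stereoFun x u i.succ =
      2 * u i / (1 + ‖x‖ ^ 2) - 4 * x i * ⟪x, u⟫_ℝ / (1 + ‖x‖ ^ 2) ^ 2 := by
  have hs := (one_add_normSq_pos x).ne'
  have hd : HasFDerivAt stereoFun (fderiv ℝ stereoFun x) x :=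
    ((stereoFun_contDiff d).differentiable (by simp) x).hasFDerivAt
  have h₀ := (EuclideanSpace.proj (𝕜 := ℝ) i.succ).hasFDerivAt.comp x hd
  have hq := (hasStrictFDerivAt_norm_sq x).hasFDerivAt
  have hi := ((EuclideanSpace.proj (𝕜 := ℝ) i).hasFDerivAt (x := x)).const_mul 2
  have h₁ := hi.mul ((hasFDerivAt_inv (𝕜 := ℝ) hs).comp x (hq.const_add 1))
  have h₂ := congrArg (fun L => L u) (h₀.unique h₁)
  simp at h₂
  rw [h₂]
  field_simp
  ring

theorem stereo_conformal {d : ℕ} (x : E d) : ConformalAt stereoFun x := by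
  have hs := one_add_normSq_pos x
  rw [conformalAt_iff']
  refine ⟨4 / (1 + ‖x‖ ^ 2) ^ 2, by positivity, fun u v => ?_⟩
  have hx : ∑ i, x i * x i = ‖x‖ ^ 2 := by
    rw [EuclideanSpace.real_norm_sq_eq]
    exact Finset.sum_congr rfl fun i _ => (sq _).symm
  have hi : ∀ y z : E d, ⟪y, z⟫_ℝ = ∑ i, y i * z i := fun y z => by
    simp [PiLp.inner_apply, mul_comm]
  have hi' : ∀ y z : E (d + 1), ⟪y, z⟫_ℝ = ∑ i, y i * z i := fun y z => by
    simp [PiLp.inner_apply, mul_comm]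
  rw [hi', Fin.sum_univ_succ]
  simp only [stereoFun_fderiv_zero, stereoFun_fderiv_succ]
  have e : ∀ i, (2 * u i / (1 + ‖x‖ ^ 2) - 4 * x i * ⟪x, u⟫_ℝ / (1 + ‖x‖ ^ 2) ^ 2) *
      (2 * v i / (1 + ‖x‖ ^ 2) - 4 * x i * ⟪x, v⟫_ℝ / (1 + ‖x‖ ^ 2) ^ 2) =
      4 / (1 + ‖x‖ ^ 2) ^ 2 * (u i * v i)
      - 8 * ⟪x, v⟫_ℝ / (1 + ‖x‖ ^ 2) ^ 3 * (x i * u i)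
      - 8 * ⟪x, u⟫_ℝ / (1 + ‖x‖ ^ 2) ^ 3 * (x i * v i)
      + 16 * ⟪x, u⟫_ℝ * ⟪x, v⟫_ℝ / (1 + ‖x‖ ^ 2) ^ 4 * (x i * x i) := fun i => by
    field_simp
    ring
  rw [Finset.sum_congr rfl fun i _ => e i, Finset.sum_add_distrib, Finset.sum_sub_distrib,
    Finset.sum_sub_distrib, ← Finset.mul_sum, ← Finset.mul_sum, ← Finset.mul_sum,
    ← Finset.mul_sum, hx, ← hi, ← hi, ← hi]
  field_simp
  ring

theorem stereo_oriented {d : ℕ} (x : E d) : 0 < orient (stereoFun x) (fun i =>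
    fderiv ℝ stereoFun x (EuclideanSpace.basisFun (Fin d) ℝ i)) := by
  have hs := one_add_normSq_pos x
  have hx : ∑ i, x i * x i = ‖x‖ ^ 2 := by
    rw [EuclideanSpace.real_norm_sq_eq]
    exact Finset.sum_congr rfl fun i _ => (sq _).symm
  let s := 1 + ‖x‖ ^ 2
  have hxi : ∀ i, ⟪x, EuclideanSpace.single i 1⟫_ℝ = x i := fun i => by
    simp [EuclideanSpace.inner_single_right]
  -- the matrix whose rows are the vectors in question
  let A : Matrix (Fin (d + 1)) (Fin (d + 1)) ℝ := fun i j =>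
    (Matrix.vecCons (stereoFun x) (fun i =>
      fderiv ℝ stereoFun x (EuclideanSpace.basisFun (Fin d) ℝ i)) : Fin (d + 1) → E (d + 1)) i j
  let N : Matrix (Fin (d + 1)) (Fin (d + 1)) ℝ :=
    Fin.cons (Fin.cons 1 fun _ => 0) fun i => Fin.cons (-2 * x i / s) fun j =>
      if i = j then 2 / s else 0
  let c : Fin (d + 1) → ℝ := Fin.cons 1 fun i => x i
  have hA : orient (stereoFun x) (fun i =>
      fderiv ℝ stereoFun x (EuclideanSpace.basisFun (Fin d) ℝ i)) = A.det := by
    rw [← Matrix.det_transpose]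
    rfl
  have hN : N.det = (2 / s) ^ d := by
    rw [Matrix.det_of_isLowerTriangular N, Fin.prod_univ_succ]
    · simp [N, div_pow]
    · intro i j hij
      have hij' : i < j := hij
      refine Fin.cases (fun hij => ?_) (fun i hij => ?_) i hij'
      · obtain ⟨k, rfl⟩ := Fin.exists_succ_eq.2 hij.ne'
        simp [N]
      · obtain ⟨k, rfl⟩ := Fin.exists_succ_eq.2 ((Fin.zero_le _).trans_lt hij).ne'
        have : i ≠ k := by
          rintro rfl
          exact lt_irrefl _ hij
        simp [N, this]
  have hrow : ∀ j, (∑ k, c k • N k) j = stereoFun x j := by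
    intro j
    rw [Finset.sum_apply, Fin.sum_univ_succ]
    refine Fin.cases ?_ (fun j => ?_) j
    · simp only [c, N, stereoFun, Fin.cons_zero, Fin.cons_succ, Pi.smul_apply, smul_eq_mul,
        Matrix.cons_val_zero]
      have : ∀ i, x i * (-2 * x i / s) = -2 / s * (x i * x i) := fun i => by ring
      rw [Finset.sum_congr rfl fun i _ => this i, ← Finset.mul_sum, hx]
      simp only [s]
      field_simp
      ring
    · simp [c, N, stereoFun, s]
      ring
  have hA' : A.det = (N.updateRow 0 (∑ k, c k • N k)).det := by
    symm
    refine Matrix.det_eq_of_forall_row_eq_smul_add_const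
      (Fin.cons 0 fun i => 2 * x i / s) 0 rfl fun i j => ?_
    refine Fin.cases ?_ (fun i => ?_) i
    · rw [Matrix.updateRow_self, hrow]
      simp [A]
    · rw [Matrix.updateRow_ne (Fin.succ_ne_zero i)]
      refine Fin.cases ?_ (fun j => ?_) j
      · simp [A, N, stereoFun_fderiv_zero, s, stereoFun, hxi]
        field_simp
        ring
      · simp [A, N, stereoFun_fderiv_succ, s, stereoFun, hxi, eq_comm]
        split_ifs <;> field_simp <;> ring
  rw [hA, hA', Matrix.det_updateRow_sum, hN]
  simp only [c, Fin.cons_zero, one_smul, s]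
  positivity

theorem stereo_sphConf (d : ℕ) : SphConf (stereo d) Set.univ :=
  have := Fact.mk (@finrank_euclideanSpace_fin ℝ _ (d + 1))
  ⟨isOpen_univ,
    (ContMDiff.codRestrict_sphere (n := d) (stereoFun_contDiff d).contMDiff
      stereoFun_mem).contMDiffOn,
    fun x _ => stereo_conformal x, fun x _ => stereo_oriented x⟩

/-- Composition with `σ_0`, which regards `CE d n` as a set of disk configurations in `S^d`. -/
def CE.toSphere {d n : ℕ} (f : CE d n) : SConf d n :=
  ⟨fun i => (f.1 i).map (stereo d), by
    obtain ⟨F, V, h, hf⟩ := f.2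
    refine ⟨fun i => stereo d ∘ F i, fun i => V i ∩ F i ⁻¹' Set.univ,
      ⟨fun i => SphConf.precomp d _ _ _ _ (stereo_sphConf d) (h.conf i),
        fun i => by simpa using h.subset i,
        fun i => ((stereo_injective d).injOn.comp (h.injOn i) (Set.mapsTo_univ _ _)).mono
          Set.inter_subset_left, fun i j hij => ?_,
        fun i => Set.mapsTo_univ _ _⟩, fun i => congrArg (Filter.Germ.map (stereo d)) (hf i)⟩
    simp only [Set.preimage_univ, Set.inter_univ, Set.image_comp]
    exact (Set.disjoint_image_iff (stereo_injective d)).2 (h.disjoint i j hij)⟩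

/-! ## Conformal automorphisms of the sphere -/

/-- The differential at `p` of a map from `S^d` to `S^d`, followed by the inclusion of the tangent
space into `ℝ^{d+1}`. -/
def sphDeriv {d : ℕ} (φ : Sph d → Sph d) (p : Sph d) :
    TangentSpace (𝓡 d) p →L[ℝ] E (d + 1) :=
  mfderiv (𝓡 d) 𝓘(ℝ, E (d + 1)) (fun q => (φ q : E (d + 1))) p

/-- The group `Conf⁺(S^d)`: orientation-preserving conformal diffeomorphisms of the sphere.
The tangent space at `p` is viewed in `ℝ^{d+1}` by the differential `sphDeriv id p` of the
inclusion. -/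
structure SphAut (d : ℕ) where
  /-- the underlying diffeomorphism -/
  toDiffeo : Sph d ≃ₘ^∞⟮𝓡 d, 𝓡 d⟯ Sph d
  conformal : ∀ p : Sph d, ∃ c : ℝ, 0 < c ∧ ∀ u v : TangentSpace (𝓡 d) p,
    ⟪sphDeriv toDiffeo p u, sphDeriv toDiffeo p v⟫_ℝ =
      c ^ 2 * ⟪sphDeriv id p u, sphDeriv id p v⟫_ℝ
  oriented : ∀ p : Sph d, ∀ w : Fin d → TangentSpace (𝓡 d) p,
    0 < orient (p : E (d + 1)) (fun i => sphDeriv id p (w i)) →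
      0 < orient (toDiffeo p : E (d + 1)) (fun i => sphDeriv toDiffeo p (w i))

theorem sphDeriv_comp {d : ℕ} (φ : Sph d → Sph d) (hφ : ContMDiff (𝓡 d) (𝓡 d) ∞ φ)
    (f : E d → Sph d) (x : E d) (hf : MDifferentiableAt 𝓘(ℝ, E d) (𝓡 d) f x) (u : E d) :
    fderiv ℝ (fun y => (φ (f y) : E (d + 1))) x u =
      sphDeriv φ (f x) (mfderiv 𝓘(ℝ, E d) (𝓡 d) f x u) := by
  have := Fact.mk (@finrank_euclideanSpace_fin ℝ _ (d + 1))
  have h₁ : ContMDiff (𝓡 d) 𝓘(ℝ, E (d + 1)) ∞ fun q => (φ q : E (d + 1)) :=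
    (contMDiff_coe_sphere (n := d)).comp hφ
  have h₂ := mfderiv_comp x (h₁.mdifferentiable (by simp) (f x)) hf
  rw [← mfderiv_eq_fderiv]
  exact congrArg (fun L : E d →L[ℝ] E (d + 1) => L u) h₂

theorem SphAut.sphConf {d : ℕ} (φ : SphAut d) {f : E d → Sph d} {V : Set (E d)}
    (hf : SphConf f V) : SphConf (φ.toDiffeo ∘ f) V := by
  have hs := φ.toDiffeo.contMDiff
  have hm : ∀ x ∈ V, MDifferentiableAt 𝓘(ℝ, E d) (𝓡 d) f x := fun x hx =>
    (hf.smooth.contMDiffAt (hf.isOpen.mem_nhds hx)).mdifferentiableAt (by simp)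
  have e₁ := fun x hx u => sphDeriv_comp φ.toDiffeo hs f x (hm x hx) u
  have e₂ := fun x hx u => sphDeriv_comp id contMDiff_id f x (hm x hx) u
  simp only [id] at e₂
  refine ⟨hf.isOpen, hs.comp_contMDiffOn hf.smooth, fun x hx => ?_, fun x hx => ?_⟩
  · obtain ⟨c, hc, h⟩ := φ.conformal (f x)
    obtain ⟨c', hc', h'⟩ := conformalAt_iff'.1 (hf.conformal x hx)
    refine conformalAt_iff'.2 ⟨c ^ 2 * c', by positivity, fun u v => ?_⟩
    have e := h (mfderiv 𝓘(ℝ, E d) (𝓡 d) f x u) (mfderiv 𝓘(ℝ, E d) (𝓡 d) f x v)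
    erw [← e₁ x hx, ← e₁ x hx, ← e₂ x hx, ← e₂ x hx, h'] at e
    rw [mul_assoc]
    exact e
  · have h := φ.oriented (f x) fun i =>
      mfderiv 𝓘(ℝ, E d) (𝓡 d) f x (EuclideanSpace.basisFun (Fin d) ℝ i)
    have h' := hf.oriented x hx
    simp only [e₂ x hx] at h'
    have h'' := h h'
    simp only [← e₁ x hx] at h''
    exact h''

/-- The action of `Conf⁺(S^d)` on disk configurations, `(f_1, …, f_n) ↦ (φ f_1, …, φ f_n)`. -/
def SphAut.act {d n : ℕ} (φ : SphAut d) (f : SConf d n) : SConf d n :=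
  ⟨fun i => (f.1 i).map φ.toDiffeo, by
    obtain ⟨F, V, h, hf⟩ := f.2
    refine ⟨fun i => φ.toDiffeo ∘ F i, V, ⟨fun i => φ.sphConf (h.conf i), h.subset,
        fun i => φ.toDiffeo.injective.injOn.comp (h.injOn i) (Set.mapsTo_univ _ _),
        fun i j hij => ?_, fun i => Set.mapsTo_univ _ _⟩, fun i => congrArg (Filter.Germ.map φ.toDiffeo) (hf i)⟩
    simp only [Set.image_comp]
    exact (Set.disjoint_image_iff φ.toDiffeo.injective).2 (h.disjoint i j hij)⟩

/-! ## The Lorentz group and the group `𝔾_d` -/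

/-- The index set of the basis `e_1, …, e_d, e_+, e_-` of `ℝ^{d+1,1}`. -/
abbrev LIdx (d : ℕ) := Fin d ⊕ Fin 2

/-- The form `⟨v, w⟩ = ∑ v_i w_i + v_+ w_- + v_- w_+` on `ℝ^{d+1,1}`. -/
def lform {d : ℕ} (v w : LIdx d → ℝ) : ℝ :=
  ∑ i, v (.inl i) * w (.inl i) + v (.inr 0) * w (.inr 1) + v (.inr 1) * w (.inr 0)

/-- The component of the null cone on which `⟨v, e_+ - e_-⟩ = v_- - v_+` is positive. -/
def nullPlus (d : ℕ) : Set (LIdx d → ℝ) :=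
  {v | v ≠ 0 ∧ lform v v = 0 ∧ 0 < v (.inr 1) - v (.inr 0)}

/-- The group `SO⁺(d+1,1)`, as a set of matrices. -/
def lorentz (d : ℕ) : Set (Matrix (LIdx d) (LIdx d) ℝ) :=
  {g | (∀ v w, lform (g.mulVec v) (g.mulVec w) = lform v w) ∧ g.det = 1 ∧
    g.mulVec '' nullPlus d = nullPlus d}

/-- The lift `x - (|x|² / √2) e_+ + (1 / √2) e_-` of `x ∈ ℝ^d` to the null cone. -/
def nullLift {d : ℕ} (x : E d) : LIdx d → ℝ :=
  Sum.elim (fun i => x i) ![-(‖x‖ ^ 2 / √2), 1 / √2]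

/-- The Möbius transformation `x ↦ g · x` of a Lorentz matrix: if `g · x ≠ ∞`, then
`g (nullLift x)` is a nonzero multiple of `nullLift (moebius g x)`. -/
def moebius {d : ℕ} (g : Matrix (LIdx d) (LIdx d) ℝ) (x : E d) : E d :=
  WithLp.toLp 2 fun i =>
    g.mulVec (nullLift x) (.inl i) / (√2 * g.mulVec (nullLift x) (.inr 1))

/-- The group `𝔾_d` of all `g ∈ SO⁺(d+1,1)` with `g(𝔻) = 𝔻` for the open unit disk `𝔻`; it
carries the topology of matrices.  The points of `𝔻` are not sent to `∞` if and only if the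
`e_-`-coordinates of their images do not vanish. -/
def confG (d : ℕ) : Set (Matrix (LIdx d) (LIdx d) ℝ) :=
  {g | g ∈ lorentz d ∧ (∀ x ∈ Metric.ball (0 : E d) 1, g.mulVec (nullLift x) (.inr 1) ≠ 0) ∧
    moebius g '' Metric.ball (0 : E d) 1 = Metric.ball (0 : E d) 1}

/-- `φ ∈ CE d 1` is the element of the operad given by `g ∈ 𝔾_d`. -/
def IsMoebius {d : ℕ} (g : Matrix (LIdx d) (LIdx d) ℝ) (φ : CE d 1) : Prop :=
  g ∈ confG d ∧ φ.1 0 = (moebius g : DGerm d (E d))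

/-! ## Algebras over the operad -/

/-- A `CE_d`-algebra in complex vector spaces with underlying space `V`.  Linear maps
`V^{⊗ n} → V` are given as multilinear maps. -/
structure CEAlgebra (d : ℕ) (V : Type*) [AddCommGroup V] [Module ℂ V] where
  /-- the structure maps -/
  ρ : ∀ n, CE d n → MultilinearMap ℂ (fun _ : Fin n => V) V
  map_one : ∀ a, ρ 1 (CE.one d) a = a 0
  map_circ : ∀ {n m N : ℕ} (hN : N + 1 = n + m) (φ : CE d n) (i : Fin n) (ψ : CE d m)
    (a : Fin N → V), ρ N (φ.circ hN i ψ) a = ρ n φ (plug hN i a (ρ m ψ (block hN i a)))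
  map_perm : ∀ {n : ℕ} (φ : CE d n) (σ : Equiv.Perm (Fin n)) (a : Fin n → V),
    ρ n (φ.perm σ) (fun i => a (σ i)) = ρ n φ a

section

variable {d : ℕ} {V : Type*}

/-- The vacuum vector `1 = ρ_0(∗)`. -/
def CEAlgebra.vacuum [AddCommGroup V] [Module ℂ V] (A : CEAlgebra d V) : V :=
  A.ρ 0 (Config.empty _ _) ![]

/-- The action of the monoid `CE d 1`. -/
def CEAlgebra.act [AddCommGroup V] [Module ℂ V] (A : CEAlgebra d V) (φ : CE d 1) (v : V) : V :=
  A.ρ 1 φ ![v]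

variable [NormedAddCommGroup V] [InnerProductSpace ℂ V]

/-- The norm of the element `∑_s v_{s,1} ⊗ ⋯ ⊗ v_{s,n}` of an algebraic tensor product, for the
inner product with `(v_1 ⊗ ⋯ ⊗ v_n, w_1 ⊗ ⋯ ⊗ w_n) = ∏_i (v_i, w_i)`. -/
def tensorNorm {n N : ℕ} (v : Fin N → Fin n → V) : ℝ :=
  √(∑ s, ∑ t, ∏ i, ⟪v s i, v t i⟫_ℂ).re

/-- The linear map `W_1 ⊗ ⋯ ⊗ W_n → F` given by a multilinear map `T` is bounded for the Hilbert
space norm of the algebraic tensor product. -/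
def TensorBounded {F : Type*} [NormedAddCommGroup F] [NormedSpace ℂ F] {n : ℕ}
    (W : Fin n → Submodule ℂ V) (T : MultilinearMap ℂ (fun _ : Fin n => V) F) : Prop :=
  ∃ C : ℝ, ∀ (N : ℕ) (v : Fin N → Fin n → V), (∀ s i, v s i ∈ W i) →
    ‖∑ s, T (v s)‖ ≤ C * tensorNorm v

/-- A Hilbert space filtration `V = ⋃ H^k`.  Compatible inner products on the increasing sequence
`H^k` are the same as one inner product on `V`, which is taken as the datum here. -/
structure HilbertFiltration (A : CEAlgebra d V) where
  /-- the subspaces `H^k` -/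
  H : ℕ → Submodule ℂ V
  vacuum_mem : A.vacuum ∈ H 0
  mono : ∀ k, H k ≤ H (k + 1)
  exhaust : ∀ v, ∃ k, v ∈ H k
  complete : ∀ k, CompleteSpace (H k)
  separable : ∀ k, TopologicalSpace.SeparableSpace (H k)
  act_mem : ∀ k φ, ∀ v ∈ H k, A.act φ v ∈ H k
  bounded : ∀ (n : ℕ) (k : Fin n → ℕ), ∃ K, ∀ φ : CE d n,
    (∀ a : Fin n → V, (∀ i, a i ∈ H (k i)) → A.ρ n φ a ∈ H K) ∧
      TensorBounded (fun i => H (k i)) (A.ρ n φ)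

/-- Condition (U): `𝔾_d` acts on every `H^k` by unitary operators, strongly continuously. -/
structure CondU {A : CEAlgebra d V} (Φ : HilbertFiltration A) : Prop where
  isometry : ∀ g φ, IsMoebius g φ → ∀ k, ∀ v ∈ Φ.H k, ∀ w ∈ Φ.H k,
    ⟪A.act φ v, A.act φ w⟫_ℂ = ⟪v, w⟫_ℂ
  surjective : ∀ g φ, IsMoebius g φ → ∀ k, ∀ w ∈ Φ.H k, ∃ v ∈ Φ.H k, A.act φ v = w
  continuous : ∀ g₀ φ₀, IsMoebius g₀ φ₀ → ∀ k, ∀ v ∈ Φ.H k, ∀ ε > 0,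
    ∀ᶠ g in 𝓝 g₀, ∀ φ, IsMoebius g φ → ‖A.act φ v - A.act φ₀ v‖ < ε

/-- Condition (D) on the operators `ρ(r^D)` on the spaces `H^k`, for `0 < r < 1`. -/
structure CondD {A : CEAlgebra d V} (Φ : HilbertFiltration A) : Prop where
  continuous : ∀ k, ∀ v ∈ Φ.H k, ∀ ε > 0, ∃ δ : ℝ, 0 < δ ∧ δ < 1 ∧
    ∀ (r : ℝ) (hr : 0 < r ∧ r ≤ 1), δ < r → ‖A.act (dil d r hr) v - v‖ < ε
  contraction : ∀ (r : ℝ) (hr : 0 < r ∧ r ≤ 1), r < 1 → ∀ k, ∀ v ∈ Φ.H k,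
    ‖A.act (dil d r hr) v‖ ≤ ‖v‖
  selfAdjoint : ∀ (r : ℝ) (hr : 0 < r ∧ r ≤ 1), r < 1 → ∀ k, ∀ v ∈ Φ.H k, ∀ w ∈ Φ.H k,
    ⟪A.act (dil d r hr) v, w⟫_ℂ = ⟪v, A.act (dil d r hr) w⟫_ℂ
  hilbertSchmidt : ∀ (r : ℝ) (hr : 0 < r ∧ r ≤ 1), r < 1 → ∀ k,
    ∃ (ι : Type) (e : HilbertBasis ι ℂ (Φ.H k)),
      Summable fun i => ‖A.act (dil d r hr) (e i : V)‖ ^ 2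
  uniform : ∀ (r : ℝ) (hr : 0 < r ∧ r ≤ 1), r < 1 → ∃ M : ℝ, 0 < M ∧ ∀ k,
    ∃ (ι : Type) (e : HilbertBasis ι ℂ (Φ.H k)),
      (Summable fun i => ‖A.act (dil d r hr) (e i : V)‖ ^ 2) ∧
        ∑' i, ‖A.act (dil d r hr) (e i : V)‖ ^ 2 ≤ M

end

/-! ## States on the sphere -/

/-- A state of `A` on `S^d`.  Linear forms on `V^{⊗ n}` are given as multilinear forms. -/
structure SphState {d : ℕ} {V : Type*} [AddCommGroup V] [Module ℂ V] (A : CEAlgebra d V) where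
  /-- the linear forms `χ(f_1, …, f_n)` -/
  χ : ∀ n, SConf d n → MultilinearMap ℂ (fun _ : Fin n => V) ℂ
  map_circ : ∀ {n m N : ℕ} (hN : N + 1 = n + m) (f : SConf d n) (i : Fin n) (ψ : CE d m)
    (a : Fin N → V), χ N (f.circ hN i ψ) a = χ n f (plug hN i a (A.ρ m ψ (block hN i a)))
  map_perm : ∀ {n : ℕ} (f : SConf d n) (σ : Equiv.Perm (Fin n)) (a : Fin n → V),
    χ n (f.perm σ) (fun i => a (σ i)) = χ n f a

/-- The state is invariant under `Conf⁺(S^d)`. -/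
def SphState.Invariant {d : ℕ} {V : Type*} [AddCommGroup V] [Module ℂ V] {A : CEAlgebra d V}
    (S : SphState A) : Prop :=
  ∀ (n : ℕ) (φ : SphAut d) (f : SConf d n), S.χ n (φ.act f) = S.χ n f

/-- On configurations inside the disk, the state is the vacuum expectation value. -/
def SphState.ExtendsVacuum {d : ℕ} {V : Type*} [NormedAddCommGroup V] [InnerProductSpace ℂ V]
    {A : CEAlgebra d V} (S : SphState A) : Prop :=
  ∀ (n : ℕ) (f : CE d n) (a : Fin n → V), S.χ n f.toSphere a = ⟪A.vacuum, A.ρ n f a⟫_ℂ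

/-- The state is continuous: its restrictions to `H^{k_1} ⊗ ⋯ ⊗ H^{k_n}` are bounded. -/
def SphState.IsContinuous {d : ℕ} {V : Type*} [NormedAddCommGroup V] [InnerProductSpace ℂ V]
    {A : CEAlgebra d V} (S : SphState A) (Φ : HilbertFiltration A) : Prop :=
  ∀ (n : ℕ) (f : SConf d n) (k : Fin n → ℕ), TensorBounded (fun i => Φ.H (k i)) (S.χ n f)

end ConfDisk

end

/-! Uniqueness. Finitely many disks in the sphere leave some point `q` uncovered. An automorphism
takes `q` to the point missed by `stereo`, and a boost fixing that point then squeezes the compact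
union of disks into the closed upper hemisphere, which is the image of the closed unit disk. Every
configuration `f` therefore satisfies `β.act f = g.toSphere` with `g` in the operad, and invariance
together with the vacuum formula forces `χ f` to be the vacuum expectation value of `g`.

Existence amounts to `CondD.vev_eq_of_act`: this value does not depend on the choice of `β` and `g`,
that is, two operad configurations related by an automorphism `α` of the sphere have equal vacuum
expectation values. Every unary operation fixes the vacuum, so self-adjoint operations (dilations)
and unitary ones (elements of `𝔾_d`) preserve vacuum expectation values. The difficulty is that `α`
need not preserve the disk.

Suppose first that `α` fixes infinity. In stereographic coordinates it is a conformal map of all of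
`ℝ^d`, hence a similarity by Liouville's theorem. For `d ≥ 3` one shows that the inverse conformal
factor is quadratic along lines and then constant, because the map is proper; for `d = 2` an entire
function of linear growth is affine. Rotations belong to `𝔾_d`. Translations do not, but they arise
from a composite: a hyperbolic translation and its conjugate by a dilation have the same pole, so
they differ by an affine map (`smul_ballMap_smul`). This expresses a scaled translation through
dilations and elements of `𝔾_d`, and `CondD.vev_smul_add` follows.

For general `α`, fix `f` and normalize it at each uncovered point `q`. By the first case the
resulting value depends only on `q`. It is locally constant in `q`, since a small displacement of
the point at infinity is undone by a hyperbolic translation, which preserves the disk and the value.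
The complement of the disks is connected for `d ≥ 2`, so the value is constant; comparing `q = ∞`
with `q = α⁻¹ ∞` gives the claim.

Continuity is inherited from the boundedness of the operations. The value on the empty configuration
is `⟪1, 1⟫`, and `1 ≠ 0` because a dilation can be written with the vacuum inserted into an
additional disk. -/

noncomputable section

namespace ConfDisk

/-! ## Post-composition with unary operations and vacuum expectation values -/

/-- Post-composition of a configuration with a unary operation. -/
def CE.after {d n : ℕ} (φ : CE d 1) (f : CE d n) : CE d n :=
  CE.circ (add_comm n 1) φ 0 f

theorem CE.after_val {d n : ℕ} (φ : CE d 1) (f : CE d n) (k : Fin n) :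
    (CE.after φ f).1 k = (φ.1 0).compTendsto' (f.1 k) (CE.tendsto f k) := by
  change splice (add_comm n 1) 0 φ.1
    (fun j => (φ.1 0).compTendsto' (f.1 j) (CE.tendsto f j)) k = _
  have h₁ : ¬ k.1 < (0 : Fin 1).1 := by simp
  have h₂ : k.1 < (0 : Fin 1).1 + n := by simp
  rw [splice, dif_neg h₁, dif_pos h₂]
  simp

theorem CE.after_coe {d n : ℕ} {φ : CE d 1} {f : CE d n} {k : Fin n} {T F : E d → E d}
    (hφ : φ.1 0 = (T : DGerm d (E d))) (hf : f.1 k = (F : DGerm d (E d))) :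
    (CE.after φ f).1 k = ((T ∘ F : E d → E d) : DGerm d (E d)) := by
  rw [CE.after_val]
  exact germ_comp _ _ _ _ _ hφ hf

section

variable {d : ℕ} {V : Type*}

theorem CEAlgebra.ρ_after [AddCommGroup V] [Module ℂ V] (A : CEAlgebra d V) {n : ℕ}
    (φ : CE d 1) (f : CE d n) (a : Fin n → V) :
    A.ρ n (CE.after φ f) a = A.act φ (A.ρ n f a) := by
  rw [CE.after, A.map_circ, CEAlgebra.act]
  have e : block (add_comm n 1) (0 : Fin 1) a = a := by
    funext k
    simp [block]
  rw [e]
  congr 1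
  funext j
  have : j = 0 := Subsingleton.elim _ _
  subst this
  simp [plug]

theorem CEAlgebra.act_one [AddCommGroup V] [Module ℂ V] (A : CEAlgebra d V) (v : V) :
    A.act (CE.one d) v = v := by
  simp [CEAlgebra.act, A.map_one]

/-- There is only one configuration of zero disks, and composing any unary operation with it gives
it back. -/
theorem CEAlgebra.act_vacuum [AddCommGroup V] [Module ℂ V] (A : CEAlgebra d V) (φ : CE d 1) :
    A.act φ A.vacuum = A.vacuum := by
  have e : CE.after φ (Config.empty _ _) = Config.empty _ _ :=
    Subtype.ext (funext fun i => i.elim0)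
  rw [CEAlgebra.vacuum, ← A.ρ_after, e]

variable [NormedAddCommGroup V] [InnerProductSpace ℂ V]

/-- The vacuum expectation value of a disk configuration in the disk. -/
def CEAlgebra.vev (A : CEAlgebra d V) {n : ℕ} (f : CE d n) :
    MultilinearMap ℂ (fun _ : Fin n => V) ℂ :=
  (innerSL ℂ A.vacuum : V →ₗ[ℂ] ℂ).compMultilinearMap (A.ρ n f)

theorem CEAlgebra.vev_apply (A : CEAlgebra d V) {n : ℕ} (f : CE d n) (a : Fin n → V) :
    A.vev f a = ⟪A.vacuum, A.ρ n f a⟫_ℂ := rfl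

/-- The unary operations which preserve the vacuum expectation. -/
def CEAlgebra.FixesVev (A : CEAlgebra d V) (φ : CE d 1) : Prop :=
  ∀ v, ⟪A.vacuum, A.act φ v⟫_ℂ = ⟪A.vacuum, v⟫_ℂ

theorem CEAlgebra.FixesVev.vev_after {A : CEAlgebra d V} {φ : CE d 1} (h : A.FixesVev φ) {n : ℕ}
    (f : CE d n) : A.vev (CE.after φ f) = A.vev f := by
  ext a
  rw [A.vev_apply, A.vev_apply, A.ρ_after, h]

theorem HilbertFiltration.exists_mem_vacuum_mem {A : CEAlgebra d V} (Φ : HilbertFiltration A)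
    (v : V) : ∃ k, v ∈ Φ.H k ∧ A.vacuum ∈ Φ.H k := by
  obtain ⟨k, hk⟩ := Φ.exhaust v
  exact ⟨k, hk, (monotone_nat_of_le_succ Φ.mono) (Nat.zero_le k) Φ.vacuum_mem⟩

theorem CondD.fixesVev_dil {A : CEAlgebra d V} {Φ : HilbertFiltration A} (hD : CondD Φ) {r : ℝ}
    (hr : 0 < r ∧ r ≤ 1) : A.FixesVev (dil d r hr) := by
  intro v
  -- Self-adjointness moves the operator onto the vacuum, which it fixes. Condition (D) covers only
  -- `r < 1`; for `r = 1` the dilation is the unit.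
  rcases hr.2.lt_or_eq with h | rfl
  · obtain ⟨k, hv, h₁⟩ := Φ.exists_mem_vacuum_mem v
    rw [← hD.selfAdjoint r hr h k _ h₁ _ hv, A.act_vacuum]
  · have e : dil d 1 hr = CE.one d := by
      refine Subtype.ext (funext fun _ => ?_)
      simp [dil, CE.one]
    rw [e, A.act_one]

/-- Applying the isometry to both arguments of the inner product leaves the vacuum unchanged. -/
theorem CondU.fixesVev {A : CEAlgebra d V} {Φ : HilbertFiltration A} (hU : CondU Φ)
    {g : Matrix (LIdx d) (LIdx d) ℝ} {φ : CE d 1} (h : IsMoebius g φ) : A.FixesVev φ := by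
  intro v
  obtain ⟨k, hv, h₁⟩ := Φ.exists_mem_vacuum_mem v
  rw [← hU.isometry g φ h k _ h₁ _ hv, A.act_vacuum]

theorem CondD.vev_smul {A : CEAlgebra d V} {Φ : HilbertFiltration A} (hD : CondD Φ) {n : ℕ}
    {r : ℝ} (hr : 0 < r ∧ r ≤ 1) {f g : CE d n} {F : Fin n → E d → E d}
    (hf : ∀ i, f.1 i = (F i : DGerm d (E d)))
    (hg : ∀ i, g.1 i = ((fun x => r • F i x : E d → E d) : DGerm d (E d))) :
    A.vev g = A.vev f := by
  rw [← (hD.fixesVev_dil hr).vev_after f]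
  congr 1
  exact Subtype.ext (funext fun i => (hg i).trans
    (CE.after_coe (φ := dil d r hr) (T := fun x => r • x) rfl (hf i)).symm)

/-! ## The vacuum vector does not vanish -/

theorem flatConf_smul_add {r : ℝ} (hr : 0 < r) (c : E d) :
    FlatConf (fun x : E d => r • x + c) Set.univ := by
  have h := flatConf_smul (d := d) hr
  refine ⟨isOpen_univ, h.smooth.add contDiffOn_const, fun x hx => ?_, fun x hx => ?_⟩
  · obtain ⟨L, hL, hL'⟩ := h.conformal x hx
    exact ⟨L, hL.add_const c, hL'⟩
  · rw [fderiv_add_const]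
    exact h.oriented x hx

/-- The dilation `x ↦ r x` together with a small disk between it and the boundary. -/
theorem exists_dil_pair (hd : 1 ≤ d) {r : ℝ} (hr : 0 < r) (hr1 : r < 1) :
    ∃ f : CE d 2, f.1 0 = ((fun x => r • x : E d → E d) : DGerm d (E d)) := by
  obtain ⟨c, hc⟩ : ∃ c : E d, ‖c‖ = (1 + r) / 2 := by
    refine ⟨EuclideanSpace.single ⟨0, hd⟩ ((1 + r) / 2), ?_⟩
    rw [PiLp.norm_single]
    exact Real.norm_of_nonneg (by linarith)
  -- The second disk is centred at distance `(1 + r) / 2`, midway between `r` and `1`, that is `4δ`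
  -- from either. On the ball of radius `1 + δ` the first map stays inside the sphere of radius `r +
  -- δ` and the second outside it.
  let δ := (1 - r) / 8
  have hδ : 0 < δ := by simp only [δ]; linarith
  let F : Fin 2 → E d → E d := ![fun x => r • x, fun x => δ • x + c]
  let U : Set (E d) := Metric.ball 0 (1 + δ)
  have hU : cDisk d ⊆ U := Metric.closedBall_subset_ball (by linarith)
  have h0 : ∀ x ∈ U, ‖r • x‖ < r + δ := fun x hx => by
    rw [mem_ball_zero_iff] at hx
    rw [norm_smul, Real.norm_of_nonneg hr.le]
    nlinarith
  have h1 : ∀ x ∈ U, r + δ < ‖δ • x + c‖ := fun x hx => by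
    rw [mem_ball_zero_iff] at hx
    have h2 : ‖c‖ ≤ ‖δ • x + c‖ + ‖δ • x‖ := by
      simpa using norm_sub_le (δ • x + c) (δ • x)
    rw [norm_smul, Real.norm_of_nonneg hδ.le, hc] at h2
    have h3 : δ * ‖x‖ ≤ δ * (1 + δ) := by gcongr
    have h4 : δ < 1 := by simp only [δ]; linarith
    simp only [δ] at *
    nlinarith
  have hD : Disjoint (F 0 '' U) (F 1 '' U) := by
    rw [Set.disjoint_left]
    rintro _ ⟨x, hx, rfl⟩ ⟨y, hy, hxy⟩
    have e : δ • y + c = r • x := hxy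
    have h2 := h1 y hy
    rw [e] at h2
    exact lt_irrefl _ (h2.trans (h0 x hx))
  refine ⟨⟨fun i => (F i : DGerm d (E d)), F, fun _ => U, ⟨?_, fun _ => hU, ?_, ?_, ?_⟩,
    fun _ => rfl⟩, rfl⟩
  · intro i
    have key : ∀ s : ℝ, 0 < s → ∀ e : E d, FlatConf (fun x : E d => s • x + e) U := by
      intro s hs e
      have h := flatConf_smul_add hs e
      exact ⟨Metric.isOpen_ball, h.smooth.mono (Set.subset_univ _), fun x _ => h.conformal x trivial,
        fun x _ => h.oriented x trivial⟩
    fin_cases i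
    · simpa [F] using key r hr 0
    · exact key δ hδ c
  · intro i x _ y _ e
    fin_cases i
    · exact smul_right_injective _ hr.ne' e
    · exact smul_right_injective _ hδ.ne' (add_right_cancel (b := c) e)
  · intro i j hij
    fin_cases i <;> fin_cases j
    · exact absurd rfl hij
    · exact hD
    · exact hD.symm
    · exact absurd rfl hij
  · intro i x hx
    rw [mem_closedBall_zero_iff] at hx ⊢
    fin_cases i
    · change ‖r • x‖ ≤ 1
      rw [norm_smul, Real.norm_of_nonneg hr.le]
      nlinarith
    · change ‖δ • x + c‖ ≤ 1
      refine (norm_add_le _ _).trans ?_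
      rw [norm_smul, Real.norm_of_nonneg hδ.le, hc]
      simp only [δ]
      nlinarith

/-- Filling the second disk of `exists_dil_pair` with the vacuum leaves the dilation. If the vacuum
were zero, all dilations with `r < 1` would act by zero, contradicting strong continuity at `r = 1`.
-/
theorem CondD.vacuum_ne_zero {A : CEAlgebra d V} {Φ : HilbertFiltration A} (hD : CondD Φ)
    (hd : 1 ≤ d) [Nontrivial V] : A.vacuum ≠ 0 := by
  intro h0
  obtain ⟨v, hv⟩ := exists_ne (0 : V)
  obtain ⟨k, hk⟩ := Φ.exhaust v
  obtain ⟨δ, hδ, hδ1, h⟩ := hD.continuous k v hk ‖v‖ (norm_pos_iff.2 hv)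
  have hr : 0 < (1 + δ) / 2 ∧ (1 + δ) / 2 ≤ 1 := ⟨by linarith, by linarith⟩
  have h1 := h _ hr (by linarith)
  obtain ⟨f, hf⟩ := exists_dil_pair hd hr.1 (by linarith : (1 + δ) / 2 < 1)
  have e : f.circ (N := 1) (m := 0) rfl 1 (Config.empty _ _) = dil d _ hr := by
    refine Subtype.ext (funext fun i => ?_)
    have hi : i = 0 := Subsingleton.elim _ _
    subst hi
    exact hf
  have e' : A.act (dil d _ hr) v = 0 := by
    rw [CEAlgebra.act, ← e, A.map_circ]
    refine (A.ρ 2 f).map_coord_zero 1 ?_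
    have : block (n := 2) (m := 0) (N := 1) rfl 1 ![v] = ![] := Subsingleton.elim _ _
    rw [this]
    simp only [plug]
    exact h0
  rw [e', zero_sub, norm_neg] at h1
  exact lt_irrefl _ h1

end

/-! ## Stereographic coordinates -/

section

variable {d : ℕ}

/-- Stereographic projection, as a function on the ambient space. -/
def stereoInv (y : E (d + 1)) : E d := WithLp.toLp 2 fun i => y i.succ / (1 + y 0)

theorem stereoFun_zero (x : E d) : stereoFun x 0 = (1 - ‖x‖ ^ 2) / (1 + ‖x‖ ^ 2) := rfl

theorem stereoFun_succ (x : E d) (i : Fin d) : stereoFun x i.succ = 2 * x i / (1 + ‖x‖ ^ 2) := rfl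

theorem one_add_stereoFun_zero (x : E d) : 1 + stereoFun x 0 = 2 / (1 + ‖x‖ ^ 2) := by
  have := one_add_normSq_pos x
  rw [stereoFun_zero]
  field_simp
  ring

theorem stereoInv_stereoFun (x : E d) : stereoInv (stereoFun x) = x := by
  have := one_add_normSq_pos x
  ext i
  change stereoFun x i.succ / (1 + stereoFun x 0) = x i
  rw [one_add_stereoFun_zero, stereoFun_succ]
  field_simp

theorem sph_sq_add_sum_sq (p : Sph d) :
    (p : E (d + 1)) 0 ^ 2 + ∑ i : Fin d, (p : E (d + 1)) i.succ ^ 2 = 1 := by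
  have h := p.2
  rw [mem_sphere_zero_iff_norm] at h
  rw [← Fin.sum_univ_succ fun i => (p : E (d + 1)) i ^ 2, ← EuclideanSpace.real_norm_sq_eq, h, one_pow]

theorem sph_norm_eq (p : Sph d) : ‖(p : E (d + 1))‖ = 1 := mem_sphere_zero_iff_norm.1 p.2

theorem normSq_stereoInv {p : Sph d} (hp : (p : E (d + 1)) 0 ≠ -1) :
    ‖stereoInv (p : E (d + 1))‖ ^ 2 = (1 - (p : E (d + 1)) 0) / (1 + (p : E (d + 1)) 0) := by
  have h0 : 1 + (p : E (d + 1)) 0 ≠ 0 := fun h => hp (by linarith)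
  have h := sph_sq_add_sum_sq p
  have e : ∀ i : Fin d, stereoInv (p : E (d + 1)) i ^ 2 =
    (p : E (d + 1)) i.succ ^ 2 / (1 + (p : E (d + 1)) 0) ^ 2 := fun i => div_pow _ _ _
  rw [EuclideanSpace.real_norm_sq_eq, Finset.sum_congr rfl fun i _ => e i, ← Finset.sum_div,
    eq_sub_of_add_eq' h]
  field_simp
  ring

theorem stereo_stereoInv {p : Sph d} (hp : (p : E (d + 1)) 0 ≠ -1) :
    stereo d (stereoInv (p : E (d + 1))) = p := by
  have h0 : 1 + (p : E (d + 1)) 0 ≠ 0 := fun h => hp (by linarith)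
  have hn := normSq_stereoInv hp
  have e1 : 1 + ‖stereoInv (p : E (d + 1))‖ ^ 2 = 2 / (1 + (p : E (d + 1)) 0) := by
    rw [hn]; field_simp; ring
  refine Subtype.ext ?_
  change stereoFun _ = _
  ext i
  refine Fin.cases ?_ (fun i => ?_) i
  · rw [stereoFun_zero, e1, hn]
    field_simp
    ring
  · rw [stereoFun_succ, e1]
    change 2 * ((p : E (d + 1)) i.succ / (1 + (p : E (d + 1)) 0)) / _ = _
    field_simp

theorem stereo_zero_ne (x : E d) : ((stereo d x : Sph d) : E (d + 1)) 0 ≠ -1 := by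
  have h := one_add_stereoFun_zero x
  have h' := one_add_normSq_pos x
  have : 0 < 2 / (1 + ‖x‖ ^ 2) := by positivity
  change stereoFun x 0 ≠ -1
  intro e
  rw [e] at h
  linarith

/-- The point of the sphere which is missed by `stereo`. -/
def infty (d : ℕ) : Sph d := ⟨-EuclideanSpace.single 0 1, by simp⟩

theorem infty_zero : (infty d : E (d + 1)) 0 = -1 := by simp [infty]

theorem infty_succ (i : Fin d) : (infty d : E (d + 1)) i.succ = 0 := by simp [infty]

theorem eq_infty_iff {p : Sph d} : p = infty d ↔ (p : E (d + 1)) 0 = -1 := by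
  refine ⟨fun h => h ▸ infty_zero, fun h => Subtype.ext ?_⟩
  have h1 := sph_sq_add_sum_sq p
  rw [h] at h1
  have h2 : ∑ i : Fin d, (p : E (d + 1)) i.succ ^ 2 = 0 := by linarith
  ext i
  refine Fin.cases (h.trans infty_zero.symm) (fun i => ?_) i
  rw [infty_succ]
  exact pow_eq_zero_iff (two_ne_zero) |>.1
    ((Finset.sum_eq_zero_iff_of_nonneg fun i _ => sq_nonneg _).1 h2 i (Finset.mem_univ _))

theorem stereo_ne_infty (x : E d) : stereo d x ≠ infty d := fun h =>
  stereo_zero_ne x (eq_infty_iff.1 h)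

theorem stereo_zero_nonneg_iff (x : E d) :
    0 ≤ ((stereo d x : Sph d) : E (d + 1)) 0 ↔ x ∈ cDisk d := by
  have h' := one_add_normSq_pos x
  change 0 ≤ (1 - ‖x‖ ^ 2) / (1 + ‖x‖ ^ 2) ↔ _
  rw [mem_closedBall_zero_iff, le_div_iff₀ h', zero_mul, sub_nonneg,
    sq_le_one_iff₀ (norm_nonneg x)]

theorem stereo_continuous (d : ℕ) : Continuous (stereo d) :=
  (stereoFun_contDiff d).continuous.subtype_mk _

theorem contDiffOn_stereoInv : ContDiffOn ℝ ∞ (stereoInv (d := d)) {y | y 0 ≠ -1} := by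
  rw [contDiffOn_euclidean]
  intro i
  refine ContDiffOn.div (by fun_prop) (by fun_prop) fun y hy h => hy ?_
  linarith

theorem isOpen_image_stereo {W : Set (E d)} (hW : IsOpen W) : IsOpen (stereo d '' W) := by
  have e : stereo d '' W = ((↑) : Sph d → E (d + 1)) ⁻¹'
      ({y | y 0 ≠ -1} ∩ stereoInv ⁻¹' W) := by
    ext p
    constructor
    · rintro ⟨x, hx, rfl⟩
      refine ⟨stereo_zero_ne x, ?_⟩
      change stereoInv (stereoFun x) ∈ W
      rwa [stereoInv_stereoFun]
    · rintro ⟨h, h'⟩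
      exact ⟨_, h', stereo_stereoInv h⟩
  rw [e]
  refine IsOpen.preimage continuous_subtype_val
    (contDiffOn_stereoInv.continuousOn.isOpen_inter_preimage ?_ hW)
  exact isOpen_ne_fun (by fun_prop) continuous_const

theorem SphConf.contDiffOn {f : E d → Sph d} {V : Set (E d)} (hf : SphConf f V) :
    ContDiffOn ℝ ∞ (fun x => (f x : E (d + 1))) V := by
  have := Fact.mk (@finrank_euclideanSpace_fin ℝ _ (d + 1))
  exact ((contMDiff_coe_sphere (n := d)).comp_contMDiffOn hf.smooth).contDiffOn

/-- In stereographic coordinates, a conformal map to the sphere is a conformal map between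
domains of Euclidean space. -/
theorem SphConf.flatConf {f : E d → Sph d} {V : Set (E d)} (hf : SphConf f V)
    (h : ∀ x ∈ V, f x ≠ infty d) : FlatConf (fun x => stereoInv (f x : E (d + 1))) V := by
  have hs : ContDiffOn ℝ ∞ (fun x => stereoInv (f x : E (d + 1))) V :=
    contDiffOn_stereoInv.comp hf.contDiffOn fun x hx e => h x hx (eq_infty_iff.2 e)
  have hF : ∀ x ∈ V, fderiv ℝ (fun x => (f x : E (d + 1))) x =
      (fderiv ℝ stereoFun (stereoInv (f x : E (d + 1)))).comp
        (fderiv ℝ (fun x => stereoInv (f x : E (d + 1))) x) := by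
    intro x hx
    have h1 := (stereoFun_contDiff d).differentiable (by simp)
      (stereoInv (f x : E (d + 1))) |>.hasFDerivAt
    have h2 := (hs.contDiffAt (hf.isOpen.mem_nhds hx)).differentiableAt (by simp) |>.hasFDerivAt
    refine HasFDerivAt.fderiv ((h1.comp x h2).congr_of_eventuallyEq ?_)
    filter_upwards [hf.isOpen.mem_nhds hx] with y hy
    exact congrArg Subtype.val (stereo_stereoInv fun e => h y hy (eq_infty_iff.2 e)).symm
  refine ⟨hf.isOpen, hs, fun x hx => ?_, fun x hx => ?_⟩
  · obtain ⟨c, hc, h1⟩ := conformalAt_iff'.1 (hf.conformal x hx)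
    obtain ⟨c', hc', h2⟩ := conformalAt_iff'.1 (stereo_conformal (stereoInv (f x : E (d + 1))))
    refine conformalAt_iff'.2 ⟨c / c', by positivity, fun u v => ?_⟩
    have h3 := h1 u v
    rw [hF x hx, ContinuousLinearMap.comp_apply, ContinuousLinearMap.comp_apply, h2] at h3
    field_simp
    linarith
  · have h1 := hf.oriented x hx
    rw [hF x hx, orient_comp] at h1
    have h2 := stereo_oriented (stereoInv (f x : E (d + 1)))
    have h3 : stereoFun (stereoInv (f x : E (d + 1))) = f x :=
      congrArg Subtype.val (stereo_stereoInv fun e => h x hx (eq_infty_iff.2 e))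
    rw [h3] at h2
    exact pos_of_mul_pos_left h1 h2.le

/-- A configuration of disks in the closed upper hemisphere comes from the operad. -/
theorem SConf.exists_toSphere_eq {n : ℕ} {f : SConf d n} {F : Fin n → E d → Sph d}
    {V : Fin n → Set (E d)} (h : IsRep (SphConf (d := d)) Set.univ F V)
    (hf : ∀ i, f.1 i = (F i : DGerm d (Sph d)))
    (hF : ∀ i, ∀ x ∈ cDisk d, 0 ≤ (F i x : E (d + 1)) 0) : ∃ g : CE d n, f = g.toSphere ∧
      ∀ i, g.1 i = ((fun x => stereoInv (F i x : E (d + 1)) : E d → E d) : DGerm d (E d)) := by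
  -- Only the closed disks are known to stay in the hemisphere; their neighbourhoods may reach
  -- infinity and have to be cut down.
  let W : Fin n → Set (E d) := fun i => V i ∩ {x | (F i x : E (d + 1)) 0 ≠ -1}
  have hWo : ∀ i, IsOpen (W i) := fun i =>
    (h.conf i).contDiffOn.continuousOn.isOpen_inter_preimage (h.conf i).isOpen
      (isOpen_ne_fun (f := fun y : E (d + 1) => y 0) (by fun_prop) continuous_const)
  have hconf : ∀ i, SphConf (F i) (W i) := fun i =>
    ⟨hWo i, (h.conf i).smooth.mono Set.inter_subset_left,
      fun x hx => (h.conf i).conformal x hx.1, fun x hx => (h.conf i).oriented x hx.1⟩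
  have hinj : ∀ i j, ∀ x ∈ W i, ∀ y ∈ W j, stereoInv (F i x : E (d + 1)) = stereoInv (F j y : E (d + 1)) →
      F i x = F j y := fun i j x hx y hy e => by
    rw [← stereo_stereoInv hx.2, ← stereo_stereoInv hy.2, e]
  have hW : ∀ i, cDisk d ⊆ W i := fun i x hx => ⟨h.subset i hx, by
    have := hF i x hx
    intro e
    rw [e] at this
    linarith⟩
  refine ⟨⟨fun i => ((fun x => stereoInv (F i x : E (d + 1)) : E d → E d) : DGerm d (E d)),
    fun i x => stereoInv (F i x : E (d + 1)), W, ⟨fun i => (hconf i).flatConf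
      fun x hx e => hx.2 (eq_infty_iff.1 e), hW, fun i x hx y hy e =>
        h.injOn i hx.1 hy.1 (hinj i i x hx y hy e), fun i j hij => ?_, fun i x hx => ?_⟩,
    fun _ => rfl⟩, Subtype.ext (funext fun i => ?_), fun _ => rfl⟩
  · rw [Set.disjoint_left]
    rintro _ ⟨x, hx, rfl⟩ ⟨y, hy, e⟩
    exact Set.disjoint_left.1 (h.disjoint i j hij) ⟨x, hx.1, rfl⟩
      ⟨y, hy.1, hinj j i y hy x hx e⟩
  · rw [← stereo_zero_nonneg_iff, stereo_stereoInv (hW i hx).2]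
    exact hF i x hx
  · rw [hf i]
    refine Filter.Germ.coe_eq.2 ?_
    filter_upwards [(hWo i).mem_nhdsSet.2 (hW i)] with x hx
    exact (stereo_stereoInv hx.2).symm

/-! ## Automorphisms of the sphere -/

theorem sphDeriv_comp_sph (φ ψ : Sph d → Sph d) (hφ : ContMDiff (𝓡 d) (𝓡 d) ∞ φ)
    (hψ : ContMDiff (𝓡 d) (𝓡 d) ∞ ψ) (p : Sph d) (u : TangentSpace (𝓡 d) p) :
    sphDeriv (φ ∘ ψ) p u = sphDeriv φ (ψ p) (mfderiv (𝓡 d) (𝓡 d) ψ p u) := by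
  have := Fact.mk (@finrank_euclideanSpace_fin ℝ _ (d + 1))
  have h₁ : ContMDiff (𝓡 d) 𝓘(ℝ, E (d + 1)) ∞ fun q => (φ q : E (d + 1)) :=
    (contMDiff_coe_sphere (n := d)).comp hφ
  have h₂ := mfderiv_comp p (h₁.mdifferentiable (by simp) (ψ p))
    (hψ.mdifferentiable (by simp) p)
  exact DFunLike.congr_fun h₂ u

/-- The composition of two automorphisms of the sphere. -/
def SphAut.comp (φ ψ : SphAut d) : SphAut d where
  toDiffeo := ψ.toDiffeo.trans φ.toDiffeo
  conformal p := by
    obtain ⟨c, hc, h⟩ := φ.conformal (ψ.toDiffeo p)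
    obtain ⟨c', hc', h'⟩ := ψ.conformal p
    refine ⟨c * c', by positivity, fun u v => ?_⟩
    have e := sphDeriv_comp_sph φ.toDiffeo ψ.toDiffeo φ.toDiffeo.contMDiff ψ.toDiffeo.contMDiff p
    have e' := sphDeriv_comp_sph id ψ.toDiffeo contMDiff_id ψ.toDiffeo.contMDiff p
    have h1 := h (mfderiv (𝓡 d) (𝓡 d) ψ.toDiffeo p u) (mfderiv (𝓡 d) (𝓡 d) ψ.toDiffeo p v)
    rw [← e, ← e, ← e', ← e'] at h1
    rw [Diffeomorph.coe_trans, h1, Function.id_comp, h']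
    ring
  oriented p w hw := by
    have e := sphDeriv_comp_sph φ.toDiffeo ψ.toDiffeo φ.toDiffeo.contMDiff ψ.toDiffeo.contMDiff p
    have e' := sphDeriv_comp_sph id ψ.toDiffeo contMDiff_id ψ.toDiffeo.contMDiff p
    have h1 := φ.oriented (ψ.toDiffeo p) (fun i => mfderiv (𝓡 d) (𝓡 d) ψ.toDiffeo p (w i))
    simp only [← e, ← e'] at h1
    exact h1 (ψ.oriented p w hw)

theorem SphAut.comp_apply (φ ψ : SphAut d) (p : Sph d) :
    (φ.comp ψ).toDiffeo p = φ.toDiffeo (ψ.toDiffeo p) := rfl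

theorem SphAut.comp_act (φ ψ : SphAut d) {n : ℕ} (f : SConf d n) :
    (φ.comp ψ).act f = φ.act (ψ.act f) := by
  refine Subtype.ext (funext fun i => ?_)
  change (f.1 i).map (φ.toDiffeo ∘ ψ.toDiffeo) = ((f.1 i).map ψ.toDiffeo).map φ.toDiffeo
  rw [Filter.Germ.map_map]

/-! ## Boosts of the sphere -/

theorem add_ne_zero_of_norm_lt {b x : E (d + 1)} (hb : ‖b‖ < 1) (hx : ‖x‖ = 1) : x + b ≠ 0 := by
  intro h
  rw [eq_neg_of_add_eq_zero_left h, norm_neg] at hx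
  exact hb.ne hx

/-- The boost of the sphere with parameter `b` in the open unit ball. -/
def boostFun (b x : E (d + 1)) : E (d + 1) := b + ((1 - ‖b‖ ^ 2) / ‖x + b‖ ^ 2) • (x + b)

/-- For `x` on the sphere, `boostFun b x` is the antipode of the other end of the chord through `x`
and `-b`. This explains why the sphere is preserved and why `-b` gives the inverse. -/
theorem boostFun_mem {b : E (d + 1)} (hb : ‖b‖ < 1) {x : E (d + 1)}
    (hx : x ∈ Metric.sphere (0 : E (d + 1)) 1) : boostFun b x ∈ Metric.sphere (0 : E (d + 1)) 1 := by
  rw [mem_sphere_zero_iff_norm] at hx ⊢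
  have h0 := norm_pos_iff.2 (add_ne_zero_of_norm_lt hb hx)
  rw [← sq_eq_sq₀ (norm_nonneg _) zero_le_one, boostFun, norm_add_sq_real, norm_smul, inner_smul_right,
    inner_add_right, mul_pow, Real.norm_eq_abs, sq_abs, real_inner_self_eq_norm_sq]
  have h1 : ‖x + b‖ ^ 2 = 1 + 2 * ⟪b, x⟫_ℝ + ‖b‖ ^ 2 := by
    rw [norm_add_sq_real, hx, real_inner_comm]; ring
  have h2 : ⟪b, x⟫_ℝ = (‖x + b‖ ^ 2 - 1 - ‖b‖ ^ 2) / 2 := by linarith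
  rw [h2]
  field_simp
  ring

theorem boostFun_neg_boostFun {b : E (d + 1)} (hb : ‖b‖ < 1) {x : E (d + 1)}
    (hx : ‖x‖ = 1) : boostFun (-b) (boostFun b x) = x := by
  have h0 := norm_pos_iff.2 (add_ne_zero_of_norm_lt hb hx)
  have h1 : 0 < 1 - ‖b‖ ^ 2 := by nlinarith [norm_nonneg b]
  have e : boostFun b x + -b = ((1 - ‖b‖ ^ 2) / ‖x + b‖ ^ 2) • (x + b) := by
    rw [boostFun]; abel
  rw [boostFun, e, norm_neg, norm_smul, smul_smul, mul_pow, Real.norm_eq_abs, sq_abs]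
  have : (1 - ‖b‖ ^ 2) / (((1 - ‖b‖ ^ 2) / ‖x + b‖ ^ 2) ^ 2 * ‖x + b‖ ^ 2) *
      ((1 - ‖b‖ ^ 2) / ‖x + b‖ ^ 2) = 1 := by
    field_simp
  rw [this, one_smul]
  abel

/-- The differential of an inversion is a known multiple of a reflection, so this form gives
conformality. -/
theorem boostFun_eq_inversion {b : E (d + 1)} (hb : ‖b‖ < 1) (x : E (d + 1)) :
    boostFun b x = EuclideanGeometry.inversion (-b) (√(1 - ‖b‖ ^ 2)) x + (2 : ℝ) • b := by
  have h1 : 0 < 1 - ‖b‖ ^ 2 := by nlinarith [norm_nonneg b]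
  rw [EuclideanGeometry.inversion, dist_eq_norm, sub_neg_eq_add, div_pow, Real.sq_sqrt h1.le,
    vsub_eq_sub, vadd_eq_add, sub_neg_eq_add, boostFun]
  module

theorem hasFDerivAt_boostFun {b : E (d + 1)} (hb : ‖b‖ < 1) {x : E (d + 1)} (hx : x + b ≠ 0) :
    HasFDerivAt (boostFun b) (((1 - ‖b‖ ^ 2) / ‖x + b‖ ^ 2) •
      ((ℝ ∙ (x + b))ᗮ.reflection : E (d + 1) →L[ℝ] E (d + 1))) x := by
  have h1 : 0 < 1 - ‖b‖ ^ 2 := by nlinarith [norm_nonneg b]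
  have h := (EuclideanGeometry.hasFDerivAt_inversion (R := √(1 - ‖b‖ ^ 2)) (c := -b) (x := x)
    fun e => hx (by rw [e]; simp)).add_const ((2 : ℝ) • b)
  rw [dist_eq_norm, sub_neg_eq_add, div_pow, Real.sq_sqrt h1.le] at h
  have e := funext (boostFun_eq_inversion hb)
  rw [e]
  exact h

/-- The reflection that moves the point, up to sign, is the same one that gives the differential.
The outward normal and the tangent frame can thus be handled by one determinant. -/
theorem boostFun_eq_neg_reflection {b : E (d + 1)} (hb : ‖b‖ < 1) {x : E (d + 1)}
    (hx : ‖x‖ = 1) : boostFun b x = -(ℝ ∙ (x + b))ᗮ.reflection x := by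
  have h0 := norm_pos_iff.2 (add_ne_zero_of_norm_lt hb hx)
  have h1 : ‖x + b‖ ^ 2 = 1 + 2 * ⟪x, b⟫_ℝ + ‖b‖ ^ 2 := by
    rw [norm_add_sq_real, hx]; ring
  rw [Submodule.reflection_orthogonal_apply, Submodule.reflection_singleton_apply, boostFun,
    inner_add_left, real_inner_self_eq_norm_sq, hx, RCLike.ofReal_real_eq_id, id, real_inner_comm]
  have h2 : ⟪x, b⟫_ℝ = (‖x + b‖ ^ 2 - 1 - ‖b‖ ^ 2) / 2 := by linarith
  rw [h2]
  match_scalars <;> field_simp <;> ring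

theorem contMDiff_boostFun {b : E (d + 1)} (hb : ‖b‖ < 1) :
    ContMDiff (𝓡 d) (𝓡 d) ∞ fun p : Sph d => (⟨boostFun b p, boostFun_mem hb p.2⟩ : Sph d) := by
  have := Fact.mk (@finrank_euclideanSpace_fin ℝ _ (d + 1))
  refine ContMDiff.codRestrict_sphere (n := d) (f := fun p : Sph d => boostFun b p) ?_
    fun p => boostFun_mem hb p.2
  intro p
  have h0 := add_ne_zero_of_norm_lt hb (sph_norm_eq p)
  have h : ContDiffAt ℝ ∞ (boostFun b) (p : E (d + 1)) := by
    have h1 : ContDiffAt ℝ ∞ (fun x => x + b) (p : E (d + 1)) := by fun_prop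
    have h2 : ContDiffAt ℝ ∞ (fun x => (1 - ‖b‖ ^ 2) / ‖x + b‖ ^ 2) (p : E (d + 1)) :=
      contDiffAt_const.div (h1.norm_sq ℝ) (pow_ne_zero _ (norm_ne_zero_iff.2 h0))
    exact contDiffAt_const.add (h2.smul h1)
  exact h.contMDiffAt.comp p (contMDiff_coe_sphere (n := d) p)

theorem sphDeriv_eq_fderiv (φ : Sph d → Sph d) (Φ : E (d + 1) → E (d + 1))
    (h : ∀ p, (φ p : E (d + 1)) = Φ p) {p : Sph d} {L : E (d + 1) →L[ℝ] E (d + 1)}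
    (hL : HasFDerivAt Φ L p) (u : TangentSpace (𝓡 d) p) :
    sphDeriv φ p u = L (sphDeriv id p u) := by
  have := Fact.mk (@finrank_euclideanSpace_fin ℝ _ (d + 1))
  have h₂ := (hL.hasMFDerivAt.comp p
    ((contMDiff_coe_sphere (n := d) (m := ∞)).mdifferentiable (by simp) p).hasMFDerivAt).mfderiv
  have e : (fun q => (φ q : E (d + 1))) = Φ ∘ ((↑) : Sph d → E (d + 1)) := funext h
  rw [sphDeriv, e]
  exact DFunLike.congr_fun h₂ u

theorem orient_smul (a c : ℝ) (p : E (d + 1)) (w : Fin d → E (d + 1)) :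
    orient (a • p) (fun i => c • w i) = a * c ^ d * orient p w := by
  have h := (EuclideanSpace.basisFun (Fin (d + 1)) ℝ).toBasis.det.map_smul_univ
    (Fin.cons a fun _ => c) (Matrix.vecCons p w)
  rw [Fin.prod_univ_succ] at h
  simp only [Fin.cons_zero, Fin.cons_succ, Finset.prod_const, Finset.card_univ,
    Fintype.card_fin, smul_eq_mul] at h
  rw [orient, orient, ← h]
  congr 1
  funext i
  exact Fin.cases rfl (fun i => rfl) i

theorem orient_map (L : E (d + 1) →ₗ[ℝ] E (d + 1)) (p : E (d + 1)) (w : Fin d → E (d + 1)) :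
    orient (L p) (fun i => L (w i)) = LinearMap.det L * orient p w := by
  rw [orient, orient, ← Module.Basis.det_comp]
  congr 1
  funext i
  exact Fin.cases rfl (fun i => rfl) i

/-- The boost with parameter `b`, as an automorphism of the sphere. -/
def SphAut.boost (b : E (d + 1)) (hb : ‖b‖ < 1) : SphAut d where
  toDiffeo :=
    { toFun := fun p => ⟨boostFun b p, boostFun_mem hb p.2⟩
      invFun := fun p => ⟨boostFun (-b) p, boostFun_mem ((norm_neg b).trans_lt hb) p.2⟩
      left_inv := fun p => Subtype.ext (boostFun_neg_boostFun hb (sph_norm_eq p))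
      right_inv := fun p => Subtype.ext <| by
        simpa using boostFun_neg_boostFun ((norm_neg b).trans_lt hb) (sph_norm_eq p)
      contMDiff_toFun := contMDiff_boostFun hb
      contMDiff_invFun := contMDiff_boostFun ((norm_neg b).trans_lt hb) }
  conformal p := by
    have h0 := norm_pos_iff.2 (add_ne_zero_of_norm_lt hb (sph_norm_eq p))
    have h1 : 0 < 1 - ‖b‖ ^ 2 := by nlinarith [norm_nonneg b]
    refine ⟨(1 - ‖b‖ ^ 2) / ‖(p : E (d + 1)) + b‖ ^ 2, by positivity, fun u v => ?_⟩
    have h := fun u => sphDeriv_eq_fderiv (d := d)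
      (fun p => ⟨boostFun b p, boostFun_mem hb p.2⟩) (boostFun b) (fun _ => rfl)
      (hasFDerivAt_boostFun hb (add_ne_zero_of_norm_lt hb (sph_norm_eq p))) u
    refine (congrArg₂ (fun x y => ⟪x, y⟫_ℝ) (h u) (h v)).trans ?_
    simp only [smul_apply, real_inner_smul_left, real_inner_smul_right]
    rw [← mul_assoc, ← sq]
    congr 1
    exact LinearIsometryEquiv.inner_map_map _ _ _
  oriented p w hw := by
    have h0 := norm_pos_iff.2 (add_ne_zero_of_norm_lt hb (sph_norm_eq p))
    have h1 : 0 < 1 - ‖b‖ ^ 2 := by nlinarith [norm_nonneg b]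
    have h := fun u => sphDeriv_eq_fderiv (d := d)
      (fun p => ⟨boostFun b p, boostFun_mem hb p.2⟩) (boostFun b) (fun _ => rfl)
      (hasFDerivAt_boostFun hb (add_ne_zero_of_norm_lt hb (sph_norm_eq p))) u
    let R := (ℝ ∙ ((p : E (d + 1)) + b))ᗮ.reflection
    have hdet : LinearMap.det (R : E (d + 1) →ₗ[ℝ] E (d + 1)) = -1 := by
      have := Submodule.det_reflection (ℝ ∙ ((p : E (d + 1)) + b))ᗮ
      rw [Submodule.orthogonal_orthogonal,
        finrank_span_singleton (add_ne_zero_of_norm_lt hb (sph_norm_eq p)), pow_one] at this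
      exact this
    have e : orient (boostFun b p) (fun i => sphDeriv
        (fun p => ⟨boostFun b p, boostFun_mem hb p.2⟩) p (w i)) =
        ((1 - ‖b‖ ^ 2) / ‖(p : E (d + 1)) + b‖ ^ 2) ^ d *
          orient (p : E (d + 1)) (fun i => sphDeriv id p (w i)) := by
      -- The reflection contributes determinant `-1`, the sign in front of the normal contributes
      -- another `-1`, and the `d` tangent vectors contribute the positive conformal factor to the
      -- power `d`.
      rw [boostFun_eq_neg_reflection hb (sph_norm_eq p)]
      simp only [h]
      have e1 := orient_smul (-1) ((1 - ‖b‖ ^ 2) / ‖(p : E (d + 1)) + b‖ ^ 2)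
        (R (p : E (d + 1))) (fun i => R (sphDeriv id p (w i)))
      have e2 := orient_map (R : E (d + 1) →ₗ[ℝ] E (d + 1)) p (fun i => sphDeriv id p (w i))
      rw [hdet] at e2
      have e3 : orient (R (p : E (d + 1))) (fun i => R (sphDeriv id p (w i))) =
        -1 * orient (p : E (d + 1)) (fun i => sphDeriv id p (w i)) := e2
      rw [e3, neg_one_smul] at e1
      refine e1.trans (by ring)
    refine lt_of_lt_of_eq ?_ e.symm
    positivity

theorem SphAut.boost_apply (b : E (d + 1)) (hb : ‖b‖ < 1) (p : Sph d) :
    (((SphAut.boost b hb).toDiffeo p : Sph d) : E (d + 1)) = boostFun b p := rfl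

end

/-! ### Hyperbolic translations of the ball, as boosts of the sphere and as Lorentz matrices -/

section

variable {d : ℕ}

/-! ## Conformal automorphisms of the ball -/

/-- The denominator of `ballMap`. -/
def ballDenom (b x : E d) : ℝ := 1 + 2 * ⟪b, x⟫_ℝ + ‖b‖ ^ 2 * ‖x‖ ^ 2

/-- The hyperbolic translation of the unit ball which sends `0` to `b`. -/
def ballMap (b x : E d) : E d :=
  (ballDenom b x)⁻¹ • ((1 - ‖b‖ ^ 2) • x + (1 + 2 * ⟪b, x⟫_ℝ + ‖x‖ ^ 2) • b)

theorem ballDenom_pos {b x : E d} (h : ‖b‖ * ‖x‖ < 1) : 0 < ballDenom b x := by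
  have h1 := neg_le_of_abs_le (abs_real_inner_le_norm b x)
  have : 0 < (1 - ‖b‖ * ‖x‖) ^ 2 := pow_pos (by linarith) 2
  rw [ballDenom]
  nlinarith

theorem norm_mul_norm_lt {b x : E d} (hb : ‖b‖ < 1) (hx : ‖x‖ ≤ 1) : ‖b‖ * ‖x‖ < 1 := by
  nlinarith [norm_nonneg b, norm_nonneg x]

theorem one_sub_normSq_pos {b : E d} (hb : ‖b‖ < 1) : 0 < 1 - ‖b‖ ^ 2 := by
  nlinarith [norm_nonneg b]

theorem normSq_ballMap {b x : E d} (h : 0 < ballDenom b x) :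
    ‖ballMap b x‖ ^ 2 = (‖b‖ ^ 2 + 2 * ⟪b, x⟫_ℝ + ‖x‖ ^ 2) / ballDenom b x := by
  rw [ballMap, norm_smul, mul_pow, norm_add_sq_real, norm_smul, norm_smul, inner_smul_left,
    inner_smul_right, mul_pow, mul_pow]
  simp only [Real.norm_eq_abs, sq_abs, conj_trivial, real_inner_comm b x]
  field_simp
  rw [ballDenom]
  ring

theorem inner_ballMap (b x : E d) : ⟪b, ballMap b x⟫_ℝ =
    ((1 - ‖b‖ ^ 2) * ⟪b, x⟫_ℝ + (1 + 2 * ⟪b, x⟫_ℝ + ‖x‖ ^ 2) * ‖b‖ ^ 2) / ballDenom b x := by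
  rw [ballMap, inner_smul_right, inner_add_right, inner_smul_right, inner_smul_right,
    real_inner_self_eq_norm_sq]
  field_simp

theorem one_sub_normSq_ballMap {b x : E d} (h : 0 < ballDenom b x) :
    1 - ‖ballMap b x‖ ^ 2 = (1 - ‖b‖ ^ 2) * (1 - ‖x‖ ^ 2) / ballDenom b x := by
  rw [normSq_ballMap h]
  field_simp
  rw [ballDenom]
  ring

theorem ballMap_mem_ball {b x : E d} (hb : ‖b‖ < 1) (hx : x ∈ Metric.ball (0 : E d) 1) :
    ballMap b x ∈ Metric.ball (0 : E d) 1 := by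
  rw [mem_ball_zero_iff] at hx ⊢
  have h := ballDenom_pos (norm_mul_norm_lt hb hx.le)
  have h1 := one_sub_normSq_ballMap h
  have h2 := one_sub_normSq_pos hb
  have h3 := one_sub_normSq_pos hx
  have : 0 < 1 - ‖ballMap b x‖ ^ 2 := by rw [h1]; positivity
  nlinarith [norm_nonneg (ballMap b x)]

/-- This comes from the relativistic bound `(‖b‖ + ‖x‖) / (1 + ‖b‖ * ‖x‖)`. The weaker form keeps
the intermediate configurations of `CondD.vev_smul_add` inside the disk. -/
theorem norm_ballMap_le {b x : E d} (hb : ‖b‖ < 1) (hx : ‖x‖ ≤ 1) :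
    ‖ballMap b x‖ ≤ ‖b‖ + ‖x‖ := by
  have hl := norm_mul_norm_lt hb hx
  have h := ballDenom_pos hl
  have h1 := le_of_abs_le (abs_real_inner_le_norm b x)
  have hb0 := norm_nonneg b
  have hx0 := norm_nonneg x
  have h2 : ‖ballMap b x‖ ^ 2 ≤ ((‖b‖ + ‖x‖) / (1 + ‖b‖ * ‖x‖)) ^ 2 := by
    rw [normSq_ballMap h, div_pow, div_le_div_iff₀ h (by positivity), ballDenom]
    have h3 : 0 ≤ (1 - ‖b‖ ^ 2) * (1 - ‖x‖ ^ 2) :=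
      mul_nonneg (one_sub_normSq_pos hb).le (by nlinarith)
    nlinarith [mul_nonneg h3 (sub_nonneg.2 h1)]
  have h4 := abs_le_of_sq_le_sq h2 (by positivity)
  refine (le_of_abs_le (h4 : |‖ballMap b x‖| ≤ _)).trans (div_le_self (by positivity) ?_)
  nlinarith

theorem ballMap_neg_ballMap {b x : E d} (hb : ‖b‖ < 1) (h : 0 < ballDenom b x) :
    ballMap (-b) (ballMap b x) = x := by
  have h2 := one_sub_normSq_pos hb
  have hi := inner_ballMap b x
  have hn := normSq_ballMap h
  have hD : ballDenom (-b) (ballMap b x) = (1 - ‖b‖ ^ 2) ^ 2 / ballDenom b x := by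
    rw [ballDenom, norm_neg, inner_neg_left, hi, hn]
    field_simp
    rw [ballDenom]
    ring
  have h3 : 1 + 2 * -⟪b, ballMap b x⟫_ℝ + ‖ballMap b x‖ ^ 2 =
      (1 - ‖b‖ ^ 2) * (1 + 2 * ⟪b, x⟫_ℝ + ‖x‖ ^ 2) / ballDenom b x := by
    rw [hi, hn]
    field_simp
    rw [ballDenom]
    ring
  rw [ballMap, hD, norm_neg, inner_neg_left, h3, ballMap]
  match_scalars <;> field_simp
  ring

/-- Conjugates of hyperbolic translations by dilations differ from hyperbolic translations by
affine maps. -/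
theorem smul_ballMap_smul {b y : E d} (hb : ‖b‖ < 1) {r : ℝ} (hr : r ≠ 0)
    (h : 0 < ballDenom b y) :
    r • ballMap (r • b) (r⁻¹ • y) = ((1 - r ^ 2 * ‖b‖ ^ 2) / (1 - ‖b‖ ^ 2)) • ballMap b y +
      ((r ^ 2 - 1) / (1 - ‖b‖ ^ 2)) • b := by
  have h2 := one_sub_normSq_pos hb
  -- For `b ≠ 0` both maps have the same pole `-b / ‖b‖ ^ 2`, which is why they differ by a map
  -- fixing infinity.
  have hD : ballDenom (r • b) (r⁻¹ • y) = ballDenom b y := by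
    rw [ballDenom, ballDenom, norm_smul, norm_smul, inner_smul_left, inner_smul_right, mul_pow,
      mul_pow]
    simp only [Real.norm_eq_abs, sq_abs, conj_trivial]
    field_simp
  rw [ballMap, hD, ballMap, norm_smul, norm_smul, inner_smul_left, inner_smul_right, mul_pow,
    mul_pow]
  simp only [Real.norm_eq_abs, sq_abs, conj_trivial]
  match_scalars
  · field_simp
  · field_simp
    rw [ballDenom]
    ring

/-! ## Relation to boosts of the sphere -/

/-- The inclusion of the equatorial hyperplane. -/
def eqLift (b : E d) : E (d + 1) := WithLp.toLp 2 (Matrix.vecCons 0 b)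

theorem normSq_eqLift (b : E d) : ‖eqLift b‖ ^ 2 = ‖b‖ ^ 2 := by
  rw [EuclideanSpace.real_norm_sq_eq, EuclideanSpace.real_norm_sq_eq, Fin.sum_univ_succ]
  simp [eqLift]

theorem norm_eqLift (b : E d) : ‖eqLift b‖ = ‖b‖ :=
  (sq_eq_sq₀ (norm_nonneg _) (norm_nonneg _)).1 (normSq_eqLift b)

theorem inner_eqLift (b : E d) (y : E (d + 1)) : ⟪y, eqLift b⟫_ℝ = ∑ i, b i * y i.succ := by
  rw [PiLp.inner_apply, Fin.sum_univ_succ]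
  simp [eqLift]

theorem inner_stereoFun_eqLift (b x : E d) :
    ⟪stereoFun x, eqLift b⟫_ℝ = 2 * ⟪b, x⟫_ℝ / (1 + ‖x‖ ^ 2) := by
  rw [inner_eqLift, PiLp.inner_apply]
  simp only [stereoFun_succ, RCLike.inner_apply, conj_trivial]
  rw [Finset.mul_sum, Finset.sum_div]
  exact Finset.sum_congr rfl fun i _ => by ring

theorem boostFun_eqLift_stereoFun {b x : E d} (hb : ‖b‖ < 1) (h : 0 < ballDenom b x) :
    boostFun (eqLift b) (stereoFun x) = stereoFun (ballMap b x) := by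
  have h1 := one_add_normSq_pos x
  have h2 := one_sub_normSq_pos hb
  have hn := normSq_ballMap h
  have hN : 1 + ‖ballMap b x‖ ^ 2 =
      ((1 + ‖b‖ ^ 2) * (1 + ‖x‖ ^ 2) + 4 * ⟪b, x⟫_ℝ) / ballDenom b x := by
    rw [hn]
    field_simp
    rw [ballDenom]
    ring
  have hP : 0 < (1 + ‖b‖ ^ 2) * (1 + ‖x‖ ^ 2) + 4 * ⟪b, x⟫_ℝ := by
    have h3 := one_add_normSq_pos (ballMap b x)
    rw [hN] at h3
    exact (div_pos_iff_of_pos_right h).1 h3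
  have hs : ‖stereoFun x‖ = 1 := mem_sphere_zero_iff_norm.1 (stereoFun_mem x)
  have hS : ‖stereoFun x + eqLift b‖ ^ 2 =
      ((1 + ‖b‖ ^ 2) * (1 + ‖x‖ ^ 2) + 4 * ⟪b, x⟫_ℝ) / (1 + ‖x‖ ^ 2) := by
    rw [norm_add_sq_real, hs, normSq_eqLift, inner_stereoFun_eqLift]
    field_simp
    ring
  ext i
  refine Fin.cases ?_ (fun i => ?_) i
  · rw [stereoFun_zero, hN, hn, boostFun, hS, normSq_eqLift]
    simp only [PiLp.add_apply, PiLp.smul_apply, eqLift, Matrix.cons_val_zero, stereoFun_zero,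
      smul_eq_mul]
    field_simp
    rw [ballDenom]
    ring
  · rw [stereoFun_succ, hN, boostFun, hS, normSq_eqLift, ballMap]
    simp only [PiLp.add_apply, PiLp.smul_apply, eqLift, Matrix.cons_val_succ, stereoFun_succ,
      smul_eq_mul]
    field_simp
    ring

/-- The boost of the sphere that extends `ballMap b`. -/
abbrev SphAut.ballBoost (b : E d) (hb : ‖b‖ < 1) : SphAut d :=
  SphAut.boost (eqLift b) ((norm_eqLift b).trans_lt hb)

theorem SphAut.ballBoost_stereo {b x : E d} (hb : ‖b‖ < 1) (h : 0 < ballDenom b x) :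
    (SphAut.ballBoost b hb).toDiffeo (stereo d x) = stereo d (ballMap b x) :=
  Subtype.ext (boostFun_eqLift_stereoFun hb h)

theorem eventually_ballDenom_pos {b : E d} (hb : ‖b‖ < 1) :
    ∀ᶠ x in 𝓝ˢ (cDisk d), 0 < ballDenom b x := by
  have hc : Continuous fun x : E d => ballDenom b x := by unfold ballDenom; fun_prop
  exact (isOpen_lt continuous_const hc).mem_nhdsSet.2 fun x hx =>
    ballDenom_pos (norm_mul_norm_lt hb (mem_closedBall_zero_iff.1 hx))

theorem norm_ballMap_le_one {b x : E d} (hb : ‖b‖ < 1) (hx : ‖x‖ ≤ 1) : ‖ballMap b x‖ ≤ 1 := by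
  have h := ballDenom_pos (norm_mul_norm_lt hb hx)
  have h1 := one_sub_normSq_ballMap h
  have h3 : 0 ≤ 1 - ‖x‖ ^ 2 := by nlinarith [norm_nonneg x]
  have h2 := one_sub_normSq_pos hb
  have : 0 ≤ 1 - ‖ballMap b x‖ ^ 2 := by rw [h1]; positivity
  nlinarith [norm_nonneg (ballMap b x)]

/-- Conformality, orientation and injectivity are read off from the boost of the sphere, so
`ballMap` itself is never differentiated. -/
theorem exists_CE_ballMap {b : E d} (hb : ‖b‖ < 1) :
    ∃ φ : CE d 1, φ.1 0 = (ballMap b : DGerm d (E d)) := by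
  have hs := (SphAut.ballBoost b hb).sphConf (stereo_sphConf d)
  have h : IsRep (SphConf (d := d)) Set.univ
      (fun _ : Fin 1 => (SphAut.ballBoost b hb).toDiffeo ∘ stereo d) (fun _ => Set.univ) :=
    ⟨fun _ => hs, fun _ => Set.subset_univ _, fun _ =>
      ((SphAut.ballBoost b hb).toDiffeo.injective.comp (stereo_injective d)).injOn,
      fun i j hij => absurd (Subsingleton.elim i j) hij, fun _ => Set.mapsTo_univ _ _⟩
  obtain ⟨g, -, hg⟩ := SConf.exists_toSphere_eq (f := ⟨_, _, _, h, fun _ => rfl⟩) h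
    (fun _ => rfl) fun _ x hx => by
      have hx' := mem_closedBall_zero_iff.1 hx
      rw [Function.comp_apply, SphAut.ballBoost_stereo hb
        (ballDenom_pos (norm_mul_norm_lt hb hx')), stereo_zero_nonneg_iff, mem_closedBall_zero_iff]
      exact norm_ballMap_le_one hb hx'
  refine ⟨g, (hg 0).trans (Filter.Germ.coe_eq.2 ?_)⟩
  filter_upwards [eventually_ballDenom_pos hb] with x hx
  rw [Function.comp_apply, SphAut.ballBoost_stereo hb hx]
  exact stereoInv_stereoFun _

/-! ## Elements of `𝔾_d` -/

/-- The time coordinate being positive already excludes the zero vector, so preservation of the form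
and positivity for `g` and its right inverse `g'` give the bijection of the null cone. -/
theorem mem_confG_of_inverse {g g' : Matrix (LIdx d) (LIdx d) ℝ}
    (hg : ∀ v, g.mulVec (g'.mulVec v) = v)
    (hform : ∀ v w, lform (g.mulVec v) (g.mulVec w) = lform v w) (hdet : g.det = 1)
    (hpos : ∀ v ∈ nullPlus d, 0 < g.mulVec v (.inr 1) - g.mulVec v (.inr 0))
    (hpos' : ∀ v ∈ nullPlus d, 0 < g'.mulVec v (.inr 1) - g'.mulVec v (.inr 0))
    (h0 : ∀ x ∈ Metric.ball (0 : E d) 1, g.mulVec (nullLift x) (.inr 1) ≠ 0)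
    (hT : ∀ x ∈ Metric.ball (0 : E d) 1, moebius g x ∈ Metric.ball (0 : E d) 1)
    (hT' : ∀ x ∈ Metric.ball (0 : E d) 1, ∃ y ∈ Metric.ball (0 : E d) 1, moebius g y = x) :
    g ∈ confG d := by
  refine ⟨⟨hform, hdet, ?_⟩, h0, ?_⟩
  · ext w
    constructor
    · rintro ⟨v, hv, rfl⟩
      have := hpos v hv
      refine ⟨fun e => ?_, by rw [hform]; exact hv.2.1, this⟩
      simp [e] at this
    · intro hw
      have := hpos' w hw
      refine ⟨g'.mulVec w, ⟨fun e => ?_, by rw [← hform, hg]; exact hw.2.1, this⟩, hg w⟩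
      simp [e] at this
  · ext x
    exact ⟨by rintro ⟨y, hy, rfl⟩; exact hT y hy, hT' x⟩

/-- The Lorentz boost that acts on the ball by `ballMap b`. -/
def boostMat (b : E d) : Matrix (LIdx d) (LIdx d) ℝ :=
  1 + (Matrix.of fun k => Sum.elim (fun i => ![2 / (1 - ‖b‖ ^ 2) * b i, 0])
      ![![0, -(2 / (1 - ‖b‖ ^ 2) / √2)], ![0, 2 / (1 - ‖b‖ ^ 2) / √2]] k : Matrix (LIdx d) (Fin 2) ℝ) *
    (Matrix.of ![Sum.elim (fun i => b i) ![-(1 / √2), 1 / √2],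
      Sum.elim (fun i => b i) ![-(‖b‖ ^ 2 / √2), ‖b‖ ^ 2 / √2]] : Matrix (Fin 2) (LIdx d) ℝ)

theorem sum_sq_eq (b : E d) : ∑ i, b i * b i = ‖b‖ ^ 2 := by
  rw [EuclideanSpace.real_norm_sq_eq]
  exact Finset.sum_congr rfl fun i _ => (sq _).symm

theorem sqrt_two_sq : √2 ^ 2 = (2 : ℝ) := Real.sq_sqrt zero_le_two

theorem sqrt_two_pow_three : √2 ^ 3 = 2 * √2 := by rw [pow_succ, sqrt_two_sq]

theorem sqrt_two_pow_four : √2 ^ 4 = (4 : ℝ) := by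
  rw [show 4 = 2 * 2 from rfl, pow_mul, sqrt_two_sq]
  norm_num

theorem boostMat_det {b : E d} (hb : ‖b‖ < 1) : (boostMat b).det = 1 := by
  have h := one_sub_normSq_pos hb
  have h2 : √2 ≠ 0 := by positivity
  -- The boost is a rank-two perturbation of the identity, so its determinant reduces to one of size
  -- two.
  rw [boostMat, Matrix.det_one_add_mul_comm, Matrix.det_fin_two]
  simp only [Matrix.add_apply, Matrix.mul_apply, Fintype.sum_sum_type, Fin.sum_univ_two,
    Matrix.of_apply, Matrix.cons_val_zero, Matrix.cons_val_one, Sum.elim_inl, Sum.elim_inr,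
    Matrix.one_apply_eq, Matrix.one_apply_ne (zero_ne_one' (Fin 2)), mul_zero,
    Matrix.one_apply_ne (zero_ne_one' (Fin 2)).symm, Finset.sum_const_zero]
  have e : ∑ i, b i * (2 / (1 - ‖b‖ ^ 2) * b i) = 2 / (1 - ‖b‖ ^ 2) * ‖b‖ ^ 2 := by
    rw [← sum_sq_eq, Finset.mul_sum]
    exact Finset.sum_congr rfl fun i _ => by ring
  rw [e]
  field_simp
  rw [sqrt_two_sq]
  ring

theorem boostMat_inl (b : E d) (v : LIdx d → ℝ) (i : Fin d) : (boostMat b).mulVec v (.inl i) =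
    v (.inl i) + 2 / (1 - ‖b‖ ^ 2) *
      (∑ j, b j * v (.inl j) + (v (.inr 1) - v (.inr 0)) / √2) * b i := by
  rw [boostMat, Matrix.add_mulVec, Matrix.one_mulVec, ← Matrix.mulVec_mulVec]
  simp only [Pi.add_apply, Matrix.mulVec, dotProduct, Fin.sum_univ_two, Matrix.of_apply,
    Matrix.cons_val_zero, Matrix.cons_val_one, Sum.elim_inl, Sum.elim_inr, Fintype.sum_sum_type]
  ring

theorem boostMat_inr_zero (b : E d) (v : LIdx d → ℝ) : (boostMat b).mulVec v (.inr 0) =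
    v (.inr 0) - 2 / (1 - ‖b‖ ^ 2) / √2 *
      (∑ j, b j * v (.inl j) + ‖b‖ ^ 2 * ((v (.inr 1) - v (.inr 0)) / √2)) := by
  rw [boostMat, Matrix.add_mulVec, Matrix.one_mulVec, ← Matrix.mulVec_mulVec]
  simp only [Pi.add_apply, Matrix.mulVec, dotProduct, Fin.sum_univ_two, Matrix.of_apply,
    Matrix.cons_val_zero, Matrix.cons_val_one, Sum.elim_inl, Sum.elim_inr, Fintype.sum_sum_type]
  ring

theorem boostMat_inr_one (b : E d) (v : LIdx d → ℝ) : (boostMat b).mulVec v (.inr 1) =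
    v (.inr 1) + 2 / (1 - ‖b‖ ^ 2) / √2 *
      (∑ j, b j * v (.inl j) + ‖b‖ ^ 2 * ((v (.inr 1) - v (.inr 0)) / √2)) := by
  rw [boostMat, Matrix.add_mulVec, Matrix.one_mulVec, ← Matrix.mulVec_mulVec]
  simp only [Pi.add_apply, Matrix.mulVec, dotProduct, Fin.sum_univ_two, Matrix.of_apply,
    Matrix.cons_val_zero, Matrix.cons_val_one, Sum.elim_inl, Sum.elim_inr, Fintype.sum_sum_type]
  ring

theorem lform_boostMat {b : E d} (hb : ‖b‖ < 1) (v w : LIdx d → ℝ) :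
    lform ((boostMat b).mulVec v) ((boostMat b).mulVec w) = lform v w := by
  have h := one_sub_normSq_pos hb
  have h2 : √2 ≠ 0 := by positivity
  rw [lform, lform]
  simp only [boostMat_inl, boostMat_inr_zero, boostMat_inr_one]
  generalize hβ : ∑ j, b j * v (.inl j) = β
  generalize hβ' : ∑ j, b j * w (.inl j) = β'
  have e : ∀ a c : ℝ, ∑ i, (v (.inl i) + a * b i) * (w (.inl i) + c * b i) =
      ∑ i, v (.inl i) * w (.inl i) + a * β' + c * β + a * c * ‖b‖ ^ 2 := fun a c => by
    rw [← sum_sq_eq, ← hβ, ← hβ', Finset.mul_sum, Finset.mul_sum, Finset.mul_sum,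
      ← Finset.sum_add_distrib, ← Finset.sum_add_distrib, ← Finset.sum_add_distrib]
    exact Finset.sum_congr rfl fun i _ => by ring
  rw [e]
  field_simp
  simp only [sqrt_two_sq]
  ring_nf
  simp only [sqrt_two_sq, sqrt_two_pow_four]
  ring

theorem boostMat_boostMat_neg {b : E d} (hb : ‖b‖ < 1) (v : LIdx d → ℝ) :
    (boostMat b).mulVec ((boostMat (-b)).mulVec v) = v := by
  have h := one_sub_normSq_pos hb
  have h2 : √2 ≠ 0 := by positivity
  have e : ∑ j, b j * (boostMat (-b)).mulVec v (.inl j) = ∑ j, b j * v (.inl j) +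
      2 / (1 - ‖b‖ ^ 2) * (∑ j, b j * v (.inl j) - (v (.inr 1) - v (.inr 0)) / √2) * ‖b‖ ^ 2 := by
    rw [← sum_sq_eq, Finset.mul_sum, ← Finset.sum_add_distrib]
    refine Finset.sum_congr rfl fun i _ => ?_
    rw [boostMat_inl, norm_neg, sum_sq_eq]
    simp only [PiLp.neg_apply, neg_mul, Finset.sum_neg_distrib]
    ring
  funext k
  rcases k with i | k
  · rw [boostMat_inl, e, boostMat_inl, boostMat_inr_zero, boostMat_inr_one, norm_neg]
    simp only [PiLp.neg_apply, neg_mul, Finset.sum_neg_distrib]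
    field_simp
    ring_nf
    simp only [sqrt_two_sq, sqrt_two_pow_three]
    ring
  · fin_cases k
    · change (boostMat b).mulVec _ (.inr 0) = v (.inr 0)
      rw [boostMat_inr_zero, e, boostMat_inr_zero, boostMat_inr_one, norm_neg]
      simp only [PiLp.neg_apply, neg_mul, Finset.sum_neg_distrib]
      field_simp
      ring_nf
      simp only [sqrt_two_sq, sqrt_two_pow_three, sqrt_two_pow_four]
      ring
    · change (boostMat b).mulVec _ (.inr 1) = v (.inr 1)
      rw [boostMat_inr_one, e, boostMat_inr_zero, boostMat_inr_one, norm_neg]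
      simp only [PiLp.neg_apply, neg_mul, Finset.sum_neg_distrib]
      field_simp
      ring_nf
      simp only [sqrt_two_sq, sqrt_two_pow_three, sqrt_two_pow_four]
      ring

/-- With `t = (v₋ - v₊) / √2` and `β = ∑ b_j v_j`, the new time coordinate is a positive multiple of
`(1 + ‖b‖ ^ 2) * t + 2 * β`. On the null cone the spatial part has norm at most `t`, so by
Cauchy–Schwarz `2 * |β| ≤ 2 * ‖b‖ * t < (1 + ‖b‖ ^ 2) * t`. -/
theorem boostMat_pos {b : E d} (hb : ‖b‖ < 1) {v : LIdx d → ℝ} (hv : v ∈ nullPlus d) :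
    0 < (boostMat b).mulVec v (.inr 1) - (boostMat b).mulVec v (.inr 0) := by
  have h := one_sub_normSq_pos hb
  have h2 : 0 < √2 := by positivity
  obtain ⟨-, h0, ht⟩ := hv
  rw [boostMat_inr_one, boostMat_inr_zero]
  have hβ : (∑ j, b j * v (.inl j)) ^ 2 ≤ ‖b‖ ^ 2 * ∑ j, v (.inl j) * v (.inl j) := by
    have := Finset.sum_mul_sq_le_sq_mul_sq Finset.univ (fun j => b j) fun j => v (.inl j)
    rwa [← EuclideanSpace.real_norm_sq_eq, Finset.sum_congr rfl fun j _ => sq (v (.inl j))] at this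
  rw [lform] at h0
  generalize ∑ j, b j * v (.inl j) = β at *
  generalize ∑ j, v (.inl j) * v (.inl j) = q at *
  set t := (v (.inr 1) - v (.inr 0)) / √2 with ht'
  have ht0 : 0 < t := by positivity
  have e : v (.inr 1) - v (.inr 0) = √2 * t := by rw [ht']; field_simp
  have hq : q ≤ t ^ 2 := by
    rw [ht', div_pow, sqrt_two_sq]
    nlinarith [sq_nonneg (v (.inr 1) + v (.inr 0))]
  have h3 : (2 * β) ^ 2 < ((1 + ‖b‖ ^ 2) * t) ^ 2 := by
    have h4 : ‖b‖ ^ 2 * q ≤ ‖b‖ ^ 2 * t ^ 2 := by gcongr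
    have h5 : 0 < (1 - ‖b‖ ^ 2) ^ 2 * t ^ 2 := by positivity
    nlinarith
  have h6 := (abs_lt_of_sq_lt_sq' h3 (by positivity)).1
  have e2 : v (.inr 1) + 2 / (1 - ‖b‖ ^ 2) / √2 * (β + ‖b‖ ^ 2 * t) -
      (v (.inr 0) - 2 / (1 - ‖b‖ ^ 2) / √2 * (β + ‖b‖ ^ 2 * t)) =
      √2 * (((1 + ‖b‖ ^ 2) * t + 2 * β) / (1 - ‖b‖ ^ 2)) := by
    have e3 : v (.inr 1) = v (.inr 0) + √2 * t := by linarith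
    rw [e3]
    field_simp
    ring_nf
    rw [sqrt_two_sq]
    ring
  rw [e2]
  have : 0 < (1 + ‖b‖ ^ 2) * t + 2 * β := by linarith
  positivity

theorem sum_mul_eq_inner (b x : E d) : ∑ i, b i * x i = ⟪b, x⟫_ℝ := by
  rw [PiLp.inner_apply]
  exact Finset.sum_congr rfl fun i _ => by simp [mul_comm]

theorem boostMat_nullLift {b : E d} (hb : ‖b‖ < 1) (x : E d) :
    √2 * (boostMat b).mulVec (nullLift x) (.inr 1) = ballDenom b x / (1 - ‖b‖ ^ 2) := by
  have h := one_sub_normSq_pos hb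
  have h2 : √2 ≠ 0 := by positivity
  rw [boostMat_inr_one]
  simp only [nullLift, Sum.elim_inl, Sum.elim_inr, Matrix.cons_val_zero, Matrix.cons_val_one,
    sum_mul_eq_inner]
  field_simp
  rw [sqrt_two_sq, ballDenom]
  ring

theorem moebius_boostMat {b : E d} (hb : ‖b‖ < 1) : moebius (boostMat b) = ballMap b := by
  have h := one_sub_normSq_pos hb
  have h2 : √2 ≠ 0 := by positivity
  funext x
  ext i
  change (boostMat b).mulVec (nullLift x) (.inl i) / _ = _
  rw [boostMat_nullLift hb, boostMat_inl, ballMap]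
  simp only [nullLift, Sum.elim_inl, Sum.elim_inr, Matrix.cons_val_zero, Matrix.cons_val_one,
    sum_mul_eq_inner, PiLp.smul_apply, PiLp.add_apply, smul_eq_mul]
  by_cases h3 : ballDenom b x = 0
  · simp [h3]
  field_simp
  rw [sqrt_two_sq]
  ring

theorem boostMat_mem_confG {b : E d} (hb : ‖b‖ < 1) : boostMat b ∈ confG d := by
  have hb' : ‖-b‖ < 1 := (norm_neg b).trans_lt hb
  refine mem_confG_of_inverse (boostMat_boostMat_neg hb) (lform_boostMat hb) (boostMat_det hb)
    (fun v hv => boostMat_pos hb hv) (fun v hv => boostMat_pos hb' hv) (fun x hx e => ?_)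
    (fun x hx => ?_) fun x hx => ?_
  · have h1 := boostMat_nullLift hb x
    have h2 := ballDenom_pos (norm_mul_norm_lt hb (mem_ball_zero_iff.1 hx).le)
    have h3 := one_sub_normSq_pos hb
    rw [e, mul_zero] at h1
    exact (div_pos h2 h3).ne h1
  · rw [moebius_boostMat hb]
    exact ballMap_mem_ball hb hx
  · refine ⟨ballMap (-b) x, ballMap_mem_ball hb' hx, ?_⟩
    rw [moebius_boostMat hb]
    simpa using ballMap_neg_ballMap hb'
      (ballDenom_pos (norm_mul_norm_lt hb' (mem_ball_zero_iff.1 hx).le))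

end

/-! ### Rotations, and invariance of vacuum expectation values under similarities -/

section

variable {d : ℕ}

/-! ## Rotations -/

/-- The Lorentz matrix of a rotation. -/
def rotMat (O : E d ≃ₗᵢ[ℝ] E d) : Matrix (LIdx d) (LIdx d) ℝ :=
  Matrix.fromBlocks (LinearMap.toMatrix (EuclideanSpace.basisFun (Fin d) ℝ).toBasis
    (EuclideanSpace.basisFun (Fin d) ℝ).toBasis (O.toLinearEquiv : E d →ₗ[ℝ] E d)) 0 0 1

theorem rotMat_inl (O : E d ≃ₗᵢ[ℝ] E d) (v : LIdx d → ℝ) (i : Fin d) :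
    (rotMat O).mulVec v (.inl i) = O (WithLp.toLp 2 fun i => v (.inl i)) i := by
  rw [rotMat, Matrix.fromBlocks_mulVec]
  simp only [Sum.elim_inl, Matrix.zero_mulVec, add_zero]
  have h := LinearMap.toMatrix_mulVec_repr (EuclideanSpace.basisFun (Fin d) ℝ).toBasis
    (EuclideanSpace.basisFun (Fin d) ℝ).toBasis (O.toLinearEquiv : E d →ₗ[ℝ] E d)
    (WithLp.toLp 2 fun i => v (.inl i))
  have e : ⇑((EuclideanSpace.basisFun (Fin d) ℝ).toBasis.repr
      (WithLp.toLp 2 fun i => v (.inl i))) = v ∘ Sum.inl := by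
    funext j
    simp
  rw [e] at h
  have h' := congrFun h i
  simpa using h'

theorem rotMat_inr (O : E d ≃ₗᵢ[ℝ] E d) (v : LIdx d → ℝ) (k : Fin 2) :
    (rotMat O).mulVec v (.inr k) = v (.inr k) := by
  rw [rotMat, Matrix.fromBlocks_mulVec]
  simp

theorem moebius_rotMat (O : E d ≃ₗᵢ[ℝ] E d) : moebius (rotMat O) = O := by
  have h2 : √2 ≠ 0 := by positivity
  funext x
  ext i
  change (rotMat O).mulVec (nullLift x) (.inl i) / (√2 * (rotMat O).mulVec (nullLift x) (.inr 1)) = _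
  rw [rotMat_inl, rotMat_inr]
  have e : √2 * nullLift x (.inr 1) = 1 := mul_one_div_cancel h2
  rw [e, div_one]
  rfl

theorem rotMat_mem_confG {O : E d ≃ₗᵢ[ℝ] E d}
    (hO : LinearMap.det (O.toLinearEquiv : E d →ₗ[ℝ] E d) = 1) : rotMat O ∈ confG d := by
  have hpos : ∀ O : E d ≃ₗᵢ[ℝ] E d, ∀ v ∈ nullPlus d,
      0 < (rotMat O).mulVec v (.inr 1) - (rotMat O).mulVec v (.inr 0) := fun O v hv => by
    rw [rotMat_inr, rotMat_inr]
    exact hv.2.2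
  refine mem_confG_of_inverse (g' := rotMat O.symm) (fun v => ?_) (fun v w => ?_) ?_ (hpos O)
    (hpos O.symm) (fun x _ => ?_) (fun x hx => ?_) fun x hx => ⟨O.symm x, ?_, ?_⟩
  · funext k
    rcases k with i | k
    · rw [rotMat_inl]
      simp only [rotMat_inl]
      change O (O.symm _) i = _
      rw [LinearIsometryEquiv.apply_symm_apply]
    · rw [rotMat_inr, rotMat_inr]
  · rw [lform, lform]
    simp only [rotMat_inl, rotMat_inr]
    rw [sum_mul_eq_inner, LinearIsometryEquiv.inner_map_map, ← sum_mul_eq_inner]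
  · rw [rotMat, Matrix.det_fromBlocks_zero₂₁, LinearMap.det_toMatrix, hO]
    simp
  · rw [rotMat_inr]
    simp [nullLift]
  · rw [moebius_rotMat]
    simpa using hx
  · simpa using hx
  · rw [moebius_rotMat, LinearIsometryEquiv.apply_symm_apply]

theorem flatConf_rotation {O : E d ≃ₗᵢ[ℝ] E d}
    (hO : LinearMap.det (O.toLinearEquiv : E d →ₗ[ℝ] E d) = 1) : FlatConf O Set.univ := by
  have e : ∀ x, fderiv ℝ O x = (O.toContinuousLinearEquiv : E d →L[ℝ] E d) := fun x =>
    O.toContinuousLinearEquiv.fderiv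
  refine ⟨isOpen_univ, O.contDiff.contDiffOn, fun x _ => ?_, fun x _ => ?_⟩
  · refine conformalAt_iff'.2 ⟨1, one_pos, fun u v => ?_⟩
    rw [e, one_mul]
    exact O.inner_map_map u v
  · rw [e]
    exact lt_of_lt_of_eq one_pos hO.symm

/-! ## Composition of configurations with conformal maps -/

/-- Only the composites have to land in the disk, so `T` may be an expansion, which is not itself an
operation of the operad. -/
theorem CE.exists_comp {n : ℕ} (f : CE d n) {F : Fin n → E d → E d}
    (hf : ∀ i, f.1 i = (F i : DGerm d (E d))) {T : E d → E d} (hT : FlatConf T Set.univ)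
    (hT' : Function.Injective T) (hm : ∀ i, ∀ x ∈ cDisk d, T (F i x) ∈ cDisk d) :
    ∃ g : CE d n, ∀ i, g.1 i = ((fun x => T (F i x) : E d → E d) : DGerm d (E d)) := by
  obtain ⟨F', V, h, hf'⟩ := f.2
  have he : ∀ i, F' i =ᶠ[𝓝ˢ (cDisk d)] F i := fun i =>
    Filter.Germ.coe_eq.1 ((hf' i).symm.trans (hf i))
  refine ⟨⟨fun i => ((T ∘ F' i : E d → E d) : DGerm d (E d)), fun i => T ∘ F' i,
    fun i => V i ∩ F' i ⁻¹' Set.univ, ⟨fun i => FlatConf.precomp d _ _ _ _ hT (h.conf i),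
      fun i => by simpa using h.subset i,
      fun i => (hT'.injOn.comp (h.injOn i) (Set.mapsTo_univ _ _)).mono Set.inter_subset_left,
      fun i j hij => ?_, fun i x hx => ?_⟩, fun _ => rfl⟩, fun i => ?_⟩
  · simp only [Set.preimage_univ, Set.inter_univ, Set.image_comp]
    exact (Set.disjoint_image_iff hT').2 (h.disjoint i j hij)
  · have := (he i).self_of_nhdsSet hx
    rw [Function.comp_apply, this]
    exact hm i x hx
  · refine Filter.Germ.coe_eq.2 ?_
    filter_upwards [he i] with x hx
    rw [Function.comp_apply, hx]

theorem CE.mapsTo_cDisk {n : ℕ} (f : CE d n) {i : Fin n} {F : E d → E d}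
    (hf : f.1 i = (F : DGerm d (E d))) {x : E d} (hx : x ∈ cDisk d) : F x ∈ cDisk d := by
  obtain ⟨F', V, h, hf'⟩ := f.2
  have he : F' i =ᶠ[𝓝ˢ (cDisk d)] F := Filter.Germ.coe_eq.1 ((hf' i).symm.trans hf)
  rw [← he.self_of_nhdsSet hx]
  exact h.mapsTo i hx

theorem CE.eventually_norm_lt {n : ℕ} (f : CE d n) {i : Fin n} {F : E d → E d}
    (hf : f.1 i = (F : DGerm d (E d))) : ∀ᶠ x in 𝓝ˢ (cDisk d), ‖F x‖ < 2 := by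
  have h := CE.tendsto f i
  rw [hf] at h
  have h2 : {x : E d | ‖x‖ < 2} ∈ 𝓝ˢ (cDisk d) :=
    (isOpen_lt continuous_norm continuous_const).mem_nhdsSet.2 fun x hx =>
      lt_of_le_of_lt (mem_closedBall_zero_iff.1 hx) one_lt_two
  exact h h2

/-! ## Invariance of vacuum expectation values under similarities -/

variable {V : Type*} [NormedAddCommGroup V] [InnerProductSpace ℂ V] {A : CEAlgebra d V}
  {Φ : HilbertFiltration A}

theorem CondU.fixesVev_ballMap (hU : CondU Φ) {b : E d} (hb : ‖b‖ < 1) {φ : CE d 1}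
    (hφ : φ.1 0 = (ballMap b : DGerm d (E d))) : A.FixesVev φ :=
  hU.fixesVev (g := boostMat b) ⟨boostMat_mem_confG hb, by rw [moebius_boostMat hb]; exact hφ⟩

theorem CondU.exists_ballMap_comp (hU : CondU Φ) {b : E d} (hb : ‖b‖ < 1) {n : ℕ} (f : CE d n) :
    ∃ g : CE d n, A.vev g = A.vev f ∧ ∀ i, ∀ F : E d → E d, f.1 i = (F : DGerm d (E d)) →
      g.1 i = ((fun x => ballMap b (F x) : E d → E d) : DGerm d (E d)) := by
  obtain ⟨φ, hφ⟩ := exists_CE_ballMap hb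
  exact ⟨CE.after φ f, (hU.fixesVev_ballMap hb hφ).vev_after f, fun i F hF => CE.after_coe hφ hF⟩

theorem CondU.vev_rotation (hU : CondU Φ) {O : E d ≃ₗᵢ[ℝ] E d}
    (hO : LinearMap.det (O.toLinearEquiv : E d →ₗ[ℝ] E d) = 1) {n : ℕ} {f g : CE d n}
    {F : Fin n → E d → E d} (hf : ∀ i, f.1 i = (F i : DGerm d (E d)))
    (hg : ∀ i, g.1 i = ((fun x => O (F i x) : E d → E d) : DGerm d (E d))) :
    A.vev g = A.vev f := by
  obtain ⟨φ, hφ⟩ := CE.exists_comp (CE.one d) (fun _ => rfl) (flatConf_rotation hO) O.injective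
    fun _ x hx => by simpa using hx
  have h : IsMoebius (rotMat O) φ := ⟨rotMat_mem_confG hO, by rw [moebius_rotMat]; exact hφ 0⟩
  rw [← (hU.fixesVev h).vev_after f]
  congr 1
  exact Subtype.ext (funext fun i => (hg i).trans (CE.after_coe (hφ 0) (hf i)).symm)

/-- Write `T_b` for `ballMap b`. With `r = 1/2` and a small `b = -ε w`, the composite of `T_{-b}`,
the expansion by `2`, `T_{b/2}` and the dilation by `1/2` is the affine map `x ↦ l x + c w`.
Preceded by the dilation `s = c μ / l` it becomes `x ↦ c (μ x + w)`. Each factor preserves the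
vacuum expectation value, and so does the dilation by `c`, which can then be removed. -/
theorem CondD.vev_smul_add (hD : CondD Φ) (hU : CondU Φ) {μ : ℝ} (hμ : 0 < μ) (w : E d) {n : ℕ}
    {f g : CE d n} {F : Fin n → E d → E d} (hf : ∀ i, f.1 i = (F i : DGerm d (E d)))
    (hg : ∀ i, g.1 i = ((fun x => μ • F i x + w : E d → E d) : DGerm d (E d))) :
    A.vev g = A.vev f := by
  have hw0 := norm_nonneg w
  -- These bounds give `‖b‖ ≤ 1/4` and `s ≤ 1/4`, so that after the first translation the disks lie
  -- within radius `1/2` and may be doubled.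
  obtain ⟨ε, hε, hε1, hεμ, hεw⟩ : ∃ ε : ℝ, 0 < ε ∧ ε ≤ 1 / 4 ∧ ε * μ ≤ 1 / 4 ∧ ε * ‖w‖ ≤ 1 / 4 := by
    refine ⟨1 / (4 * (1 + μ + ‖w‖)), by positivity, ?_, ?_, ?_⟩
    · exact one_div_le_one_div_of_le (by norm_num) (by linarith)
    · rw [div_mul_eq_mul_div, div_le_div_iff₀ (by positivity) (by norm_num)]
      linarith
    · rw [div_mul_eq_mul_div, div_le_div_iff₀ (by positivity) (by norm_num)]
      linarith
  obtain ⟨b, hb, hbw⟩ : ∃ b : E d, ‖b‖ ≤ 1 / 4 ∧ b = -(ε • w) := by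
    refine ⟨_, ?_, rfl⟩
    rwa [norm_neg, norm_smul, Real.norm_of_nonneg hε.le]
  have hb0 := norm_nonneg b
  have hb1 : ‖b‖ < 1 := by linarith
  have hbn : ‖-b‖ < 1 := (norm_neg b).trans_lt hb1
  have hp := one_sub_normSq_pos hb1
  have hp1 : 15 / 16 ≤ 1 - ‖b‖ ^ 2 := by nlinarith
  -- The two coefficients of `smul_ballMap_smul` at `r = 1/2`: `l` is the linear one, and `c` below
  -- is the coefficient of `w` after inserting `b = -ε w`.
  obtain ⟨l, hl⟩ : ∃ l, l = (1 - (1 / 2 : ℝ) ^ 2 * ‖b‖ ^ 2) / (1 - ‖b‖ ^ 2) := ⟨_, rfl⟩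
  have hl1 : 1 ≤ l := by
    rw [hl, le_div_iff₀ hp]
    nlinarith
  obtain ⟨c, hc⟩ : ∃ c, c = 3 / 4 * ε / (1 - ‖b‖ ^ 2) := ⟨_, rfl⟩
  have hc0 : 0 < c := by rw [hc]; positivity
  have hcε : c ≤ ε := by
    rw [hc, div_le_iff₀ hp]
    nlinarith
  obtain ⟨s, hs⟩ : ∃ s, s = c * μ / l := ⟨_, rfl⟩
  have hs0 : 0 < s := by rw [hs]; positivity
  have hs1 : s ≤ 1 / 4 := by
    rw [hs, div_le_iff₀ (by linarith)]
    nlinarith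
  have hls : l * s = c * μ := by rw [hs]; field_simp
  have hr : (0 : ℝ) < 1 / 2 ∧ (1 / 2 : ℝ) ≤ 1 := by norm_num
  have hbr : ‖(1 / 2 : ℝ) • b‖ < 1 := by
    rw [norm_smul, Real.norm_of_nonneg (by norm_num)]
    linarith
  -- the chain of configurations
  have h0 : ∀ i, (CE.after (dil d s ⟨hs0, by linarith⟩) f).1 i =
      ((fun x => s • F i x : E d → E d) : DGerm d (E d)) := fun i =>
    CE.after_coe (φ := dil d s ⟨hs0, by linarith⟩) (T := fun x => s • x) rfl (hf i)
  obtain ⟨f₁, h₁, hf₁⟩ := hU.exists_ballMap_comp hbn (CE.after (dil d s ⟨hs0, by linarith⟩) f)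
  have hf₁ := fun i => hf₁ i _ (h0 i)
  have hsF : ∀ i, ∀ x, ‖F i x‖ < 2 → ‖s • F i x‖ ≤ 1 / 2 := fun i x hx => by
    rw [norm_smul, Real.norm_of_nonneg hs0.le]
    nlinarith [norm_nonneg (F i x)]
  obtain ⟨f₂, hf₂⟩ := CE.exists_comp f₁ hf₁ (T := fun x => (1 / 2 : ℝ)⁻¹ • x)
    (flatConf_smul (by norm_num)) (smul_right_injective _ (by norm_num)) fun i x hx => by
      have h1 := mem_closedBall_zero_iff.1 (f.mapsTo_cDisk (hf i) hx)
      have h2 : ‖s • F i x‖ ≤ 1 / 4 := by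
        rw [norm_smul, Real.norm_of_nonneg hs0.le]
        nlinarith [norm_nonneg (F i x)]
      have h3 := norm_ballMap_le hbn (h2.trans (by norm_num))
      rw [mem_closedBall_zero_iff, norm_smul, Real.norm_of_nonneg (by norm_num)]
      rw [norm_neg] at h3
      linarith
  -- The expansion preserves the value because it is undone by the dilation with factor `1/2`.
  have e₂ : A.vev f₁ = A.vev f₂ := hD.vev_smul hr hf₂ fun i => by
    rw [hf₁]
    simp only [smul_smul]
    norm_num
  obtain ⟨f₃, h₃, hf₃⟩ := hU.exists_ballMap_comp hbr f₂
  have hf₃ := fun i => hf₃ i _ (hf₂ i)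
  have e₄ : A.vev (CE.after (dil d (1 / 2) hr) f₃) = A.vev g := by
    refine hD.vev_smul ⟨hc0, by linarith⟩ hg fun i => ?_
    refine (CE.after_coe (φ := dil d (1 / 2) hr) (T := fun x => (1 / 2 : ℝ) • x) rfl (hf₃ i)).trans
      (Filter.Germ.coe_eq.2 ?_)
    filter_upwards [f.eventually_norm_lt (hf i)] with x hx
    have h1 := hsF i x hx
    have h2 := norm_ballMap_le hbn (h1.trans (by norm_num))
    rw [norm_neg] at h2
    have h3 : 0 < ballDenom b (ballMap (-b) (s • F i x)) :=
      ballDenom_pos (norm_mul_norm_lt hb1 (by linarith))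
    have h4 : 0 < ballDenom (-b) (s • F i x) :=
      ballDenom_pos (norm_mul_norm_lt hbn (by linarith))
    have h5 := ballMap_neg_ballMap hbn h4
    rw [neg_neg] at h5
    change (1 / 2 : ℝ) • ballMap ((1 / 2 : ℝ) • b) ((1 / 2 : ℝ)⁻¹ • ballMap (-b) (s • F i x)) = _
    rw [smul_ballMap_smul hb1 (by norm_num) h3, h5, ← hl, smul_smul, hls, smul_add, smul_smul, hbw,
      smul_neg, ← neg_smul, smul_smul, ← hbw]
    congr 2
    rw [hc]
    ring
  rw [← e₄, (hD.fixesVev_dil hr).vev_after, h₃, ← e₂, h₁, (hD.fixesVev_dil _).vev_after]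

/-- Vacuum expectation values are invariant under orientation-preserving similarities. -/
theorem CondD.vev_similarity (hD : CondD Φ) (hU : CondU Φ) {μ : ℝ} (hμ : 0 < μ)
    {O : E d ≃ₗᵢ[ℝ] E d} (hO : LinearMap.det (O.toLinearEquiv : E d →ₗ[ℝ] E d) = 1) (w : E d)
    {n : ℕ} {f g : CE d n} {F : Fin n → E d → E d} (hf : ∀ i, f.1 i = (F i : DGerm d (E d)))
    (hg : ∀ i, g.1 i = ((fun x => μ • O (F i x) + w : E d → E d) : DGerm d (E d))) :
    A.vev g = A.vev f := by
  obtain ⟨f', hf'⟩ := CE.exists_comp f hf (flatConf_rotation hO) O.injective fun i x hx => by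
    simpa using f.mapsTo_cDisk (hf i) hx
  rw [hD.vev_smul_add hU hμ w hf' hg, hU.vev_rotation hO hf hf']

end

/-! ### Liouville's theorem for proper conformal maps of the whole space, dimension at least three
-/

section

variable {d : ℕ} {G : Type*} [NormedAddCommGroup G] [NormedSpace ℝ G]

/-! ## Directional derivatives of smooth functions -/

/-- The directional derivative of `F`, as a function. -/
def dirDeriv (u : E d) (F : E d → G) (x : E d) : G := fderiv ℝ F x u

theorem contDiff_dirDeriv (u : E d) {F : E d → G} (hF : ContDiff ℝ ∞ F) :
    ContDiff ℝ ∞ (dirDeriv u F) :=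
  (hF.fderiv_right (m := ∞) (by simp)).clm_apply contDiff_const

theorem dirDeriv_comm (u v : E d) {F : E d → G} (hF : ContDiff ℝ ∞ F) :
    dirDeriv u (dirDeriv v F) = dirDeriv v (dirDeriv u F) := by
  funext x
  have h1 : DifferentiableAt ℝ (fderiv ℝ F) x :=
    (hF.fderiv_right (m := ∞) (by simp)).differentiable (by simp) x
  have e : ∀ w z, dirDeriv w (dirDeriv z F) x = fderiv ℝ (fderiv ℝ F) x w z := fun w z => by
    have := (h1.hasFDerivAt.clm_apply (hasFDerivAt_const z x)).fderiv
    change fderiv ℝ (fun y => fderiv ℝ F y z) x w = _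
    rw [this]
    simp
  rw [e, e]
  exact (hF.contDiffAt.isSymmSndFDerivAt (by simp; exact WithTop.coe_le_coe.2 (le_top : (2 : ℕ∞) ≤ ⊤))) u v

theorem dirDeriv_add_left (u v : E d) (F : E d → G) :
    dirDeriv (u + v) F = fun x => dirDeriv u F x + dirDeriv v F x :=
  funext fun x => map_add (fderiv ℝ F x) u v

theorem dirDeriv_sub_left (u v : E d) (F : E d → G) :
    dirDeriv (u - v) F = fun x => dirDeriv u F x - dirDeriv v F x :=
  funext fun x => map_sub (fderiv ℝ F x) u v

theorem dirDeriv_add (u : E d) {F F' : E d → G} (hF : ContDiff ℝ ∞ F) (hF' : ContDiff ℝ ∞ F') :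
    dirDeriv u (fun x => F x + F' x) = fun x => dirDeriv u F x + dirDeriv u F' x := by
  funext x
  have := ((hF.differentiable (by simp) x).hasFDerivAt.add
    (hF'.differentiable (by simp) x).hasFDerivAt).fderiv
  exact DFunLike.congr_fun this u

theorem dirDeriv_sub (u : E d) {F F' : E d → G} (hF : ContDiff ℝ ∞ F) (hF' : ContDiff ℝ ∞ F') :
    dirDeriv u (fun x => F x - F' x) = fun x => dirDeriv u F x - dirDeriv u F' x := by
  funext x
  have := ((hF.differentiable (by simp) x).hasFDerivAt.sub
    (hF'.differentiable (by simp) x).hasFDerivAt).fderiv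
  exact DFunLike.congr_fun this u

theorem dirDeriv_smul (u : E d) {r : E d → ℝ} {F : E d → G} (hr : ContDiff ℝ ∞ r)
    (hF : ContDiff ℝ ∞ F) : dirDeriv u (fun x => r x • F x) =
      fun x => r x • dirDeriv u F x + dirDeriv u r x • F x := by
  funext x
  have := ((hr.differentiable (by simp) x).hasFDerivAt.smul
    (hF.differentiable (by simp) x).hasFDerivAt).fderiv
  exact DFunLike.congr_fun this u

theorem dirDeriv_inner (u : E d) {F F' : E d → E d} (hF : ContDiff ℝ ∞ F)
    (hF' : ContDiff ℝ ∞ F') : dirDeriv u (fun x => ⟪F x, F' x⟫_ℝ) =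
      fun x => ⟪F x, dirDeriv u F' x⟫_ℝ + ⟪dirDeriv u F x, F' x⟫_ℝ := by
  funext x
  have := ((hF.differentiable (by simp) x).hasFDerivAt.inner ℝ
    (hF'.differentiable (by simp) x).hasFDerivAt).fderiv
  exact DFunLike.congr_fun this u

theorem dirDeriv_const (u : E d) (c : G) : dirDeriv u (fun _ : E d => c) = fun _ => 0 := by
  funext x
  simp [dirDeriv]

theorem hasDerivAt_line {F : E d → G} (hF : ContDiff ℝ ∞ F) (x e : E d) (t : ℝ) :
    HasDerivAt (fun t : ℝ => F (x + t • e)) (dirDeriv e F (x + t • e)) t := by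
  have h1 : HasDerivAt (fun t : ℝ => x + t • e) e t := by
    simpa using ((hasDerivAt_id t).smul_const e).const_add x
  exact (hF.differentiable (by simp) (x + t • e)).hasFDerivAt.comp_hasDerivAt t h1

/-- A smooth function whose third derivative in direction `e` vanishes is quadratic on lines in
direction `e`. -/
theorem eq_quadratic_of_dirDeriv {r : E d → ℝ} (hr : ContDiff ℝ ∞ r) {e : E d}
    (h : ∀ x, dirDeriv e (dirDeriv e (dirDeriv e r)) x = 0) (x : E d) (t : ℝ) :
    r (x + t • e) = r x + t * dirDeriv e r x + t ^ 2 / 2 * dirDeriv e (dirDeriv e r) x := by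
  have h1 := contDiff_dirDeriv e hr
  have h2 := contDiff_dirDeriv e h1
  have key : ∀ {f g : ℝ → ℝ}, (∀ t, HasDerivAt f (g t) t) → (∀ t, g t = 0) → ∀ t, f t = f 0 :=
    fun hf hg t => is_const_of_deriv_eq_zero (fun t => (hf t).differentiableAt)
      (fun t => (hf t).deriv.trans (hg t)) t 0
  have a2 : ∀ t : ℝ, dirDeriv e (dirDeriv e r) (x + t • e) = dirDeriv e (dirDeriv e r) x := fun t => by
    simpa using key (hasDerivAt_line h2 x e) (fun t => h _) t
  have a1 : ∀ t : ℝ, dirDeriv e r (x + t • e) =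
      dirDeriv e r x + t * dirDeriv e (dirDeriv e r) x := fun t => by
    have := key (fun t => (hasDerivAt_line h1 x e t).sub
      ((hasDerivAt_id t).mul_const (dirDeriv e (dirDeriv e r) x))) (fun t => by rw [a2]; ring) t
    simp only [id, zero_smul, add_zero, zero_mul, sub_zero, Pi.sub_apply] at this
    linarith
  have := key (fun t => ((hasDerivAt_line hr x e t).sub
    ((hasDerivAt_id t).mul_const (dirDeriv e r x))).sub
      (((hasDerivAt_pow 2 t).div_const 2).mul_const (dirDeriv e (dirDeriv e r) x)))
    (fun t => by rw [a1]; simp) t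
  simp only [id, zero_smul, add_zero, zero_mul, sub_zero, Pi.sub_apply] at this
  simp at this
  linarith

/-- A curve whose speed is the inverse of a positive quadratic polynomial is bounded. -/
theorem norm_le_of_deriv_le_inv_quadratic {f f' : ℝ → G} (hf : ∀ t, HasDerivAt f (f' t) t)
    {a b c : ℝ} (hc : 0 < c) (hpos : ∀ t : ℝ, 0 < a + t * b + t ^ 2 / 2 * c)
    (hle : ∀ t, ‖f' t‖ ≤ (a + t * b + t ^ 2 / 2 * c)⁻¹) : ∃ C, ∀ t, 0 ≤ t → ‖f t‖ ≤ C := by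
  obtain ⟨s, hs⟩ : ∃ s, s = b / c := ⟨_, rfl⟩
  have h1 : ∀ t, a + t * b + t ^ 2 / 2 * c = c / 2 * (t + s) ^ 2 + (a - c / 2 * s ^ 2) := fun t => by
    rw [hs]; field_simp; ring
  have hδ : 0 < a - c / 2 * s ^ 2 := by
    have := hpos (-s)
    rw [h1] at this
    simpa using this
  -- After completing the square the quadratic is at least `k * (1 + (t + s) ^ 2)`, so the length of
  -- the curve is controlled by an arctangent.
  obtain ⟨k, hk, hk1, hk2⟩ : ∃ k, 0 < k ∧ k ≤ c / 2 ∧ k ≤ a - c / 2 * s ^ 2 :=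
    ⟨_, lt_min (half_pos hc) hδ, min_le_left _ _, min_le_right _ _⟩
  have h2 : ∀ t, ‖f' t‖ ≤ k⁻¹ * (1 / (1 + (t + s) ^ 2)) := fun t => by
    refine (hle t).trans ?_
    rw [h1, ← one_div, ← one_div, div_mul_div_comm, one_mul]
    refine one_div_le_one_div_of_le (by positivity) ?_
    nlinarith [sq_nonneg (t + s)]
  have hB : ∀ t, HasDerivAt (fun t => ‖f 0‖ + k⁻¹ * (Real.arctan (t + s) - Real.arctan s))
      (k⁻¹ * (1 / (1 + (t + s) ^ 2))) t := fun t => by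
    simpa using ((((hasDerivAt_id t).add_const s).arctan).sub_const (Real.arctan s)).const_mul k⁻¹
      |>.const_add ‖f 0‖
  refine ⟨‖f 0‖ + k⁻¹ * Real.pi, fun T hT => ?_⟩
  have h3 := image_norm_le_of_norm_deriv_right_le_deriv_boundary (f := f) (f' := f') (a := 0)
    (b := T) (B := fun t => ‖f 0‖ + k⁻¹ * (Real.arctan (t + s) - Real.arctan s))
    (fun t _ => (hf t).continuousAt.continuousWithinAt) (fun t _ => (hf t).hasDerivWithinAt)
    (by simp) hB (fun t _ => h2 t) (Set.right_mem_Icc.2 hT)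
  refine h3.trans ?_
  have := Real.arctan_lt_pi_div_two (T + s)
  have := Real.neg_pi_div_two_lt_arctan s
  gcongr
  linarith

/-! ## Liouville's theorem in dimension at least three -/

theorem exists_unit_orthogonal {n : ℕ} (h : n < d) (v : Fin n → E d) :
    ∃ w : E d, ‖w‖ = 1 ∧ ∀ i, ⟪v i, w⟫_ℝ = 0 := by
  have h1 : Module.finrank ℝ (Submodule.span ℝ (Set.range v)) ≤ n := by
    have := finrank_range_le_card (R := ℝ) v
    rwa [Fintype.card_fin] at this
  have h2 := Submodule.finrank_add_finrank_orthogonal (Submodule.span ℝ (Set.range v))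
  rw [finrank_euclideanSpace_fin] at h2
  have : Nontrivial (Submodule.span ℝ (Set.range v))ᗮ :=
    Module.nontrivial_of_finrank_pos (R := ℝ) (by omega)
  obtain ⟨w, hw⟩ := exists_ne (0 : (Submodule.span ℝ (Set.range v))ᗮ)
  have hw0 : (w : E d) ≠ 0 := fun e => hw (Subtype.ext e)
  refine ⟨(‖(w : E d)‖⁻¹ : ℝ) • (w : E d), norm_smul_inv_norm hw0, fun i => ?_⟩
  rw [inner_smul_right, (Submodule.mem_orthogonal _ _).1 w.2 _ (Submodule.subset_span ⟨i, rfl⟩),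
    mul_zero]

/-- The inverse `ρ` of the conformal factor of a smooth conformal map. -/
structure IsInvFactor (h : E d → E d) (ρ : E d → ℝ) : Prop where
  smooth : ContDiff ℝ ∞ h
  smooth' : ContDiff ℝ ∞ ρ
  pos : ∀ x, 0 < ρ x
  inner_eq : ∀ x u v, ρ x ^ 2 * ⟪dirDeriv u h x, dirDeriv v h x⟫_ℝ = ⟪u, v⟫_ℝ

theorem FlatConf.exists_isInvFactor (hd : 0 < d) {h : E d → E d} (hh : FlatConf h Set.univ) :
    ∃ ρ, IsInvFactor h ρ := by
  have hs : ContDiff ℝ ∞ h := contDiffOn_univ.1 hh.smooth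
  obtain ⟨e, he, -⟩ := exists_unit_orthogonal (n := 0) hd Fin.elim0
  have hc : ∀ x, ∃ c : ℝ, 0 < c ∧ ∀ u v : E d, ⟪dirDeriv u h x, dirDeriv v h x⟫_ℝ = c * ⟪u, v⟫_ℝ :=
    fun x => conformalAt_iff'.1 (hh.conformal x trivial)
  have hn : ∀ x, ∃ c : ℝ, 0 < c ∧ ‖dirDeriv e h x‖ ^ 2 = c ∧
      ∀ u v : E d, ⟪dirDeriv u h x, dirDeriv v h x⟫_ℝ = c * ⟪u, v⟫_ℝ := fun x => by
    obtain ⟨c, hc, h1⟩ := hc x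
    refine ⟨c, hc, ?_, h1⟩
    rw [← real_inner_self_eq_norm_sq, h1, real_inner_self_eq_norm_sq, he, one_pow, mul_one]
  have hp : ∀ x, 0 < ‖dirDeriv e h x‖ := fun x => by
    obtain ⟨c, hc, h1, -⟩ := hn x
    refine (norm_nonneg _).lt_of_ne fun h0 => ?_
    rw [← h0] at h1
    simp at h1
    exact hc.ne h1
  -- Stretching in one fixed unit direction already gives the conformal factor, and the norm is
  -- smooth away from zero.
  refine ⟨fun x => ‖dirDeriv e h x‖⁻¹, hs, ?_, fun x => inv_pos.2 (hp x), fun x u v => ?_⟩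
  · refine ((contDiff_dirDeriv e hs).norm ℝ fun x => norm_pos_iff.1 (hp x)).inv fun x => (hp x).ne'
  · obtain ⟨c, hc, h1, h2⟩ := hn x
    have := hp x
    rw [h2, ← h1]
    field_simp

namespace IsInvFactor

variable {h : E d → E d} {ρ : E d → ℝ}

theorem inner_dirDeriv (hr : IsInvFactor h ρ) (x u v : E d) :
    ⟪dirDeriv u h x, dirDeriv v h x⟫_ℝ = ⟪u, v⟫_ℝ / ρ x ^ 2 := by
  have := hr.pos x
  rw [eq_div_iff (by positivity), mul_comm, hr.inner_eq]

/-- Differentiate the identity `inner_eq`, whose right-hand side is constant in `x`, in direction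
`c`. -/
theorem inner_second (hr : IsInvFactor h ρ) (x a b c : E d) :
    ρ x * (⟪dirDeriv c (dirDeriv a h) x, dirDeriv b h x⟫_ℝ +
      ⟪dirDeriv a h x, dirDeriv c (dirDeriv b h) x⟫_ℝ) =
      -2 * dirDeriv c ρ x * ⟪a, b⟫_ℝ / ρ x ^ 2 := by
  have ha := contDiff_dirDeriv a hr.smooth
  have hb := contDiff_dirDeriv b hr.smooth
  have h1 : dirDeriv c (fun x => (ρ x • ρ x) • ⟪dirDeriv a h x, dirDeriv b h x⟫_ℝ) x = 0 := by
    have : (fun x => (ρ x • ρ x) • ⟪dirDeriv a h x, dirDeriv b h x⟫_ℝ) = fun _ => ⟪a, b⟫_ℝ :=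
      funext fun x => by rw [← hr.inner_eq x a b, smul_eq_mul, smul_eq_mul, sq]
    rw [this, dirDeriv_const]
  have hρ : ContDiff ℝ ∞ fun x => ρ x • ρ x := hr.smooth'.smul hr.smooth'
  rw [dirDeriv_smul c hρ (ha.inner ℝ hb), dirDeriv_inner c ha hb,
    dirDeriv_smul c hr.smooth' hr.smooth'] at h1
  simp only [hr.inner_dirDeriv, smul_eq_mul] at h1
  have hp := hr.pos x
  have e : ρ x * (ρ x * (⟪dirDeriv c (dirDeriv a h) x, dirDeriv b h x⟫_ℝ +
      ⟪dirDeriv a h x, dirDeriv c (dirDeriv b h) x⟫_ℝ) -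
      -2 * dirDeriv c ρ x * ⟪a, b⟫_ℝ / ρ x ^ 2) = 0 := by
    rw [← h1]
    ring
  exact sub_eq_zero.1 ((mul_eq_zero.1 e).resolve_left hp.ne')

/-- The second derivative of a conformal map. -/
theorem inner_second_eq (hr : IsInvFactor h ρ) (x a b c : E d) :
    ρ x ^ 3 * ⟪dirDeriv a (dirDeriv b h) x, dirDeriv c h x⟫_ℝ =
      -(dirDeriv a ρ x * ⟪b, c⟫_ℝ + dirDeriv b ρ x * ⟪a, c⟫_ℝ - dirDeriv c ρ x * ⟪a, b⟫_ℝ) := by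
  have h1 := hr.inner_second x b c a
  have h2 := hr.inner_second x a c b
  have h3 := hr.inner_second x a b c
  rw [dirDeriv_comm b a hr.smooth] at h2
  rw [dirDeriv_comm c a hr.smooth, dirDeriv_comm c b hr.smooth] at h3
  rw [real_inner_comm _ (dirDeriv b h x)] at h1
  rw [real_inner_comm _ (dirDeriv a h x)] at h2
  rw [real_inner_comm _ (dirDeriv a h x)] at h3
  have hp := hr.pos x
  rw [eq_div_iff (by positivity)] at h1 h2 h3
  -- The alternating sum over the three placements of the derivative isolates one second derivative,
  -- as for Christoffel symbols.
  linear_combination (h1 + h2 - h3) / 2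

theorem eq_zero_of_inner (hr : IsInvFactor h ρ) {x y : E d}
    (hy : ∀ c, ⟪y, dirDeriv c h x⟫_ℝ = 0) : y = 0 := by
  have hp := hr.pos x
  have hinj : Function.Injective (fderiv ℝ h x : E d →ₗ[ℝ] E d) := by
    rw [← LinearMap.ker_eq_bot, LinearMap.ker_eq_bot']
    intro u hu
    have := hr.inner_eq x u u
    have e : dirDeriv u h x = 0 := hu
    rw [e, inner_zero_left, mul_zero] at this
    exact inner_self_eq_zero.1 this.symm
  obtain ⟨c, hc⟩ := LinearMap.injective_iff_surjective.1 hinj y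
  have := hy c
  have e : dirDeriv c h x = y := hc
  rw [e] at this
  exact inner_self_eq_zero.1 this

theorem second_eq_zero (hr : IsInvFactor h ρ) (h0 : ∀ u x, dirDeriv u ρ x = 0) (u v x : E d) :
    dirDeriv u (dirDeriv v h) x = 0 := by
  have hp := hr.pos x
  refine hr.eq_zero_of_inner (x := x) fun c => ?_
  have := hr.inner_second_eq x u v c
  simp only [h0, zero_mul, add_zero, sub_zero, neg_zero] at this
  exact (mul_eq_zero.1 this).resolve_left (by positivity)

/-- For orthogonal `u`, `v`, the formula `inner_second_eq` says that `ρ ∂_u∂_v h` cancels the mixed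
terms `∂_uρ ∂_v h + ∂_vρ ∂_u h` of the product rule. -/
theorem second_smul (hr : IsInvFactor h ρ) {u v : E d} (huv : ⟪u, v⟫_ℝ = 0) :
    dirDeriv u (dirDeriv v fun x => ρ x • h x) =
      fun x => dirDeriv u (dirDeriv v ρ) x • h x := by
  have hv := contDiff_dirDeriv v hr.smooth
  have hv' := contDiff_dirDeriv v hr.smooth'
  have h1 : ContDiff ℝ ∞ fun x => ρ x • dirDeriv v h x := hr.smooth'.smul hv
  have h2 : ContDiff ℝ ∞ fun x => dirDeriv v ρ x • h x := hv'.smul hr.smooth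
  rw [dirDeriv_smul v hr.smooth' hr.smooth, dirDeriv_add u h1 h2,
    dirDeriv_smul u hr.smooth' hv, dirDeriv_smul u hv' hr.smooth]
  funext x
  have hp := hr.pos x
  have e : ρ x • dirDeriv u (dirDeriv v h) x + dirDeriv u ρ x • dirDeriv v h x +
      dirDeriv v ρ x • dirDeriv u h x = 0 := by
    refine hr.eq_zero_of_inner (x := x) fun c => ?_
    rw [inner_add_left, inner_add_left, inner_smul_left, inner_smul_left, inner_smul_left,
      hr.inner_dirDeriv, hr.inner_dirDeriv]
    have := hr.inner_second_eq x u v c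
    rw [huv] at this
    simp only [conj_trivial]
    field_simp
    linarith
  rw [← add_assoc, e, zero_add]

/-- Dimension three leaves room for a unit vector `w` orthogonal to `u` and `v`. Computing
`∂_w∂_u∂_v (ρ h)` in two orders with `second_smul` gives `(∂_u∂_vρ) ∂_w h = (∂_w∂_vρ) ∂_u h`, and
`∂_w h` is nonzero and orthogonal to `∂_u h`. -/
theorem second_factor_eq_zero (hr : IsInvFactor h ρ) (hd : 3 ≤ d) {u v : E d}
    (huv : ⟪u, v⟫_ℝ = 0) : dirDeriv u (dirDeriv v ρ) = fun _ => 0 := by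
  obtain ⟨w, hw, ho⟩ := exists_unit_orthogonal (n := 2) hd ![u, v]
  have hwu : ⟪u, w⟫_ℝ = 0 := ho 0
  have hwv : ⟪v, w⟫_ℝ = 0 := ho 1
  have hρh : ContDiff ℝ ∞ fun x => ρ x • h x := hr.smooth'.smul hr.smooth
  have h2 := fun a b => contDiff_dirDeriv a (contDiff_dirDeriv b hr.smooth')
  have h1 := dirDeriv_comm w u (contDiff_dirDeriv v hρh)
  rw [hr.second_smul huv, hr.second_smul (u := w) (v := v) (by rw [real_inner_comm]; exact hwv),
    dirDeriv_smul w (h2 u v) hr.smooth, dirDeriv_smul u (h2 w v) hr.smooth,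
    dirDeriv_comm w u (contDiff_dirDeriv v hr.smooth')] at h1
  funext x
  have hp := hr.pos x
  have h3 := add_right_cancel (congrFun h1 x)
  have h4 := congrArg (fun y => ⟪y, dirDeriv w h x⟫_ℝ) h3
  simp only [inner_smul_left, hr.inner_dirDeriv, hwu, real_inner_self_eq_norm_sq, hw] at h4
  simp at h4
  exact h4.resolve_right hp.ne'

/-- For orthonormal `e`, `u`, the vectors `e + u` and `e - u` are orthogonal, so `∂_e∂_eρ =
∂_u∂_uρ`. Then `∂_e∂_e∂_eρ = ∂_u(∂_e∂_uρ) = 0`. -/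
theorem third_factor_eq_zero (hr : IsInvFactor h ρ) (hd : 3 ≤ d) {e : E d} (he : ‖e‖ = 1)
    (x : E d) : dirDeriv e (dirDeriv e (dirDeriv e ρ)) x = 0 := by
  obtain ⟨u, hu, ho⟩ := exists_unit_orthogonal (n := 1) (by omega : 1 < d) ![e]
  have heu : ⟪e, u⟫_ℝ = 0 := ho 0
  have h1 := hr.second_factor_eq_zero hd (u := e + u) (v := e - u) (by
    rw [inner_add_left, inner_sub_right, inner_sub_right, real_inner_comm, heu,
      real_inner_self_eq_norm_sq, real_inner_self_eq_norm_sq, he, hu]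
    rw [real_inner_comm] at heu
    simp [heu])
  have hs := fun a => contDiff_dirDeriv a hr.smooth'
  rw [dirDeriv_sub_left, dirDeriv_sub (e + u) (hs e) (hs u), dirDeriv_add_left,
    dirDeriv_add_left, dirDeriv_comm u e hr.smooth'] at h1
  have h2 : dirDeriv e (dirDeriv e ρ) = dirDeriv u (dirDeriv u ρ) := by
    funext y
    have := congrFun h1 y
    simp only [hr.second_factor_eq_zero hd heu] at this
    linarith
  rw [h2, dirDeriv_comm e u (hs u), hr.second_factor_eq_zero hd heu, dirDeriv_const]

/-- On a line `ρ` is a positive quadratic polynomial, and `h` moves with speed `1 / ρ`. A positive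
leading coefficient would make the image of a ray bounded, contrary to properness; with a
nonpositive one, positivity for all `t` leaves no linear term. -/
theorem factor_deriv_eq_zero (hr : IsInvFactor h ρ) (hd : 3 ≤ d)
    (hprop : ∀ C : ℝ, ∃ R : ℝ, ∀ x, R ≤ ‖x‖ → C < ‖h x‖) (e x : E d) (he : ‖e‖ = 1) :
    dirDeriv e ρ x = 0 := by
  have hq := eq_quadratic_of_dirDeriv hr.smooth' (hr.third_factor_eq_zero hd he) x
  generalize hb : dirDeriv e ρ x = b at hq
  generalize hc : dirDeriv e (dirDeriv e ρ) x = c at hq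
  have hpos : ∀ t : ℝ, 0 < ρ x + t * b + t ^ 2 / 2 * c := fun t => by
    rw [← hq]
    exact hr.pos _
  have hc0 : c ≤ 0 := by
    by_contra! hc0
    obtain ⟨C, hC⟩ := norm_le_of_deriv_le_inv_quadratic (hasDerivAt_line hr.smooth x e) hc0 hpos
      fun t => by
        rw [← hq]
        have hp := hr.pos (x + t • e)
        rw [← sq_le_sq₀ (norm_nonneg _) (by positivity), ← real_inner_self_eq_norm_sq,
          hr.inner_dirDeriv, real_inner_self_eq_norm_sq, he]
        simp
    obtain ⟨R, hR⟩ := hprop C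
    have h0 : 0 ≤ ‖x‖ + |R| := by positivity
    refine absurd (hC (‖x‖ + |R|) h0) (not_le.2 (hR _ ?_))
    have h1 := norm_sub_le (x + (‖x‖ + |R|) • e) x
    rw [add_sub_cancel_left, norm_smul, he, mul_one, Real.norm_of_nonneg h0] at h1
    linarith [le_abs_self R]
  have hρ := hr.pos x
  by_contra hb0
  -- At this parameter the constant and linear terms cancel.
  have h1 := hpos (-(ρ x / b))
  have h2 : -(ρ x / b) * b = -ρ x := by field_simp
  rw [h2] at h1
  nlinarith [sq_nonneg (-(ρ x / b))]

end IsInvFactor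

theorem eq_affine_of_second_eq_zero {h : E d → E d} (hs : ContDiff ℝ ∞ h)
    (h0 : ∀ u v x, dirDeriv u (dirDeriv v h) x = 0) (x : E d) : h x = fderiv ℝ h 0 x + h 0 := by
  have h1 : ∀ y, fderiv ℝ h y = fderiv ℝ h 0 := fun y => by
    ext1 v
    exact is_const_of_fderiv_eq_zero (𝕜 := ℝ) (f := dirDeriv v h)
      ((contDiff_dirDeriv v hs).differentiable (by simp))
      (fun y => ContinuousLinearMap.ext fun u => h0 u v y) y 0
  have h2 : ∀ y, HasFDerivAt (fun y => h y - fderiv ℝ h 0 y) (0 : E d →L[ℝ] E d) y := fun y => by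
    have := ((hs.differentiable (by simp) y).hasFDerivAt).sub (fderiv ℝ h 0).hasFDerivAt
    exact this.congr_fderiv (by rw [h1, sub_self])
  have := is_const_of_fderiv_eq_zero (fun y => (h2 y).differentiableAt) (fun y => (h2 y).fderiv) x 0
  simp only [map_zero, sub_zero] at this
  rw [← this]
  abel

theorem FlatConf.affine_of_three_le (hd : 3 ≤ d) {h : E d → E d} (hh : FlatConf h Set.univ)
    (hprop : ∀ C : ℝ, ∃ R : ℝ, ∀ x, R ≤ ‖x‖ → C < ‖h x‖) (x : E d) :
    h x = fderiv ℝ h 0 x + h 0 := by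
  obtain ⟨ρ, hr⟩ := hh.exists_isInvFactor (by omega)
  refine eq_affine_of_second_eq_zero hr.smooth (hr.second_eq_zero fun u y => ?_) x
  rcases eq_or_ne u 0 with rfl | hu
  · exact map_zero _
  have h1 := hr.factor_deriv_eq_zero hd hprop ((‖u‖⁻¹ : ℝ) • u) y (norm_smul_inv_norm hu)
  have h2 : (‖u‖⁻¹ : ℝ) • dirDeriv u ρ y = 0 := (map_smul (fderiv ℝ ρ y) (‖u‖⁻¹ : ℝ) u).symm.trans h1
  exact (smul_eq_zero.1 h2).resolve_left (inv_ne_zero (norm_ne_zero_iff.2 hu))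

end

/-! ### Conformal maps of the plane, and automorphisms of the sphere fixing infinity -/

section

/-! ## Liouville's theorem in dimension two -/

theorem det_fin_two_euclidean (L : E 2 →L[ℝ] E 2) :
    L.det = L (EuclideanSpace.single 0 1) 0 * L (EuclideanSpace.single 1 1) 1 -
      L (EuclideanSpace.single 1 1) 0 * L (EuclideanSpace.single 0 1) 1 := by
  rw [ContinuousLinearMap.det,
    ← LinearMap.det_toMatrix (EuclideanSpace.basisFun (Fin 2) ℝ).toBasis, Matrix.det_fin_two]
  simp [LinearMap.toMatrix_apply]

theorem cauchyRiemann_of_conformal {L : E 2 →L[ℝ] E 2} (hL : IsConformalMap L) (hdet : 0 < L.det) :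
    L (EuclideanSpace.single 1 1) 0 = -L (EuclideanSpace.single 0 1) 1 ∧
      L (EuclideanSpace.single 1 1) 1 = L (EuclideanSpace.single 0 1) 0 := by
  obtain ⟨c, hc, h⟩ := (isConformalMap_iff L).1 hL
  rw [det_fin_two_euclidean] at hdet
  have h1 := h (EuclideanSpace.single 0 1) (EuclideanSpace.single 0 1)
  have h2 := h (EuclideanSpace.single 1 1) (EuclideanSpace.single 1 1)
  have h3 := h (EuclideanSpace.single 0 1) (EuclideanSpace.single 1 1)
  simp only [PiLp.inner_apply, Fin.sum_univ_two] at h1 h2 h3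
  simp at h1 h2 h3
  generalize L (EuclideanSpace.single 0 1) 0 = p at *
  generalize L (EuclideanSpace.single 0 1) 1 = q at *
  generalize L (EuclideanSpace.single 1 1) 0 = r at *
  generalize L (EuclideanSpace.single 1 1) 1 = s at *
  -- Lagrange's identity gives `det ^ 2 = c ^ 2` for orthogonal columns of squared length `c`.
  -- Positivity selects `det = c`, and then `(r + q) ^ 2 + (s - p) ^ 2 = 2 * c - 2 * det = 0`.
  have h4 : (p * s - r * q - c) * (p * s - r * q + c) = 0 := by
    have : c * c = (p ^ 2 + q ^ 2) * (r ^ 2 + s ^ 2) := by rw [h1, h2]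
    linear_combination (p * r + q * s) * h3 * (-1) - this
  have h5 : p * s - r * q = c := by
    rcases mul_eq_zero.1 h4 with h | h <;> linarith
  have h6 : (r + q) ^ 2 + (s - p) ^ 2 = 0 := by linear_combination h1 + h2 - 2 * h5
  constructor
  · nlinarith [sq_nonneg (r + q), sq_nonneg (s - p)]
  · nlinarith [sq_nonneg (r + q), sq_nonneg (s - p)]

/-- Cauchy's estimate on the circle of radius `1 + ‖w‖` about `w` bounds the derivative uniformly,
and Liouville's theorem makes it constant. -/
theorem entire_affine_of_linear_growth {H : ℂ → ℂ} (hH : Differentiable ℂ H) {C : ℝ}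
    (hC : ∀ z, ‖H z‖ ≤ C * (1 + ‖z‖)) (z : ℂ) : H z = deriv H 0 * z + H 0 := by
  have hC0 : 0 ≤ C := by
    have := (norm_nonneg _).trans (hC 0)
    simpa using this
  have hb : ∀ w, ‖deriv H w‖ ≤ 2 * C := fun w => by
    have hR : 0 < 1 + ‖w‖ := by positivity
    refine (Complex.norm_deriv_le_of_forall_mem_sphere_norm_le hR hH.diffContOnCl
      (C := C * (2 * (1 + ‖w‖))) fun y hy => (hC y).trans ?_).trans (le_of_eq ?_)
    · have h1 : ‖y‖ ≤ ‖y - w‖ + ‖w‖ := by simpa using norm_add_le (y - w) w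
      rw [mem_sphere_iff_norm.1 hy] at h1
      gcongr
      linarith
    · field_simp
  have hconst : ∀ w, deriv H w = deriv H 0 := fun w =>
    (Differentiable.deriv hH).apply_eq_apply_of_bounded
      ((isBounded_iff_forall_norm_le).2 ⟨2 * C, by rintro _ ⟨w, rfl⟩; exact hb w⟩) w 0
  have h1 : ∀ w, HasDerivAt (fun w => H w - deriv H 0 * w) 0 w := fun w => by
    have := (hH w).hasDerivAt.sub ((hasDerivAt_id w).const_mul (deriv H 0))
    exact this.congr_deriv (by rw [hconst, mul_one, sub_self])
  have := is_const_of_deriv_eq_zero (fun w => (h1 w).differentiableAt) (fun w => (h1 w).deriv) z 0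
  simp only [mul_zero, sub_zero] at this
  rw [← this]
  ring

theorem FlatConf.affine_of_two {h : E 2 → E 2} (hh : FlatConf h Set.univ) {C : ℝ}
    (hC : ∀ x, ‖h x‖ ≤ C * (1 + ‖x‖)) : ∃ L : E 2 →L[ℝ] E 2, ∀ x, h x = L x + h 0 := by
  let J : ℂ ≃ₗᵢ[ℝ] E 2 := Complex.orthonormalBasisOneI.repr
  have hs : ContDiff ℝ ∞ h := contDiffOn_univ.1 hh.smooth
  have hJ : ∀ x, J.symm x = x 0 + x 1 * Complex.I := Complex.orthonormalBasisOneI_repr_symm_apply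
  have hJ1 : J 1 = EuclideanSpace.single 0 1 := by
    rw [eq_comm, ← J.symm_apply_eq, hJ]
    simp
  have hJI : J Complex.I = EuclideanSpace.single 1 1 := by
    rw [eq_comm, ← J.symm_apply_eq, hJ]
    simp
  have hd : Differentiable ℂ fun z => J.symm (h (J z)) := fun z => by
    have h1 : HasFDerivAt (fun z => J.symm (h (J z)))
        ((J.symm.toContinuousLinearEquiv : E 2 →L[ℝ] ℂ).comp ((fderiv ℝ h (J z)).comp
          (J.toContinuousLinearEquiv : ℂ →L[ℝ] E 2))) z :=
      (J.symm.toContinuousLinearEquiv : E 2 →L[ℝ] ℂ).hasFDerivAt.comp z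
        ((hs.differentiable (by simp) (J z)).hasFDerivAt.comp z
          (J.toContinuousLinearEquiv : ℂ →L[ℝ] E 2).hasFDerivAt)
    refine (differentiableAt_iff_restrictScalars ℝ h1.differentiableAt).2
      ⟨ContinuousLinearMap.complexOfReal ((J.symm.toContinuousLinearEquiv : E 2 →L[ℝ] ℂ).comp
        ((fderiv ℝ h (J z)).comp (J.toContinuousLinearEquiv : ℂ →L[ℝ] E 2))) ?_, ?_⟩
    · obtain ⟨e1, e2⟩ := cauchyRiemann_of_conformal
        (conformalAt_iff_isConformalMap_fderiv.1 (hh.conformal (J z) trivial))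
        (hh.oriented (J z) trivial)
      change J.symm (fderiv ℝ h (J z) (J Complex.I)) =
        Complex.I • J.symm (fderiv ℝ h (J z) (J 1))
      rw [hJ1, hJI, hJ, hJ, e1, e2, smul_eq_mul]
      push_cast
      linear_combination -(fderiv ℝ h (J z) (EuclideanSpace.single 0 1) 1 : ℂ) * Complex.I_mul_I
    · rw [h1.fderiv]
      rfl
  have ha := entire_affine_of_linear_growth hd (C := C) fun z => by
    rw [J.symm.norm_map, ← J.norm_map z]
    exact hC _
  obtain ⟨a, ha'⟩ : ∃ a, a = deriv (fun z => J.symm (h (J z))) 0 := ⟨_, rfl⟩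
  rw [← ha'] at ha
  refine ⟨(J.toContinuousLinearEquiv : ℂ →L[ℝ] E 2).comp
    (((ContinuousLinearMap.mul ℝ ℂ) a).comp (J.symm.toContinuousLinearEquiv : E 2 →L[ℝ] ℂ)),
    fun x => ?_⟩
  have h1 := congrArg J (ha (J.symm x))
  rw [J.apply_symm_apply, J.apply_symm_apply, map_add, J.apply_symm_apply, map_zero] at h1
  exact h1

/-! ## Conformal maps of Euclidean space are similarities -/

variable {d : ℕ}

theorem FlatConf.exists_similarity_of_affine {h : E d → E d} (hh : FlatConf h Set.univ)
    {L : E d →L[ℝ] E d} (hL : ∀ x, h x = L x + h 0) :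
    ∃ μ : ℝ, 0 < μ ∧ ∃ O : E d ≃ₗᵢ[ℝ] E d,
      LinearMap.det (O.toLinearEquiv : E d →ₗ[ℝ] E d) = 1 ∧ ∀ x, h x = μ • O x + h 0 := by
  have e : fderiv ℝ h 0 = L := by
    have h1 : HasFDerivAt h L 0 := by
      have h2 := (L.hasFDerivAt (x := (0 : E d))).add_const (h 0)
      rwa [← funext hL] at h2
    exact h1.fderiv
  obtain ⟨c, hc, h1⟩ := conformalAt_iff'.1 (hh.conformal 0 trivial)
  have hdet := hh.oriented 0 trivial
  rw [e] at h1 hdet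
  obtain ⟨μ, hμ, rfl⟩ : ∃ μ : ℝ, 0 < μ ∧ c = μ ^ 2 :=
    ⟨√c, Real.sqrt_pos.2 hc, (Real.sq_sqrt hc.le).symm⟩
  let l : E d →ₗᵢ[ℝ] E d := LinearMap.isometryOfInner (μ⁻¹ • (L : E d →ₗ[ℝ] E d)) fun x y => by
    have := h1 x y
    simp only [LinearMap.smul_apply, inner_smul_left, inner_smul_right, conj_trivial,
      ContinuousLinearMap.coe_coe, this]
    field_simp
  have hl : ∀ x, l x = μ⁻¹ • L x := fun x => rfl
  refine ⟨μ, hμ, l.toLinearIsometryEquiv rfl, ?_, fun x => ?_⟩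
  -- An isometry has determinant of absolute value one; the sign comes from the orientation of `h`.
  · have h2 := LinearIsometry.normDet_eq_one l
    rw [LinearMap.normDet_eq_abs_det] at h2
    have h3 : LinearMap.det l.toLinearMap = μ⁻¹ ^ d * L.det := by
      change LinearMap.det (μ⁻¹ • (L : E d →ₗ[ℝ] E d)) = _
      rw [LinearMap.det_smul, finrank_euclideanSpace_fin]
    rw [abs_of_pos (by rw [h3]; positivity)] at h2
    exact h2
  · rw [LinearIsometry.coe_toLinearIsometryEquiv, hl, smul_inv_smul₀ hμ.ne', ← hL]

theorem FlatConf.exists_similarity (hd : 2 ≤ d) {h : E d → E d} (hh : FlatConf h Set.univ)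
    (hprop : ∀ C : ℝ, ∃ R : ℝ, ∀ x, R ≤ ‖x‖ → C < ‖h x‖) {C : ℝ}
    (hC : ∀ x, ‖h x‖ ≤ C * (1 + ‖x‖)) :
    ∃ μ : ℝ, 0 < μ ∧ ∃ O : E d ≃ₗᵢ[ℝ] E d,
      LinearMap.det (O.toLinearEquiv : E d →ₗ[ℝ] E d) = 1 ∧ ∀ x, h x = μ • O x + h 0 := by
  obtain ⟨L, hL⟩ : ∃ L : E d →L[ℝ] E d, ∀ x, h x = L x + h 0 := by
    rcases hd.eq_or_lt with rfl | hd
    · exact hh.affine_of_two hC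
    · exact ⟨_, hh.affine_of_three_le hd hprop⟩
  exact hh.exists_similarity_of_affine hL

/-! ## Automorphisms of the sphere that fix a point -/

theorem normSq_sub_infty (p : Sph d) :
    ‖(p : E (d + 1)) - infty d‖ ^ 2 = 2 * (1 + (p : E (d + 1)) 0) := by
  have h : ⟪(p : E (d + 1)), (infty d : E (d + 1))⟫_ℝ = -(p : E (d + 1)) 0 := by
    rw [PiLp.inner_apply, Fin.sum_univ_succ]
    simp [infty_zero, infty_succ]
  rw [norm_sub_sq_real, sph_norm_eq, sph_norm_eq, h]
  ring

theorem normSq_stereo_sub_infty (x : E d) :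
    ‖((stereo d x : Sph d) : E (d + 1)) - infty d‖ ^ 2 = 4 / (1 + ‖x‖ ^ 2) := by
  rw [normSq_sub_infty]
  change 2 * (1 + stereoFun x 0) = _
  rw [one_add_stereoFun_zero]
  ring

/-- A smooth map of the sphere that fixes the point at infinity is Lipschitz at that point. -/
theorem exists_lipschitz_infty {φ : Sph d → Sph d} (hφ : ContMDiff (𝓡 d) (𝓡 d) ∞ φ)
    (h : φ (infty d) = infty d) : ∃ C : ℝ, 0 ≤ C ∧ ∀ p : Sph d,
      ‖(φ p : E (d + 1)) - infty d‖ ≤ C * ‖(p : E (d + 1)) - infty d‖ := by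
  have := Fact.mk (@finrank_euclideanSpace_fin ℝ _ (d + 1))
  -- The antipode of `stereo` parametrizes a neighbourhood of infinity and sends the origin to it.
  -- Differentiability there gives the estimate near infinity; farther away the diameter `2` of the
  -- sphere is enough.
  let F : E d → E (d + 1) := fun y => (φ (-stereo d y) : E (d + 1))
  have h0 : -stereo d 0 = infty d := by
    rw [eq_infty_iff]
    change -(stereoFun (0 : E d) 0) = -1
    rw [stereoFun_zero]
    simp
  have hF : DifferentiableAt ℝ F 0 := by
    have h1 : ContMDiff 𝓘(ℝ, E d) 𝓘(ℝ, E (d + 1)) ∞ F :=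
      (contMDiff_coe_sphere (n := d)).comp (hφ.comp ((contMDiff_neg_sphere (n := d)).comp
        (contMDiffOn_univ.1 (stereo_sphConf d).smooth)))
    exact h1.contDiff.differentiable (by simp) 0
  have hF0 : F 0 = infty d := by
    simp only [F]
    rw [h0, h]
  obtain ⟨C, hC⟩ := hF.hasFDerivAt.isBigO_sub.bound
  obtain ⟨ε, hε, hεC⟩ := Metric.eventually_nhds_iff.1 hC
  have hC0 : ∀ y : E d, ‖y‖ < ε → ‖F y - infty d‖ ≤ |C| * ‖y‖ := fun y hy => by
    have := hεC (y := y) (by simpa using hy)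
    rw [hF0, sub_zero] at this
    exact this.trans (by gcongr; exact le_abs_self C)
  refine ⟨|C| + 2 / min ε 1, by positivity, fun p => ?_⟩
  have hn := norm_nonneg ((p : E (d + 1)) - infty d)
  by_cases hp : ‖(p : E (d + 1)) - infty d‖ < min ε 1
  · have h1 := normSq_sub_infty p
    have h2 : ‖(p : E (d + 1)) - infty d‖ ^ 2 < 1 := by
      have := hp.trans_le (min_le_right _ _)
      nlinarith
    have h3 : (p : E (d + 1)) 0 < 0 := by linarith
    have hne : ((-p : Sph d) : E (d + 1)) 0 ≠ -1 := by
      change -(p : E (d + 1)) 0 ≠ -1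
      linarith
    have h4 := normSq_stereoInv hne
    have h5 : -stereo d (stereoInv ((-p : Sph d) : E (d + 1))) = p := by
      rw [stereo_stereoInv hne, neg_neg]
    have h6 : ‖stereoInv ((-p : Sph d) : E (d + 1))‖ ≤ ‖(p : E (d + 1)) - infty d‖ := by
      refine (sq_le_sq₀ (norm_nonneg _) hn).1 ?_
      rw [h4, h1]
      change (1 - -(p : E (d + 1)) 0) / (1 + -(p : E (d + 1)) 0) ≤ _
      have h7 : 0 ≤ 1 + (p : E (d + 1)) 0 := by nlinarith [sq_nonneg ‖(p : E (d + 1)) - infty d‖]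
      rw [div_le_iff₀ (by linarith)]
      nlinarith
    have h7 := hC0 _ (h6.trans_lt (hp.trans_le (min_le_left _ _)))
    simp only [F] at h7
    rw [h5] at h7
    refine h7.trans (mul_le_mul ?_ h6 (norm_nonneg _) (by positivity))
    have : 0 < 2 / min ε 1 := by positivity
    linarith
  · have hm : 0 < min ε 1 := lt_min hε one_pos
    have h1 : ‖(φ p : E (d + 1)) - infty d‖ ≤ 2 := by
      refine (norm_sub_le _ _).trans ?_
      rw [sph_norm_eq, sph_norm_eq]
      norm_num
    refine h1.trans ?_
    have h2 : 2 / min ε 1 * min ε 1 = 2 := by field_simp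
    have h3 : 2 / min ε 1 * min ε 1 ≤ 2 / min ε 1 * ‖(p : E (d + 1)) - infty d‖ := by
      gcongr
      exact not_lt.1 hp
    nlinarith [abs_nonneg C]

/-- The chordal distance from `stereo d x` to infinity is `2 / √(1 + ‖x‖ ^ 2)`. The Lipschitz
estimate for the automorphism therefore makes the coordinate map proper, and the one for its inverse
makes it grow at most linearly, as both versions of Liouville's theorem require. -/
theorem SphAut.exists_similarity (hd : 2 ≤ d) (α : SphAut d)
    (hα : α.toDiffeo (infty d) = infty d) :
    ∃ μ : ℝ, 0 < μ ∧ ∃ O : E d ≃ₗᵢ[ℝ] E d,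
      LinearMap.det (O.toLinearEquiv : E d →ₗ[ℝ] E d) = 1 ∧ ∃ w : E d,
        ∀ x, α.toDiffeo (stereo d x) = stereo d (μ • O x + w) := by
  have hne : ∀ x, α.toDiffeo (stereo d x) ≠ infty d := fun x e =>
    stereo_ne_infty x (α.toDiffeo.injective (e.trans hα.symm))
  have hh := (α.sphConf (stereo_sphConf d)).flatConf fun x _ => hne x
  obtain ⟨h, hhd⟩ : ∃ h : E d → E d, h = fun x =>
    stereoInv ((α.toDiffeo ∘ stereo d) x : E (d + 1)) := ⟨_, rfl⟩
  rw [← hhd] at hh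
  have hst : ∀ x, α.toDiffeo (stereo d x) = stereo d (h x) := fun x => by
    rw [hhd]
    exact (stereo_stereoInv fun e => hne x (eq_infty_iff.2 e)).symm
  obtain ⟨C, hC, hL⟩ := exists_lipschitz_infty α.toDiffeo.contMDiff hα
  obtain ⟨C', hC', hL'⟩ := exists_lipschitz_infty α.toDiffeo.symm.contMDiff (by
    conv_lhs => rw [← hα]
    exact α.toDiffeo.symm_apply_apply _)
  have key : ∀ {C : ℝ}, 0 ≤ C → ∀ x y : E d, ‖((stereo d x : Sph d) : E (d + 1)) - infty d‖ ≤
      C * ‖((stereo d y : Sph d) : E (d + 1)) - infty d‖ → 1 + ‖y‖ ^ 2 ≤ C ^ 2 * (1 + ‖x‖ ^ 2) := by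
    intro C hC x y h
    have h1 := pow_le_pow_left₀ (norm_nonneg _) h 2
    have hx := one_add_normSq_pos x
    have hy := one_add_normSq_pos y
    rw [mul_pow, normSq_stereo_sub_infty, normSq_stereo_sub_infty, ← mul_div_assoc,
      div_le_div_iff₀ hx hy] at h1
    linarith
  have h1 : ∀ x, 1 + ‖x‖ ^ 2 ≤ C ^ 2 * (1 + ‖h x‖ ^ 2) := fun x =>
    key hC _ _ (by rw [← hst]; exact hL _)
  have h2 : ∀ x, 1 + ‖h x‖ ^ 2 ≤ C' ^ 2 * (1 + ‖x‖ ^ 2) := fun x =>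
    key hC' _ _ (by
      have := hL' (α.toDiffeo (stereo d x))
      rwa [α.toDiffeo.symm_apply_apply, hst] at this)
  have hprop : ∀ B : ℝ, ∃ R : ℝ, ∀ x, R ≤ ‖x‖ → B < ‖h x‖ := fun B => by
    refine ⟨C * (1 + |B|), fun x hx => ?_⟩
    by_contra! hB
    have h3 := h1 x
    have h4 : ‖h x‖ ^ 2 ≤ |B| ^ 2 :=
      pow_le_pow_left₀ (norm_nonneg _) (hB.trans (le_abs_self B)) 2
    have h5 : (C * (1 + |B|)) ^ 2 ≤ ‖x‖ ^ 2 := pow_le_pow_left₀ (by positivity) hx 2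
    have h6 : C ^ 2 * (1 + ‖h x‖ ^ 2) ≤ C ^ 2 * (1 + |B|) ^ 2 := by
      gcongr
      nlinarith [abs_nonneg B]
    nlinarith
  obtain ⟨μ, hμ, O, hO, hw⟩ := hh.exists_similarity hd hprop (C := C') fun x => by
    refine (sq_le_sq₀ (norm_nonneg _) (by positivity)).1 ?_
    have h3 : C' ^ 2 * (1 + ‖x‖ ^ 2) ≤ (C' * (1 + ‖x‖)) ^ 2 := by
      rw [mul_pow]
      gcongr
      nlinarith [norm_nonneg x]
    linarith [h2 x]
  exact ⟨μ, hμ, O, hO, h 0, fun x => by rw [hst, hw]⟩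

end

/-! ### Connected complements, normalization at an uncovered point, and full conformal invariance -/

section

/-! ## Complements of disks are connected -/

/-- In a separation of `S \ K` the connected shell `O \ K` lies on one side. Adding all of `O` to
that side would separate `S`. -/
theorem IsPreconnected.diff_of_shell {X : Type*} [TopologicalSpace X] {S K O : Set X}
    (hS : IsPreconnected S) (hK : IsClosed K) (hO : IsOpen O) (hKO : K ⊆ O) (hOS : O ⊆ S)
    (hA : IsPreconnected (O \ K)) : IsPreconnected (S \ K) := by
  -- one of the two open sets contains the shell
  have key : ∀ u v : Set X, IsOpen u → IsOpen v → S \ K ⊆ u ∪ v → ((S \ K) ∩ u).Nonempty →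
      ((S \ K) ∩ v).Nonempty → O \ K ⊆ u → ((S \ K) ∩ (u ∩ v)).Nonempty := by
    intro u v hu hv huv hnu hnv hOu
    have h1 : S ⊆ (u \ K ∪ O) ∪ v \ K := fun x hx => by
      by_cases hxK : x ∈ K
      · exact .inl (.inr (hKO hxK))
      · rcases huv ⟨hx, hxK⟩ with h | h
        · exact .inl (.inl ⟨h, hxK⟩)
        · exact .inr ⟨h, hxK⟩
    obtain ⟨x, hx, hxu, hxv⟩ := hS (u \ K ∪ O) (v \ K) ((hu.sdiff hK).union hO) (hv.sdiff hK) h1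
      (hnu.mono fun x hx => ⟨hx.1.1, .inl ⟨hx.2, hx.1.2⟩⟩)
      (hnv.mono fun x hx => ⟨hx.1.1, hx.2, hx.1.2⟩)
    refine ⟨x, ⟨hx, hxv.2⟩, ?_, hxv.1⟩
    rcases hxu with h | h
    · exact h.1
    · exact hOu ⟨h, hxv.2⟩
  intro u v hu hv huv hnu hnv
  by_contra hne
  rw [Set.not_nonempty_iff_eq_empty] at hne
  have hsub : O \ K ⊆ S \ K := Set.sdiff_subset_sdiff_left hOS
  rcases isPreconnected_iff_subset_of_disjoint.1 hA u v hu hv (hsub.trans huv)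
    (Set.subset_empty_iff.1 ((Set.inter_subset_inter_left _ hsub).trans hne.subset)) with h | h
  · exact (key u v hu hv huv hnu hnv h).ne_empty hne
  · rw [Set.inter_comm u v] at hne
    rw [Set.union_comm] at huv
    exact (key v u hv hu huv hnv hnu h).ne_empty hne

variable {d : ℕ}

theorem isPreconnected_annulus (hd : 2 ≤ d) (a b : ℝ) (ha : 0 ≤ a) :
    IsPreconnected {x : E d | a < ‖x‖ ∧ ‖x‖ < b} := by
  have hr : 1 < Module.rank ℝ (E d) := by
    rw [← Module.finrank_eq_rank, finrank_euclideanSpace_fin]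
    exact_mod_cast hd
  have h : {x : E d | a < ‖x‖ ∧ ‖x‖ < b} =
      (fun p : ℝ × E d => p.1 • p.2) '' (Set.Ioo a b ×ˢ Metric.sphere 0 1) := by
    ext x
    constructor
    · rintro ⟨h1, h2⟩
      have hx : 0 < ‖x‖ := ha.trans_lt h1
      refine ⟨(‖x‖, (‖x‖⁻¹ : ℝ) • x), ⟨⟨h1, h2⟩, ?_⟩, smul_inv_smul₀ hx.ne' x⟩
      rw [mem_sphere_zero_iff_norm]
      exact norm_smul_inv_norm (norm_pos_iff.1 hx)
    · rintro ⟨⟨t, y⟩, ⟨⟨h1, h2⟩, hy⟩, rfl⟩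
      rw [mem_sphere_zero_iff_norm] at hy
      change a < ‖t • y‖ ∧ ‖t • y‖ < b
      rw [norm_smul, hy, mul_one, Real.norm_of_nonneg (ha.trans h1.le)]
      exact ⟨h1, h2⟩
  rw [h]
  exact (isPreconnected_Ioo.prod (isPreconnected_sphere hr 0 1)).image _
    (continuous_fst.smul continuous_snd).continuousOn

/-- A conformal differential is injective, hence surjective between spaces of equal dimension, so
the map is open near each point. -/
theorem FlatConf.isOpen_image {f : E d → E d} {V W : Set (E d)} (hf : FlatConf f V)
    (hW : IsOpen W) (hWV : W ⊆ V) : IsOpen (f '' W) := by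
  rw [isOpen_iff_mem_nhds]
  rintro _ ⟨x, hx, rfl⟩
  have hs : HasStrictFDerivAt f (fderiv ℝ f x) x :=
    (hf.smooth.contDiffAt (hf.isOpen.mem_nhds (hWV hx))).hasStrictFDerivAt (by simp)
  have hsurj : (fderiv ℝ f x).range = ⊤ := by
    obtain ⟨c, hc, h⟩ := conformalAt_iff'.1 (hf.conformal x (hWV hx))
    have hinj : Function.Injective (fderiv ℝ f x : E d →ₗ[ℝ] E d) := by
      rw [← LinearMap.ker_eq_bot, LinearMap.ker_eq_bot']
      intro u hu
      have h1 := h u u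
      have hu' : fderiv ℝ f x u = 0 := hu
      rw [hu', inner_zero_left] at h1
      exact inner_self_eq_zero.1 ((mul_eq_zero.1 h1.symm).resolve_left hc.ne')
    exact LinearMap.range_eq_top.2 (LinearMap.injective_iff_surjective.1 hinj)
  rw [← hs.map_nhds_eq_of_surj hsurj]
  exact Filter.image_mem_map (hW.mem_nhds hx)

/-- The complement of the disks of a configuration in the disk is connected in the sphere. -/
theorem isPreconnected_compl_disks (hd : 2 ≤ d) {n : ℕ} {F : Fin n → E d → E d}
    {V : Fin n → Set (E d)} (h : IsRep (FlatConf (d := d)) (cDisk d) F V) (s : Finset (Fin n)) :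
    IsPreconnected (⋃ i ∈ s, stereo d '' (F i '' cDisk d))ᶜ := by
  have hcomp : ∀ i, IsCompact (stereo d '' (F i '' cDisk d)) := fun i =>
    ((isCompact_closedBall 0 1).image_of_continuousOn
      ((h.conf i).smooth.continuousOn.mono (h.subset i))).image (stereo_continuous d)
  classical
  induction s using Finset.induction_on with
  | empty =>
    have hr : 1 < Module.rank ℝ (E (d + 1)) := by
      rw [← Module.finrank_eq_rank, finrank_euclideanSpace_fin]
      exact_mod_cast (by omega : 1 < d + 1)
    simp only [Finset.notMem_empty, Set.iUnion_of_empty, Set.iUnion_empty, Set.compl_empty]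
    have := isPreconnected_sphere hr (0 : E (d + 1)) 1
    exact (isPreconnected_iff_preconnectedSpace.1 this).isPreconnected_univ
  | insert i s his ih =>
    have e : (⋃ j ∈ insert i s, stereo d '' (F j '' cDisk d))ᶜ =
        (⋃ j ∈ s, stereo d '' (F j '' cDisk d))ᶜ \ (stereo d '' (F i '' cDisk d)) := by
      rw [Finset.set_biUnion_insert, Set.compl_union, Set.inter_comm, Set.sdiff_eq]
    rw [e]
    -- A collar of the disk inside its domain provides the shell: it is the homeomorphic image of an
    -- annulus, and it avoids the disks removed earlier.
    obtain ⟨ε, hε, hεV⟩ := (isCompact_closedBall (0 : E d) 1).exists_thickening_subset_open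
      (h.conf i).isOpen (h.subset i)
    have hball : Metric.ball (0 : E d) (1 + ε) ⊆ V i := by
      refine subset_trans ?_ hεV
      rw [thickening_closedBall hε zero_le_one, add_comm]
    have hKO : cDisk d ⊆ Metric.ball (0 : E d) (1 + ε) := Metric.closedBall_subset_ball (by linarith)
    refine IsPreconnected.diff_of_shell ih (hcomp i).isClosed
      (isOpen_image_stereo ((h.conf i).isOpen_image Metric.isOpen_ball hball))
      (Set.image_mono (Set.image_mono hKO)) ?_ ?_
    · rw [Set.subset_compl_iff_disjoint_right, Set.disjoint_iUnion₂_right]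
      intro j hj
      have hij : i ≠ j := fun e => his (e ▸ hj)
      exact (Set.disjoint_image_iff (stereo_injective d)).2
        ((h.disjoint i j hij).mono (Set.image_mono hball) (Set.image_mono (h.subset j)))
    · rw [← Set.image_sdiff (stereo_injective d), ← Set.InjOn.image_sdiff_subset
        ((h.injOn i).mono hball) hKO]
      refine IsPreconnected.image (IsPreconnected.image ?_ _ ?_) _ (stereo_continuous d).continuousOn
      · convert isPreconnected_annulus hd 1 (1 + ε) zero_le_one using 1
        ext x
        simp [and_comm]
      · exact (h.conf i).smooth.continuousOn.mono (Set.sdiff_subset.trans hball)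

/-! ## Normalizing configurations in the sphere -/

/-- An automorphism of the sphere whose inverse is given as an automorphism. -/
def SphAut.IsInvertible (φ : SphAut d) : Prop :=
  ∃ ψ : SphAut d, ∀ p, ψ.toDiffeo (φ.toDiffeo p) = p

theorem SphAut.act_eq_of_leftInverse {φ ψ : SphAut d} (h : ∀ p, ψ.toDiffeo (φ.toDiffeo p) = p)
    {n : ℕ} (f : SConf d n) : ψ.act (φ.act f) = f := by
  rw [← SphAut.comp_act]
  refine Subtype.ext (funext fun i => ?_)
  change (f.1 i).map (ψ.toDiffeo ∘ φ.toDiffeo) = f.1 i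
  have : ψ.toDiffeo ∘ φ.toDiffeo = id := funext h
  rw [this, Filter.Germ.map_id, id]

theorem SphAut.isInvertible_boost (b : E (d + 1)) (hb : ‖b‖ < 1) :
    (SphAut.boost b hb).IsInvertible :=
  ⟨SphAut.boost (-b) ((norm_neg b).trans_lt hb), fun p =>
    Subtype.ext (boostFun_neg_boostFun hb (sph_norm_eq p))⟩

theorem SphAut.IsInvertible.comp {φ ψ : SphAut d} (hφ : φ.IsInvertible) (hψ : ψ.IsInvertible) :
    (φ.comp ψ).IsInvertible := by
  obtain ⟨φ', h⟩ := hφ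
  obtain ⟨ψ', h'⟩ := hψ
  exact ⟨ψ'.comp φ', fun p => by rw [comp_apply, comp_apply, h, h']⟩

theorem SphAut.exists_apply_eq_of_ne_neg {p q : Sph d} (h : q ≠ -p) :
    ∃ φ : SphAut d, φ.IsInvertible ∧ φ.toDiffeo p = q := by
  obtain ⟨c, hc⟩ : ∃ c, c = ⟪(p : E (d + 1)), (q : E (d + 1))⟫_ℝ := ⟨_, rfl⟩
  have hc1 : -1 < c := by
    have h1 : 0 < ‖(p : E (d + 1)) + q‖ ^ 2 := by
      refine pow_pos (norm_pos_iff.2 fun e => h (Subtype.ext ?_)) 2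
      exact eq_neg_of_add_eq_zero_right e
    rw [norm_add_sq_real, sph_norm_eq, sph_norm_eq, ← hc] at h1
    linarith
  -- Then `p + b` is the midpoint of `p` and `q`, and `1 - ‖b‖ ^ 2 = ‖p + b‖ ^ 2`, so the boost
  -- sends `p` to `b + (p + q) / 2 = q`. The condition `‖b‖ < 1` is exactly that `p` and `q` are not
  -- antipodal.
  let b : E (d + 1) := (1 / 2 : ℝ) • ((q : E (d + 1)) - p)
  have hbn : ‖b‖ ^ 2 = (1 - c) / 2 := by
    rw [norm_smul, mul_pow, norm_sub_sq_real, sph_norm_eq, sph_norm_eq, real_inner_comm, ← hc,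
      Real.norm_of_nonneg (by norm_num)]
    ring
  have hb : ‖b‖ < 1 := by nlinarith [norm_nonneg b]
  have hpb : (p : E (d + 1)) + b = (1 / 2 : ℝ) • ((p : E (d + 1)) + q) := by
    simp only [b]
    module
  have hn : ‖(p : E (d + 1)) + b‖ ^ 2 = (1 + c) / 2 := by
    rw [hpb, norm_smul, mul_pow, norm_add_sq_real, sph_norm_eq, sph_norm_eq, ← hc,
      Real.norm_of_nonneg (by norm_num)]
    ring
  refine ⟨SphAut.boost b hb, SphAut.isInvertible_boost b hb, Subtype.ext ?_⟩
  rw [SphAut.boost_apply, boostFun, hn, hbn, hpb]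
  have h2 : (1 - (1 - c) / 2) / ((1 + c) / 2) = 1 := by
    have : 1 + c ≠ 0 := by linarith
    field_simp
    ring
  rw [h2, one_smul]
  simp only [b]
  module

theorem SphAut.exists_apply_eq (hd : 1 ≤ d) (p q : Sph d) :
    ∃ φ : SphAut d, φ.IsInvertible ∧ φ.toDiffeo p = q := by
  by_cases h : q = -p
  -- Antipodal points are joined through an intermediate point orthogonal to both.
  · obtain ⟨w, hw, ho⟩ := exists_unit_orthogonal (d := d + 1) (n := 1) (by omega) ![(p : E (d + 1))]
    have ho : ⟪(p : E (d + 1)), w⟫_ℝ = 0 := ho 0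
    let r : Sph d := ⟨w, mem_sphere_zero_iff_norm.2 hw⟩
    have hpp : ⟪(p : E (d + 1)), (p : E (d + 1))⟫_ℝ = 1 := by
      rw [real_inner_self_eq_norm_sq, sph_norm_eq, one_pow]
    have h1 : r ≠ -p := fun e => by
      have e' : w = -(p : E (d + 1)) := congrArg Subtype.val e
      rw [e', inner_neg_right, hpp] at ho
      norm_num at ho
    have h2 : q ≠ -r := fun e => by
      rw [h] at e
      have e' : (p : E (d + 1)) = w := congrArg Subtype.val (neg_injective e)
      rw [← e', hpp] at ho
      norm_num at ho
    obtain ⟨φ, hφ, h3⟩ := SphAut.exists_apply_eq_of_ne_neg h1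
    obtain ⟨ψ, hψ, h4⟩ := SphAut.exists_apply_eq_of_ne_neg h2
    exact ⟨ψ.comp φ, hψ.comp hφ, by rw [comp_apply, h3, h4]⟩
  · exact SphAut.exists_apply_eq_of_ne_neg h

theorem boostFun_single_zero (s : ℝ) (p : Sph d) :
    boostFun (EuclideanSpace.single 0 s : E (d + 1)) (p : E (d + 1)) 0 =
      s + (1 - s ^ 2) / (1 + 2 * s * (p : E (d + 1)) 0 + s ^ 2) * ((p : E (d + 1)) 0 + s) := by
  have h1 : ‖(EuclideanSpace.single 0 s : E (d + 1))‖ ^ 2 = s ^ 2 := by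
    rw [PiLp.norm_single, Real.norm_eq_abs, sq_abs]
  have h2 : ‖(p : E (d + 1)) + EuclideanSpace.single 0 s‖ ^ 2 =
      1 + 2 * s * (p : E (d + 1)) 0 + s ^ 2 := by
    rw [norm_add_sq_real, h1, sph_norm_eq, EuclideanSpace.inner_single_right]
    simp
    ring
  rw [boostFun, h1, h2]
  simp [mul_add]

/-- A compact set which avoids the point at infinity can be moved into the upper hemisphere by an
automorphism that fixes this point. -/
theorem SphAut.exists_compression {K : Set (Sph d)} (hK : IsCompact K) (hN : infty d ∉ K) :
    ∃ φ : SphAut d, φ.IsInvertible ∧ φ.toDiffeo (infty d) = infty d ∧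
      ∀ p ∈ K, 0 ≤ (φ.toDiffeo p : E (d + 1)) 0 := by
  have hc : Continuous fun p : Sph d => (p : E (d + 1)) 0 := by fun_prop
  have hgt : ∀ p : Sph d, p ≠ infty d → -1 < (p : E (d + 1)) 0 := fun p hp => by
    have h1 := normSq_sub_infty p
    have h2 : 0 < ‖(p : E (d + 1)) - infty d‖ ^ 2 :=
      pow_pos (norm_pos_iff.2 (sub_ne_zero.2 fun e => hp (Subtype.ext e))) 2
    linarith
  obtain ⟨m, hm, hmK⟩ := hK.exists_forall_le' hc.continuousOn (a := -1)
    fun p hp => hgt p fun e => hN (e ▸ hp)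
  -- With `s = 1 - t`, the boost along the axis makes heights at least `-2 * s / (1 + s ^ 2)`
  -- nonnegative. This threshold exceeds `-1` by `t ^ 2 / (1 + s ^ 2)`, which is smaller than `2 * t
  -- ≤ 1 + m`.
  obtain ⟨t, ht, ht1, htm⟩ : ∃ t : ℝ, 0 < t ∧ t ≤ 1 / 2 ∧ t ≤ (1 + m) / 2 :=
    ⟨_, lt_min one_half_pos (by linarith), min_le_left _ _, min_le_right _ _⟩
  have hs : ‖(EuclideanSpace.single 0 (1 - t) : E (d + 1))‖ < 1 := by
    rw [PiLp.norm_single, Real.norm_of_nonneg (by linarith)]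
    linarith
  refine ⟨SphAut.boost _ hs, SphAut.isInvertible_boost _ hs, ?_, fun p hp => ?_⟩
  · rw [eq_infty_iff, SphAut.boost_apply, boostFun_single_zero, infty_zero]
    have : (1 : ℝ) + 2 * (1 - t) * -1 + (1 - t) ^ 2 = t ^ 2 := by ring
    rw [this]
    field_simp
    ring
  · have h1 := hmK p hp
    have h0 : 0 < 1 + 2 * (1 - t) * (p : E (d + 1)) 0 + (1 - t) ^ 2 := by nlinarith
    rw [SphAut.boost_apply, boostFun_single_zero, div_mul_eq_mul_div, ← sub_neg_eq_add,
      sub_nonneg, ← neg_div, div_le_iff₀ h0]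
    nlinarith

/-- `β` moves `q` to infinity and the configuration `f` to the configuration `g` in the disk. -/
structure IsNormalization {n : ℕ} (f : SConf d n) (q : Sph d) (β : SphAut d) (g : CE d n) : Prop where
  apply_eq : β.toDiffeo q = infty d
  act_eq : β.act f = g.toSphere

theorem exists_isNormalization (hd : 1 ≤ d) {n : ℕ} {f : SConf d n} {F : Fin n → E d → Sph d}
    {V : Fin n → Set (E d)} (h : IsRep (SphConf (d := d)) Set.univ F V)
    (hf : ∀ i, f.1 i = (F i : DGerm d (Sph d))) {q : Sph d} (hq : ∀ i, q ∉ F i '' cDisk d) :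
    ∃ β : SphAut d, β.IsInvertible ∧ ∃ g, IsNormalization f q β g := by
  obtain ⟨φ, hφ, hφq⟩ := SphAut.exists_apply_eq hd q (infty d)
  have hK : IsCompact (⋃ i, φ.toDiffeo '' (F i '' cDisk d)) := isCompact_iUnion fun i =>
    ((isCompact_closedBall 0 1).image_of_continuousOn
      ((h.conf i).smooth.continuousOn.mono (h.subset i))).image φ.toDiffeo.continuous
  obtain ⟨ψ, hψ, hψN, hψK⟩ := SphAut.exists_compression hK (by
    rw [Set.mem_iUnion]
    rintro ⟨i, p, hp, e⟩
    exact hq i (φ.toDiffeo.injective (e.trans hφq.symm) ▸ hp))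
  have hβ := hψ.comp hφ
  obtain ⟨β, hβe⟩ : ∃ β, β = ψ.comp φ := ⟨_, rfl⟩
  have hrep : IsRep (SphConf (d := d)) Set.univ (fun i => β.toDiffeo ∘ F i) V :=
    ⟨fun i => β.sphConf (h.conf i), h.subset,
      fun i => β.toDiffeo.injective.injOn.comp (h.injOn i) (Set.mapsTo_univ _ _),
      fun i j hij => by
        rw [Set.image_comp, Set.image_comp]
        exact (Set.disjoint_image_iff β.toDiffeo.injective).2 (h.disjoint i j hij),
      fun i => Set.mapsTo_univ _ _⟩
  obtain ⟨g, hg, -⟩ := SConf.exists_toSphere_eq (f := β.act f) hrep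
    (fun i => congrArg (Filter.Germ.map β.toDiffeo) (hf i)) fun i x hx => by
      rw [hβe]
      exact hψK _ (Set.mem_iUnion.2 ⟨i, _, ⟨x, hx, rfl⟩, rfl⟩)
  refine ⟨β, hβe ▸ hβ, g, ?_, hg⟩
  rw [hβe, SphAut.comp_apply, hφq, hψN]

/-- A point `F 0 x` with `x` just outside the closed disk but in the domain is missed by the zeroth
disk by injectivity and by the others by disjointness. -/
theorem exists_notMem_disks (hd : 1 ≤ d) {n : ℕ} {F : Fin n → E d → Sph d}
    {V : Fin n → Set (E d)} (h : IsRep (SphConf (d := d)) Set.univ F V) :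
    ∃ q : Sph d, ∀ i, q ∉ F i '' cDisk d := by
  rcases n with - | n
  · exact ⟨infty d, fun i => i.elim0⟩
  obtain ⟨e, he, -⟩ := exists_unit_orthogonal (d := d) (n := 0) hd Fin.elim0
  have heV : e ∈ V 0 := h.subset 0 (mem_closedBall_zero_iff.2 he.le)
  obtain ⟨ε, hε, hV⟩ := Metric.isOpen_iff.1 (h.conf 0).isOpen e heV
  obtain ⟨x, hx⟩ : ∃ x : E d, x = (1 + ε / 2) • e := ⟨_, rfl⟩
  have hxV : x ∈ V 0 := hV (by
    rw [mem_ball_iff_norm, hx, add_smul, one_smul, add_sub_cancel_left, norm_smul, he,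
      Real.norm_of_nonneg (by positivity)]
    linarith)
  have hx1 : x ∉ cDisk d := by
    rw [mem_closedBall_zero_iff, hx, norm_smul, he, Real.norm_of_nonneg (by positivity)]
    linarith
  refine ⟨F 0 x, fun i => ?_⟩
  rintro ⟨y, hy, e⟩
  by_cases hi : i = 0
  · subst hi
    exact hx1 (h.injOn 0 (h.subset 0 hy) hxV e ▸ hy)
  · exact Set.disjoint_left.1 (h.disjoint i 0 hi) ⟨y, h.subset i hy, rfl⟩ ⟨x, hxV, e.symm⟩

theorem CE.toSphere_coe {n : ℕ} {f : CE d n} {i : Fin n} {F : E d → E d}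
    (hf : f.1 i = (F : DGerm d (E d))) :
    f.toSphere.1 i = ((fun x => stereo d (F x) : E d → Sph d) : DGerm d (Sph d)) :=
  congrArg (Filter.Germ.map (stereo d)) hf

theorem SphAut.act_coe {n : ℕ} (φ : SphAut d) {f : SConf d n} {i : Fin n} {F : E d → Sph d}
    (hf : f.1 i = (F : DGerm d (Sph d))) :
    (φ.act f).1 i = ((fun x => φ.toDiffeo (F x) : E d → Sph d) : DGerm d (Sph d)) :=
  congrArg (Filter.Germ.map φ.toDiffeo) hf

/-- An automorphism of the sphere that maps a configuration in the disk to another one. -/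
theorem CE.coe_of_act_toSphere_eq {n : ℕ} {f g : CE d n} {α : SphAut d}
    (h : α.act f.toSphere = g.toSphere) {i : Fin n} {F G : E d → E d}
    (hf : f.1 i = (F : DGerm d (E d))) (hG : g.1 i = (G : DGerm d (E d))) :
    ∀ᶠ x in 𝓝ˢ (cDisk d), α.toDiffeo (stereo d (F x)) = stereo d (G x) := by
  have h1 := congrArg (fun k : SConf d n => k.1 i) h
  rw [α.act_coe (CE.toSphere_coe hf), CE.toSphere_coe hG] at h1
  exact Filter.Germ.coe_eq.1 h1

variable {V : Type*} [NormedAddCommGroup V] [InnerProductSpace ℂ V] {A : CEAlgebra d V}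
  {Φ : HilbertFiltration A}

theorem CondD.vev_eq_of_fix_infty (hD : CondD Φ) (hU : CondU Φ) (hd : 2 ≤ d) {n : ℕ} {f g : CE d n}
    {α : SphAut d} (hα : α.toDiffeo (infty d) = infty d) (h : α.act f.toSphere = g.toSphere) :
    A.vev g = A.vev f := by
  obtain ⟨μ, hμ, O, hO, w, hw⟩ := α.exists_similarity hd hα
  obtain ⟨F, V, -, hF⟩ := f.2
  obtain ⟨G, W, -, hG⟩ := g.2
  refine hD.vev_similarity hU hμ hO w hF fun i => (hG i).trans (Filter.Germ.coe_eq.2 ?_)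
  filter_upwards [CE.coe_of_act_toSphere_eq h (hF i) (hG i)] with x hx
  rw [hw] at hx
  exact (stereo_injective d hx).symm

/-- Two normalizations at the same point differ by `β' ∘ β⁻¹`, which fixes infinity, so Liouville's
theorem applies. -/
theorem IsNormalization.vev_eq (hD : CondD Φ) (hU : CondU Φ) (hd : 2 ≤ d) {n : ℕ} {f : SConf d n}
    {q : Sph d} {β β' : SphAut d} {g g' : CE d n} (hβ : β.IsInvertible)
    (h : IsNormalization f q β g) (h' : IsNormalization f q β' g') : A.vev g' = A.vev g := by
  obtain ⟨ψ, hψ⟩ := hβ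
  refine hD.vev_eq_of_fix_infty hU hd (α := β'.comp ψ) ?_ ?_
  · rw [SphAut.comp_apply, ← h.apply_eq, hψ, h'.apply_eq, h.apply_eq]
  · rw [← h.act_eq, SphAut.comp_act, SphAut.act_eq_of_leftInverse hψ, h'.act_eq]

theorem exists_ballBoost_eq_infty {p : Sph d} (hp : (p : E (d + 1)) 0 < 0) :
    ∃ (b : E d) (hb : ‖b‖ < 1), (SphAut.ballBoost b hb).toDiffeo p = infty d := by
  have hp1 : 0 < 1 - (p : E (d + 1)) 0 := by linarith
  -- This is the stereographic coordinate of `-p`. The pole of the translation by `b` is the inverse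
  -- point `-b / ‖b‖ ^ 2`, which is the coordinate of `p` itself (for `b = 0`, `p` is already
  -- infinity); `‖b‖ < 1` says that `p` is in the lower hemisphere.
  let b : E d := WithLp.toLp 2 fun i => -((p : E (d + 1)) i.succ / (1 - (p : E (d + 1)) 0))
  have hs := sph_sq_add_sum_sq p
  have hb2 : ‖b‖ ^ 2 = (1 + (p : E (d + 1)) 0) / (1 - (p : E (d + 1)) 0) := by
    have e : ∀ i, b i ^ 2 = (p : E (d + 1)) i.succ ^ 2 / (1 - (p : E (d + 1)) 0) ^ 2 := fun i => by
      simp only [b, neg_sq, div_pow]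
    rw [EuclideanSpace.real_norm_sq_eq, Finset.sum_congr rfl fun i _ => e i, ← Finset.sum_div,
      eq_sub_of_add_eq' hs]
    field_simp
    ring
  have hb : ‖b‖ < 1 := by
    have : ‖b‖ ^ 2 < 1 := by
      rw [hb2, div_lt_one hp1]
      linarith
    nlinarith [norm_nonneg b]
  refine ⟨b, hb, ?_⟩
  have hin : ⟪(p : E (d + 1)), eqLift b⟫_ℝ = -(1 + (p : E (d + 1)) 0) := by
    have e : ∀ i, b i * (p : E (d + 1)) i.succ =
        -((p : E (d + 1)) i.succ ^ 2 / (1 - (p : E (d + 1)) 0)) := fun i => by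
      simp only [b]
      ring
    rw [inner_eqLift, Finset.sum_congr rfl fun i _ => e i, Finset.sum_neg_distrib,
      ← Finset.sum_div, eq_sub_of_add_eq' hs]
    field_simp
    ring
  have hn : ‖(p : E (d + 1)) + eqLift b‖ ^ 2 =
      2 * (p : E (d + 1)) 0 ^ 2 / (1 - (p : E (d + 1)) 0) := by
    rw [norm_add_sq_real, normSq_eqLift, hin, hb2, sph_norm_eq]
    field_simp
    ring
  rw [eq_infty_iff, SphAut.boost_apply, boostFun, hn, normSq_eqLift, hb2]
  simp only [PiLp.add_apply, PiLp.smul_apply, eqLift, Matrix.cons_val_zero, smul_eq_mul]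
  have := hp.ne
  field_simp
  ring

/-- The boost with parameter zero serves as the identity automorphism. -/
theorem SphAut.boost_zero_act {n : ℕ} (f : SConf d n) :
    (SphAut.boost (0 : E (d + 1)) (by simp)).act f = f := by
  have e : (SphAut.boost (0 : E (d + 1)) (by simp)).toDiffeo = (id : Sph d → Sph d) := funext fun p => by
    refine Subtype.ext ?_
    rw [SphAut.boost_apply, boostFun]
    simp
  refine Subtype.ext (funext fun i => ?_)
  change (f.1 i).map (SphAut.boost (0 : E (d + 1)) (by simp)).toDiffeo = f.1 i
  rw [e, Filter.Germ.map_id, id]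

/-- Vacuum expectation values are invariant under automorphisms of the sphere. -/
theorem CondD.vev_eq_of_act (hD : CondD Φ) (hU : CondU Φ) (hd : 2 ≤ d) {n : ℕ} {f g : CE d n}
    {α : SphAut d} (h : α.act f.toSphere = g.toSphere) : A.vev g = A.vev f := by
  obtain ⟨F, V, hrep, hF⟩ := f.2
  obtain ⟨G, W, hrep', hG⟩ := g.2
  obtain ⟨FS, VS, hrepS, hFS⟩ := f.toSphere.2
  have hev : ∀ i, ∀ x ∈ cDisk d, FS i x = stereo d (F i x) := fun i x hx =>
    (Filter.Germ.coe_eq.1 ((hFS i).symm.trans (CE.toSphere_coe (hF i)))).self_of_nhdsSet hx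
  let U : Set (Sph d) := (⋃ i ∈ (Finset.univ : Finset (Fin n)), stereo d '' (F i '' cDisk d))ᶜ
  have hUpre : IsPreconnected U := isPreconnected_compl_disks hd hrep Finset.univ
  have hmemU : ∀ q : Sph d, (∀ i, ∀ x ∈ cDisk d, q ≠ stereo d (F i x)) → q ∈ U := by
    intro q hq
    simp only [U, Set.mem_compl_iff, Set.mem_iUnion, not_exists]
    rintro i - ⟨_, ⟨x, hx, rfl⟩, e⟩
    exact hq i x hx e.symm
  have hUmem : ∀ q ∈ U, ∀ i, q ∉ FS i '' cDisk d := by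
    rintro q hq i ⟨x, hx, rfl⟩
    refine hq (Set.mem_iUnion₂.2 ⟨i, Finset.mem_univ i, F i x, ⟨x, hx, rfl⟩, (hev i x hx).symm⟩)
  have hex := fun q hq => exists_isNormalization (by omega : 1 ≤ d) hrepS hFS (hUmem q hq)
  -- The relation compares all normalizations of `f` at two points; it is shown to hold locally and
  -- is then propagated over the connected set `U`.
  let P : Sph d → Sph d → Prop := fun q q' => ∀ β g β' g', IsNormalization f.toSphere q β g →
    IsNormalization f.toSphere q' β' g' → A.vev g' = A.vev g
  have hP : ∀ q ∈ U, ∀ᶠ q' in 𝓝[U] q, P q q' := by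
    intro q hq
    obtain ⟨β, hβ, k, hk⟩ := hex q hq
    -- For `q'` near `q` the image `β q'` is in the open lower hemisphere. A hyperbolic translation
    -- of the ball brings it to infinity while keeping the configuration in the disk and its value
    -- unchanged.
    have hopen : {q' | (β.toDiffeo q' : E (d + 1)) 0 < 0} ∈ 𝓝 q := by
      refine IsOpen.mem_nhds (isOpen_lt ?_ continuous_const) ?_
      · have hc : Continuous fun p : Sph d => (p : E (d + 1)) 0 := by fun_prop
        exact hc.comp β.toDiffeo.continuous
      · change (β.toDiffeo q : E (d + 1)) 0 < 0
        rw [hk.apply_eq, infty_zero]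
        norm_num
    filter_upwards [mem_nhdsWithin_of_mem_nhds hopen] with q' hq' β₁ g₁ β₂ g₂ h₁ h₂
    obtain ⟨b, hb, hbq⟩ := exists_ballBoost_eq_infty hq'
    obtain ⟨k', hk', hk'F⟩ := hU.exists_ballMap_comp hb k
    obtain ⟨K, -, -, hK⟩ := k.2
    have h3 : IsNormalization f.toSphere q' ((SphAut.ballBoost b hb).comp β) k' := by
      refine ⟨hbq, ?_⟩
      rw [SphAut.comp_act, hk.act_eq]
      refine Subtype.ext (funext fun i => ?_)
      rw [SphAut.act_coe _ (CE.toSphere_coe (hK i)), CE.toSphere_coe (hk'F i _ (hK i))]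
      refine Filter.Germ.coe_eq.2 ?_
      have ht := CE.tendsto k i
      rw [hK i] at ht
      have ht' : Filter.Tendsto (K i) (𝓝ˢ (cDisk d)) (𝓝ˢ (cDisk d)) := ht
      filter_upwards [ht'.eventually (eventually_ballDenom_pos hb)] with x hx
      exact SphAut.ballBoost_stereo hb hx
    rw [h3.vev_eq hD hU hd ((SphAut.isInvertible_boost _ _).comp hβ) h₂, hk',
      hk.vev_eq hD hU hd hβ h₁]
  have hPP : ∀ q ∈ U, ∀ q' ∈ U, P q q' := fun q hq q' hq' =>
    -- Transitivity needs some normalization at the middle point, which `hex` supplies.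
    hUpre.induction₂ P hP (fun x y z _ hy _ hxy hyz β g β' g' h₁ h₂ => by
      obtain ⟨β₀, -, g₀, h₀⟩ := hex y hy
      rw [hyz β₀ g₀ β' g' h₀ h₂, hxy β g β₀ g₀ h₁ h₀])
      (fun x y _ _ hxy β g β' g' h₁ h₂ => (hxy β' g' β g h₂ h₁).symm) hq hq'
  -- The identity normalizes `f` at infinity with result `f`, and `α` normalizes it at `α⁻¹ ∞` with
  -- result `g`. Both points are uncovered: `stereo` never takes the value infinity, and `α` carries
  -- the disks of `f` onto those of `g`.
  refine hPP (infty d) (hmemU _ fun i x _ e => stereo_ne_infty _ e.symm)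
    (α.toDiffeo.symm (infty d)) (hmemU _ fun i x hx e => ?_)
    (SphAut.boost (0 : E (d + 1)) (by simp)) f α g ⟨?_, SphAut.boost_zero_act _⟩
    ⟨α.toDiffeo.apply_symm_apply _, h⟩
  · have h1 := (CE.coe_of_act_toSphere_eq h (hF i) (hG i)).self_of_nhdsSet x hx
    rw [← e, α.toDiffeo.apply_symm_apply] at h1
    exact stereo_ne_infty _ h1.symm
  · refine Subtype.ext ?_
    rw [SphAut.boost_apply, boostFun]
    simp

/-! ## Compatibility with composition -/

theorem germ_map_compTendsto' {Y Z : Type} (r : Y → Z) (f : DGerm d Y) (g : DGerm d (E d))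
    (hg : g.Tendsto (𝓝ˢ (cDisk d))) :
    (f.compTendsto' g hg).map r = (f.map r).compTendsto' g hg := by
  induction f using Filter.Germ.inductionOn with
  | _ F =>
    revert hg
    induction g using Filter.Germ.inductionOn with
    | _ G => exact fun _ => rfl

theorem SphAut.act_circ {n m N : ℕ} (hN : N + 1 = n + m) (φ : SphAut d) (f : SConf d n) (i : Fin n)
    (g : CE d m) : φ.act (f.circ hN i g) = (φ.act f).circ hN i g := by
  refine Subtype.ext (funext fun k => ?_)
  refine (splice_map hN i f.1
    (fun k => (f.1 i).compTendsto' (g.1 k) (CE.tendsto g k)) (Filter.Germ.map φ.toDiffeo) k).trans ?_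
  simp only [germ_map_compTendsto']
  rfl

theorem CE.toSphere_circ {n m N : ℕ} (hN : N + 1 = n + m) (f : CE d n) (i : Fin n)
    (g : CE d m) : (f.circ hN i g).toSphere = f.toSphere.circ hN i g := by
  refine Subtype.ext (funext fun k => ?_)
  refine (splice_map hN i f.1
    (fun k => (f.1 i).compTendsto' (g.1 k) (CE.tendsto g k)) (Filter.Germ.map (stereo d)) k).trans ?_
  simp only [germ_map_compTendsto']
  rfl

theorem SConf.exists_act_eq (hd : 1 ≤ d) {n : ℕ} (f : SConf d n) :
    ∃ (β : SphAut d) (g : CE d n), β.IsInvertible ∧ β.act f = g.toSphere := by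
  obtain ⟨F, V, h, hf⟩ := f.2
  obtain ⟨q, hq⟩ := exists_notMem_disks hd h
  obtain ⟨β, hβ, g, hg⟩ := exists_isNormalization hd h hf hq
  exact ⟨β, g, hβ, hg.act_eq⟩

theorem HilbertFiltration.tensorBounded_vev (Φ : HilbertFiltration A) {n : ℕ} (g : CE d n)
    (k : Fin n → ℕ) : TensorBounded (fun i => Φ.H (k i)) (A.vev g) := by
  obtain ⟨K, hK⟩ := Φ.bounded n k
  obtain ⟨C, hC⟩ := (hK g).2
  refine ⟨‖A.vacuum‖ * C, fun N v hv => ?_⟩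
  simp only [A.vev_apply]
  rw [← inner_sum, mul_assoc]
  refine (norm_inner_le_norm _ _).trans ?_
  gcongr
  exact hC N v hv

end

end ConfDisk

end


/-! ### Construction and uniqueness of the state -/

theorem mainTheorem6 {d : ℕ} (hd : 2 ≤ d) {V : Type*} [NormedAddCommGroup V]
    [InnerProductSpace ℂ V] (A : ConfDisk.CEAlgebra d V) (Φ : ConfDisk.HilbertFiltration A)
    (hU : ConfDisk.CondU Φ) (hD : ConfDisk.CondD Φ) :
    ∃ S : ConfDisk.SphState A,
      (S.Invariant ∧ S.ExtendsVacuum) ∧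
      (∀ S' : ConfDisk.SphState A, S'.Invariant → S'.ExtendsVacuum → S' = S) ∧
      S.IsContinuous Φ ∧
      (Nontrivial V → S.χ 0 (ConfDisk.Config.empty _ _) ≠ 0) := by
  have hex := fun (n : ℕ) (f : ConfDisk.SConf d n) => f.exists_act_eq (by omega : 1 ≤ d)
  choose β g hβ hg using hex
  -- Independence of the chosen normalization. All properties of the state follow by picking a
  -- convenient normalization: for a composition or a permutation, the one already chosen for `f`.
  have key : ∀ (n : ℕ) (f : ConfDisk.SConf d n) (α : ConfDisk.SphAut d) (k : ConfDisk.CE d n),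
      α.act f = k.toSphere → A.vev (g n f) = A.vev k := fun n f α k h => by
    obtain ⟨ψ, hψ⟩ := hβ n f
    refine (hD.vev_eq_of_act hU hd (α := α.comp ψ) ?_).symm
    rw [← hg, ConfDisk.SphAut.comp_act, ConfDisk.SphAut.act_eq_of_leftInverse hψ, h]
  let S : ConfDisk.SphState A :=
    { χ := fun n f => A.vev (g n f)
      map_circ := fun {n m N} hN f i ψ a => by
        rw [key N _ (β n f) ((g n f).circ hN i ψ) (by
          rw [ConfDisk.SphAut.act_circ, hg, ConfDisk.CE.toSphere_circ]), A.vev_apply, A.map_circ,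
          A.vev_apply]
      map_perm := fun {n} f σ a => by
        rw [key n (f.perm σ) (β n f) ((g n f).perm σ)
          (congrArg (fun k : ConfDisk.SConf d n => k.perm σ) (hg n f)), A.vev_apply, A.map_perm,
          A.vev_apply] }
  have hvac : S.ExtendsVacuum := fun n f a =>
    congrArg (fun T => T a) (key n f.toSphere (ConfDisk.SphAut.boost 0 (by simp)) f
      (ConfDisk.SphAut.boost_zero_act _))
  refine ⟨S, ⟨fun n φ f => ?_, hvac⟩, fun S' hinv hvac' => ?_,
    fun n f k => Φ.tensorBounded_vev (g n f) k, fun _ => ?_⟩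
  · exact (key n f ((β n (φ.act f)).comp φ) _ (by rw [ConfDisk.SphAut.comp_act, hg])).symm
  -- Invariance moves `f` into the disk, where the vacuum formula determines the value.
  · have h : S'.χ = S.χ := by
      funext n f
      ext a
      rw [← hinv n (β n f) f, hg, hvac']
      rfl
    cases S'
    cases h
    rfl
  -- On the empty configuration the vacuum formula reads `⟪1, 1⟫`.
  · have h1 := hvac 0 (ConfDisk.Config.empty _ _) ![]
    have h2 : (ConfDisk.CE.toSphere (ConfDisk.Config.empty _ _ : ConfDisk.CE d 0)) =
        ConfDisk.Config.empty _ _ := Subtype.ext (funext fun i => i.elim0)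
    rw [h2] at h1
    intro h3
    rw [h3] at h1
    have h4 : A.vacuum = 0 := inner_self_eq_zero.1 h1.symm
    exact hD.vacuum_ne_zero (by omega) h4
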